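/- **Processes and types.** Value types are $U ::= C\multimap\diamond \mid C\to\diamond$, name types are $C ::= S \mid \langle U\rangle$, and session types are $S ::= \mathsf{end}\mid\, !\langle U\rangle;S\mid\, ?(U);S\mid \oplus\{l:S_l\}_{l\in I}\mid \&\{l:S_l\}_{l\in I}$ ($I$ a finite set of labels), with the usual duality $\overline S$. Values and processes are $$V ::= x\mid \lambda y{:}C^{m}.P,\qquad P ::= u!\langle V\rangle.P\mid u?(x).P\mid u\triangleleft l.P\mid u\triangleright\{l:P_l\}_{l\in I}\mid V\,u\mid P\mid P'\mid(\nu s{:}S)P\mid(\nu a{:}\langle U\rangle)P\mid\mathbf 0,$$ where $m\in\{\multimap,\to\}$, a name $u$ is a session name $s$ or $\overline s$, a shared name $a$, or a parameter $y$ of an abstraction, and prefixes and applications are annotated with the type that their subject (their argument) has at that point. $\mathsf{fv}(\cdot)$ denotes the free variables that stand for values. Judgements $\Gamma;\Lambda;\Delta\vdash P\triangleright\diamond$ and $\Gamma;\Lambda;\Delta\vdash V\triangleright U$ have a shared environment $\Gamma$ (assignments $x:C\to\diamond$ and $u:\langle U\rangle$), a linear environment $\Lambda$ (assignments $x:C\multimap\diamond$)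 and a session environment $\Delta$ (assignments $u:S$). They are given by the usual rules of the higher-order session calculus HO: linear and shared variables, session and shared names; linear abstraction; promotion (a linear abstraction that is typed with empty $\Lambda$ and $\Delta$ has the type $C\to\diamond$); use of a shared variable $x:C\to\diamond$ of $\Gamma$ as a linear one in a process; weakening of $\Delta$ by $u:\mathsf{end}$; inaction, application, parallel composition and restriction, where $\Lambda$ and $\Delta$ are split; output and input on session names and on shared names (the value sent on a shared name has an empty $\Lambda$); selection; and branching over a non-empty set of labels. A session environment is *balanced* if $u:S$ and $\overline u:S'$ in it imply $S'=\overline S$. **Minimal types and decomposition.** Minimal session types are $M ::= \mathsf{end}\mid\, !\langle\widetilde U\rangle;\mathsf{end}\mid\,?(\widetilde U);\mathsf{end}\mid\oplus\{l:M_l\}_{l\in I}\mid\&\{l:M_l\}_{l\in I}$, over value types $\widetilde C\multimap\diamond$ and $\widetilde C\to\diamond$ with non-empty tuples of name types $C ::= M\mid\langle U\rangle$. The polyadic calculus with these types has the same rules, with polyadic session communication and application. The decomposition $\mathcal G$ is $$\mathcal G(C\multimap\diamond)=\mathcal G(C)\multimap\diamond,\quad \mathcal G(C\to\diamond)=\mathcal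 G(C)\to\diamond,\quad \mathcal G(\langle U\rangle)=\langle\mathcal G(U)\rangle,\quad\mathcal G(\mathsf{end})=\mathsf{end},$$ $$\mathcal G(!\langle U\rangle;S)=\,!\langle\mathcal G(U)\rangle;\mathsf{end}\,,\ \mathcal G(S)\qquad \mathcal G(?(U);S)=\,?(\mathcal G(U));\mathsf{end}\,,\ \mathcal G(S)\qquad(\mathcal G(S)\text{ is omitted if }S=\mathsf{end}),$$ $$\mathcal G(\oplus\{l:S_l\})=\oplus\{l:\,?(\mathcal G(\overline{S_l})\multimap\diamond);\mathsf{end}\},\qquad \mathcal G(\&\{l:S_l\})=\&\{l:\,!\langle\mathcal G(S_l)\multimap\diamond\rangle;\mathsf{end}\}.$$ On $\Gamma$ and $\Lambda$ it acts on the types; on $\Delta$ it replaces $u_i:S$ by $u_i:M_1,\dots,u_{i+n-1}:M_n$, where $\mathcal G(S)=(M_1,\dots,M_n)$. A process or value is *initialized* if each of its free names has an index $i\ge1$. **Degree.** $|x|=0$, $|\lambda y{:}C^{\multimap}.P|=|P|$, $|\lambda y{:}C^{\to}.P|=0$; $|u!\langle V\rangle.P|=|V|+|P|+1$, $|u?(x).P|=|P|+1$,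 $|u\triangleleft l.P|=|P|+2$, $|u\triangleright\{l:P_l\}|=1$, $|V\,u|=|V|+1$, $|P\mid Q|=|P|+|Q|+1$, $|(\nu n)P|=|P|$, $|\mathbf 0|=1$. **Breakdown.** Let $c_k,\overline{c_k}$ ($k\ge1$), the *propagators*, be reserved session names. Let $\sigma=\{u_{i+1}/u_i\}$ if the subject $u_i$ has a session type at that point and let $\sigma$ be the identity otherwise; $|T|$ is the length of a tuple $T$; and each of $\widetilde w=\mathsf{fv}(V)$, $\widetilde y=\mathsf{fv}(Q)$, $\widetilde z=\mathsf{fv}(R)$, $\widetilde x_l=\mathsf{fv}(P_l)$ is listed as a tuple. For a tuple $\widetilde x$ of variables, put $$\mathcal B^k_{\tilde x}(u_i!\langle V\rangle.Q)=c_k?(\widetilde x).u_i!\langle\mathcal V^{k+1}_{\tilde w}(V\sigma)\rangle.\overline{c_{k+|V|+1}}!\langle\widetilde y\rangle.\mathbf 0\ \mid\ \mathcal B^{k+|V|+1}_{\tilde y}(Q\sigma),$$ $$\mathcal B^k_{\tilde x}(u_i?(v).Q)=c_k?(\widetilde x).u_i?(v).\overline{c_{k+1}}!\langle\widetilde y\rangle.\mathbf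 0\ \mid\ \mathcal B^{k+1}_{\tilde y}(Q\sigma),$$ $$\mathcal B^k_{\tilde x}(V\,u_i)=c_k?(\widetilde x).\mathcal V^{k+1}_{\tilde x}(V)\,(u_i,\dots,u_{i+|\mathcal G(C)|-1})\quad\text{where }u_i:C,$$ $$\mathcal B^k_{\tilde x}(Q\mid R)=c_k?(\widetilde x).\overline{c_{k+1}}!\langle\widetilde y\rangle.\overline{c_{k+|Q|+1}}!\langle\widetilde z\rangle.\mathbf 0\ \mid\ \mathcal B^{k+1}_{\tilde y}(Q)\ \mid\ \mathcal B^{k+|Q|+1}_{\tilde z}(R),$$ $$\mathcal B^k_{\tilde x}((\nu s{:}S)P)=(\nu\,s_1\dots s_{|\mathcal G(S)|}{:}\mathcal G(S))\,\mathcal B^k_{\tilde x}(P\{s_1\overline{s_1}/s\overline s\}),\qquad \mathcal B^k_{\tilde x}((\nu a{:}\langle U\rangle)P)=(\nu a_1{:}\mathcal G(\langle U\rangle))\,\mathcal B^k_{\tilde x}(P\{a_1/a\}),$$ $$\mathcal B^k_{\tilde x}(\mathbf 0)=c_k?().\mathbf 0,$$ $$\mathcal B^k_{\tilde x}(u_i\triangleleft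 l.P)=c_k?(\widetilde x).\overline{c_{k+1}}!\langle N\rangle.\mathbf 0\ \mid\ (\nu\widetilde s{:}\mathcal G(S_l))\big(c_{k+1}?(z).z\,\widetilde{\overline s}\ \mid\ \mathcal B^{k+2}_{\tilde x}(P\{s_1/u_i\})\big)$$ with $u_i:\oplus\{l:S_l\}$, a fresh $\widetilde s=(s_1,\dots,s_{|\mathcal G(S_l)|})$ and $N=\lambda\widetilde y{:}\mathcal G(\overline{S_l})^{\multimap}.\,u_i\triangleleft l.u_i?(z).\overline{c_{k+2}}!\langle\widetilde x\rangle.z\,\widetilde y$, where $\widetilde y=(y_1,\dots,y_{|\mathcal G(S_l)|})$ and $z$ are fresh; $$\mathcal B^k_{\tilde x}(u_i\triangleright\{l:P_l\}_{l\in I})=c_k?(\widetilde x).u_i\triangleright\{l:u_i!\langle N_l\rangle.\mathbf 0\}_{l\in I}$$ with $u_i:\&\{l:S_l\}$ and $N_l=\lambda\widetilde y{:}\mathcal G(S_l)^{\multimap}.(\nu c_{k+1},\dots,c_{k+|P_l|})\big(\overline{c_{k+1}}!\langle\widetilde x_l\rangle.\mathbf 0\mid\mathcal B^{k+1}_{\tilde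 x_l}(P_l\{y_1/u_i\})\big)$, where $\widetilde y=(y_1,\dots,y_{|\mathcal G(S_l)|})$ is fresh. On values, $\mathcal V^k_{\tilde x}(x)=x$ and $$\mathcal V^k_{\tilde x}(\lambda y{:}C^{\multimap}.P)=\lambda(y_1,\dots,y_{|\mathcal G(C)|}){:}\mathcal G(C)^{\multimap}.\big(\overline{c_k}!\langle\widetilde x\rangle.\mathbf 0\mid\mathcal B^k_{\tilde x}(P\{y_1/y\})\big),$$ $$\mathcal V^k_{\tilde x}(\lambda y{:}C^{\to}.P)=\lambda(y_1,\dots,y_{|\mathcal G(C)|}){:}\mathcal G(C)^{\to}.(\nu c_k,\dots,c_{k+|P|-1})\big(\overline{c_k}!\langle\widetilde x\rangle.\mathbf 0\mid\mathcal B^k_{\tilde x}(P\{y_1/y\})\big).$$ When the tuple that is exchanged on a propagator is empty, an irrelevant value $\lambda y.\mathbf 0$ of type $\mathsf{end}\to\diamond$ is exchanged instead. Accordingly, for a tuple $\widetilde M$ of value types let $\widetilde M^{\circ}=\widetilde M$ if $\widetilde M$ is non-empty, and let $\widetilde M^{\circ}$ be the one type $\mathsf{end}\to\diamond$ otherwise.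 **Conventions.** Bound names are pairwise distinct along nested binders and distinct from the names in the domains of $\Gamma$ and $\Delta$; the names in the domains of $\Gamma$ and $\Delta$ are indexed, $\Gamma$ assigns no type to a session name, and the decompositions $\mathcal G(\Gamma)$ and $\mathcal G(\Delta)$ assign types to pairwise distinct names; and no session name is used after its completion: in a prefix $u!\langle V\rangle.Q$ at type $!\langle U\rangle;\mathsf{end}$, or $u?(x).Q$ at type $?(U);\mathsf{end}$, the name $u$ is not free in $V$ and $Q$. **Theorem (Typability of Breakdown).** Let $P$ be an initialized process and $V$ an initialized value of HO with selection and branching, subject to these conventions, let $k>0$, and let $\widetilde x$ be an enumeration of $\mathsf{fv}(P)$ in (1) and of $\mathsf{fv}(V)$ in (2) and (3). 1. If $\Gamma;\Lambda;\Delta\vdash P\triangleright\diamond$, then there is a balanced session environment $\Theta$ with $$\mathcal G(\Gamma\setminus\widetilde x);\emptyset;\mathcal G(\Delta),\Theta\ \vdash\ \mathcal B^k_{\tilde x}(P)\triangleright\diamond,$$ such that $\mathrm{dom}(\Theta)=\{c_k,c_{k+1},\dots,c_{k+|P|-1}\}\cup\{\overline{c_{k+1}},\dots,\overline{c_{k+|P|-1}}\}$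 and $\Theta(c_k)=\,?(\widetilde M^{\circ});\mathsf{end}$, where $\widetilde M=(\mathcal G(\Gamma),\mathcal G(\Lambda))(\widetilde x)$ (in particular, $\Gamma,\Lambda$ assign a type to each variable of $\widetilde x$). 2. If $\Gamma;\Lambda;\Delta\vdash V\triangleright C\multimap\diamond$, then there is a balanced session environment $\Theta$ with $$\mathcal G(\Gamma);\mathcal G(\Lambda);\mathcal G(\Delta),\Theta\ \vdash\ \mathcal V^k_{\tilde x}(V)\triangleright\mathcal G(C)\multimap\diamond,$$ such that $\mathrm{dom}(\Theta)=\{c_k,\dots,c_{k+|V|-1}\}\cup\{\overline{c_k},\dots,\overline{c_{k+|V|-1}}\}$ and, if $|V|>0$, $\Theta(c_k)=\,?(\widetilde M^{\circ});\mathsf{end}$ and $\Theta(\overline{c_k})=\,!\langle\widetilde M^{\circ}\rangle;\mathsf{end}$, where $\widetilde M=(\mathcal G(\Gamma),\mathcal G(\Lambda))(\widetilde x)$ (again, all of $\widetilde x$ is assigned a type). 3. If $\Gamma;\emptyset;\emptyset\vdash V\triangleright C\to\diamond$, then $\mathcal G(\Gamma);\emptyset;\emptyset\vdash\mathcal V^k_{\tilde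 x}(V)\triangleright\mathcal G(C)\to\diamond$. -/

import Mathlib

/-! Higher-order session processes, their session types, minimal session types, and the breakdown
of processes into trios. -/

/-! ## Names and variables -/

/-- Labels of selection and branching. -/
abbrev Label : Type := ℕ

/-- Identifiers of session names and of abstracted names: those that a programmer writes, and a
reserved supply from which the breakdown takes its own bound names. -/
inductive Ident where
  | src (n : ℕ)
  | aux (k : ℕ)
  deriving DecidableEq

/-- What is left of a name when index and polarity are forgotten. -/
inductive Root where
  | shared (a : ℕ)
  | sess (s : Ident)
  | var (y : Ident)
  deriving DecidableEq

/-- Names with an index; index `0` means that the name has no index.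
`shared a i` is the shared name `a_i`; `sess s true i` is the session name `s_i`, and
`sess s false i` is its dual; `var y i` is a variable `y_i` that stands for a name (a parameter of
an abstraction). -/
inductive Name where
  | shared (a : ℕ) (i : ℕ)
  | sess (s : Ident) (p : Bool) (i : ℕ)
  | var (y : Ident) (i : ℕ)
  deriving DecidableEq

namespace Name

def root : Name → Root
  | shared a _ => .shared a
  | sess s _ _ => .sess s
  | var y _ => .var y

def idx : Name → ℕ
  | shared _ i => i
  | sess _ _ i => i
  | var _ i => i

/-- `u_i` becomes `u_{i+j}`. -/
def shift (j : ℕ) : Name → Name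
  | shared a i => shared a (i + j)
  | sess s p i => sess s p (i + j)
  | var y i => var y (i + j)

def IsShared : Name → Prop
  | shared _ _ => True
  | _ => False

def IsSession : Name → Prop
  | sess _ _ _ => True
  | _ => False

/-- The name has an index and does not belong to the reserved supply. -/
def Indexed : Name → Prop
  | shared _ i => 1 ≤ i
  | sess (.src _) _ i => 1 ≤ i
  | var (.src _) i => 1 ≤ i
  | _ => False

/-- The substitution `{v/u}` on names. -/
def subst (u v : Name) : Name → Name := Function.update id u v

/-- The substitution `{u_{i+1}/u_i}`. -/
def incr (u : Name) : Name → Name := subst u (u.shift 1)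

/-- The substitution `{s_1 s̄_1 / s s̄}`. -/
def openSession (s : ℕ) : Name → Name
  | sess t p i => if t = .src s ∧ i = 0 then sess t p 1 else sess t p i
  | u => u

end Name

/-! ## Session types -/

/-- Linear (`⊸`) or shared (`→`). -/
inductive Mode where
  | lin
  | shr
  deriving DecidableEq

mutual
/-- Value types `U`: `C ⊸ ⋄` and `C → ⋄`. -/
inductive HOTy : Type where
  | ho (m : Mode) (C : CTy)
/-- Name types `C`: session types and shared types `⟨U⟩`. -/
inductive CTy : Type where
  | sess (S : STy)
  | chan (U : HOTy)
/-- Session types `S`. A labelled family is a finite set of labels with a type for each of them. -/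
inductive STy : Type where
  | fin
  | out (U : HOTy) (S : STy)
  | inp (U : HOTy) (S : STy)
  | sel (I : Finset Label) (S : I → STy)
  | bra (I : Finset Label) (S : I → STy)
end

namespace STy

def isEnd : STy → Bool
  | fin => true
  | _ => false

/-- The dual of a session type. -/
def dual : STy → STy
  | fin => fin
  | out U S => inp U S.dual
  | inp U S => out U S.dual
  | sel I S => bra I fun l => (S l).dual
  | bra I S => sel I fun l => (S l).dual

end STy

def CTy.isSess : CTy → Bool
  | .sess _ => true
  | .chan _ => false

/-! ## Processes and values (with type annotations) -/

mutual
/-- Values: variables `x`, and abstractions `λ y : C^m. P` of a name parameter `y`. -/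
inductive Val : Type where
  | var (x : ℕ)
  | abs (m : Mode) (y : ℕ) (C : CTy) (P : Proc)
/-- Processes. A prefix or an application is annotated with the type that its subject
(its argument) has at that point; a binder is annotated with the type of the bound name.
`resS s S P` is `(ν s : S) P`, which binds `s` and its dual; `resC a U P` is `(ν a : ⟨U⟩) P`.
Names that are bound in a process are written without an index. -/
inductive Proc : Type where
  | out (u : Name) (C : CTy) (V : Val) (P : Proc)
  | inp (u : Name) (C : CTy) (y : ℕ) (P : Proc)
  | sel (u : Name) (I : Finset Label) (S : I → STy) (l : I) (P : Proc)
  | bra (u : Name) (I : Finset Label) (S : I → STy) (P : I → Proc)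
  | app (V : Val) (u : Name) (C : CTy)
  | par (P Q : Proc)
  | resS (s : ℕ) (S : STy) (P : Proc)
  | resC (a : ℕ) (U : HOTy) (P : Proc)
  | nil
end

/-- The bound occurrence of a parameter `y`. -/
abbrev pname (y : ℕ) : Name := .var (.src y) 0
/-- The bound occurrences of a session name and of its dual. -/
abbrev sname (s : ℕ) (p : Bool) : Name := .sess (.src s) p 0
/-- The bound occurrence of a shared name. -/
abbrev aname (a : ℕ) : Name := .shared a 0

/-- `f`, restricted to the names that are not bound by a binder for the names in `bs`. -/
def Name.avoid (bs : Finset Name) (f : Name → Name) : Name → Name :=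
  fun u => if u ∈ bs then u else f u

mutual
/-- Free variables (that stand for values). -/
def Val.fv : Val → Finset ℕ
  | .var x => {x}
  | .abs _ _ _ P => P.fv
def Proc.fv : Proc → Finset ℕ
  | .out _ _ V P => V.fv ∪ P.fv
  | .inp _ _ y P => P.fv.erase y
  | .sel _ _ _ _ P => P.fv
  | .bra _ I _ P => Finset.univ.biUnion fun l : I => (P l).fv
  | .app V _ _ => V.fv
  | .par P Q => P.fv ∪ Q.fv
  | .resS _ _ P => P.fv
  | .resC _ _ P => P.fv
  | .nil => ∅
end

mutual
/-- Free names, including the free variables that stand for names. -/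
def Val.fn : Val → Finset Name
  | .var _ => ∅
  | .abs _ y _ P => P.fn \ {pname y}
def Proc.fn : Proc → Finset Name
  | .out u _ V P => {u} ∪ V.fn ∪ P.fn
  | .inp u _ _ P => {u} ∪ P.fn
  | .sel u _ _ _ P => {u} ∪ P.fn
  | .bra u I _ P => {u} ∪ Finset.univ.biUnion fun l : I => (P l).fn
  | .app V u _ => V.fn ∪ {u}
  | .par P Q => P.fn ∪ Q.fn
  | .resS s _ P => P.fn \ {sname s true, sname s false}
  | .resC a _ P => P.fn \ {aname a}
  | .nil => ∅
end

mutual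
/-- `V.rename f` replaces each free name `u` of `V` by `f u`. -/
def Val.rename (f : Name → Name) : Val → Val
  | .var x => .var x
  | .abs m y C P => .abs m y C (P.rename (Name.avoid {pname y} f))
def Proc.rename (f : Name → Name) : Proc → Proc
  | .out u C V P => .out (f u) C (V.rename f) (P.rename f)
  | .inp u C y P => .inp (f u) C y (P.rename f)
  | .sel u I S l P => .sel (f u) I S l (P.rename f)
  | .bra u I S P => .bra (f u) I S fun l => (P l).rename f
  | .app V u C => .app (V.rename f) (f u) C
  | .par P Q => .par (P.rename f) (Q.rename f)
  | .resS s S P => .resS s S (P.rename (Name.avoid {sname s true, sname s false} f))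
  | .resC a U P => .resC a U (P.rename (Name.avoid {aname a} f))
  | .nil => .nil
end

mutual
/-- The degree of a value. -/
def Val.degree : Val → ℕ
  | .var _ => 0
  | .abs .lin _ _ P => P.degree
  | .abs .shr _ _ _ => 0
/-- The degree of a process. -/
def Proc.degree : Proc → ℕ
  | .out _ _ V P => V.degree + P.degree + 1
  | .inp _ _ _ P => P.degree + 1
  | .sel _ _ _ _ P => P.degree + 2
  | .bra _ _ _ _ => 1
  | .app V _ _ => V.degree + 1
  | .par P Q => P.degree + Q.degree + 1
  | .resS _ _ P => P.degree
  | .resC _ _ P => P.degree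
  | .nil => 1
end

mutual
/-- Barendregt's convention for the bound names of a value: they differ from the names with a root
in `X`, and from those that are bound around them. -/
def Val.Barendregt (X : Set Root) : Val → Prop
  | .var _ => True
  | .abs _ y _ P => .var (.src y) ∉ X ∧ P.Barendregt (insert (.var (.src y)) X)
def Proc.Barendregt (X : Set Root) : Proc → Prop
  | .out _ _ V P => V.Barendregt X ∧ P.Barendregt X
  | .inp _ _ _ P => P.Barendregt X
  | .sel _ _ _ _ P => P.Barendregt X
  | .bra _ _ _ P => ∀ l, (P l).Barendregt X
  | .app V _ _ => V.Barendregt X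
  | .par P Q => P.Barendregt X ∧ Q.Barendregt X
  | .resS s _ P => .sess (.src s) ∉ X ∧ P.Barendregt (insert (.sess (.src s)) X)
  | .resC a _ P => .shared a ∉ X ∧ P.Barendregt (insert (.shared a) X)
  | .nil => True
end

mutual
/-- A session name does not occur any more after an output or an input that completes its
session, i.e. after which its type is `end`. -/
def Val.NoUseAfterEnd : Val → Prop
  | .var _ => True
  | .abs _ _ _ P => P.NoUseAfterEnd
def Proc.NoUseAfterEnd : Proc → Prop
  | .out u C V P => (∀ U, C = .sess (.out U .fin) → u ∉ V.fn ∧ u ∉ P.fn) ∧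
      V.NoUseAfterEnd ∧ P.NoUseAfterEnd
  | .inp u C _ P => (∀ U, C = .sess (.inp U .fin) → u ∉ P.fn) ∧ P.NoUseAfterEnd
  | .sel _ _ _ _ P => P.NoUseAfterEnd
  | .bra _ _ _ P => ∀ l, (P l).NoUseAfterEnd
  | .app V _ _ => V.NoUseAfterEnd
  | .par P Q => P.NoUseAfterEnd ∧ Q.NoUseAfterEnd
  | .resS _ _ P => P.NoUseAfterEnd
  | .resC _ _ P => P.NoUseAfterEnd
  | .nil => True
end

/-! ## The session type system -/

/-- Shared environments `Γ`: `var x = some C` is the assignment `x : C → ⋄`, and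
`name u = some U` is the assignment `u : ⟨U⟩`. -/
@[ext] structure SCtx where
  var : ℕ → Option CTy
  name : Name → Option HOTy

namespace SCtx

/-- `Γ ∖ xs`. -/
def eraseVars (Γ : SCtx) (xs : Finset ℕ) : SCtx :=
  { Γ with var := fun x => if x ∈ xs then none else Γ.var x }

/-- The shared environment in the scope of a binder for the value variable `y : U`. -/
def bindVar (Γ : SCtx) (y : ℕ) : HOTy → SCtx
  | .ho .shr C => { Γ with var := Function.update Γ.var y (some C) }
  | .ho .lin _ => { Γ with var := Function.update Γ.var y none }

/-- The shared environment in the scope of a binder for the name `u : C`. -/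
def bindName (Γ : SCtx) (u : Name) : CTy → SCtx
  | .chan U => { Γ with name := Function.update Γ.name u (some U) }
  | .sess _ => { Γ with name := Function.update Γ.name u none }

end SCtx

/-- Linear environments `Λ`: `(x, C)` is the assignment `x : C ⊸ ⋄`. -/
abbrev LEnv : Type := Multiset (ℕ × CTy)
/-- Session environments `Δ`. -/
abbrev SEnv : Type := Multiset (Name × STy)

/-- The names or variables to which an environment assigns a type. -/
def keys {α β : Type} (E : Multiset (α × β)) : Multiset α := E.map Prod.fst

/-- The linear assignment made by a binder for `y : U`. -/
def linPart (y : ℕ) : HOTy → LEnv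
  | .ho .lin C => {(y, C)}
  | .ho .shr _ => 0

/-- The session assignment made by a binder for `u : C`. -/
def sessPart (u : Name) : CTy → SEnv
  | .sess S => {(u, S)}
  | .chan _ => 0

/-- `Γ; ∅; Δ ⊢ u ▷ C` for names. -/
inductive HasN : SCtx → SEnv → Name → CTy → Prop where
  | sess {Γ u S} : ¬ u.IsShared → Γ.name u = none → HasN Γ {(u, S)} u (.sess S)
  | sh {Γ u U} : Γ.name u = some U → HasN Γ 0 u (.chan U)

mutual
/-- `Γ; Λ; Δ ⊢ V ▷ U`. -/
inductive HasV : SCtx → LEnv → SEnv → Val → HOTy → Prop where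
  | lvar {Γ x C} : Γ.var x = none → HasV Γ {(x, C)} 0 (.var x) (.ho .lin C)
  | sh {Γ x C} : Γ.var x = some C → HasV Γ 0 0 (.var x) (.ho .shr C)
  | prom {Γ y C P} : HasV Γ 0 0 (.abs .lin y C P) (.ho .lin C) →
      HasV Γ 0 0 (.abs .shr y C P) (.ho .shr C)
  | abs {Γ Λ Δ y C P} :
      HasP (Γ.bindName (pname y) C) Λ (sessPart (pname y) C + Δ) P →
      HasV Γ Λ Δ (.abs .lin y C P) (.ho .lin C)
/-- `Γ; Λ; Δ ⊢ P ▷ ⋄`. -/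
inductive HasP : SCtx → LEnv → SEnv → Proc → Prop where
  | eprom {Γ Λ Δ x C P} : Γ.var x = some C → HasP (Γ.eraseVars {x}) ((x, C) ::ₘ Λ) Δ P →
      HasP Γ Λ Δ P
  | fin {Γ Λ Δ u P} : ¬ u.IsShared → Γ.name u = none → u ∉ keys Δ → HasP Γ Λ Δ P →
      HasP Γ Λ ((u, .fin) ::ₘ Δ) P
  | nil {Γ} : HasP Γ 0 0 .nil
  | app {Γ Λ Δ₁ Δ₂ m V u C} : HasV Γ Λ Δ₁ V (.ho m C) → HasN Γ Δ₂ u C →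
      (keys (Δ₁ + Δ₂)).Nodup → HasP Γ Λ (Δ₁ + Δ₂) (.app V u C)
  | par {Γ Λ₁ Λ₂ Δ₁ Δ₂ P Q} : HasP Γ Λ₁ Δ₁ P → HasP Γ Λ₂ Δ₂ Q →
      (keys (Λ₁ + Λ₂)).Nodup → (keys (Δ₁ + Δ₂)).Nodup →
      HasP Γ (Λ₁ + Λ₂) (Δ₁ + Δ₂) (.par P Q)
  | resS {Γ Λ Δ s S P} :
      HasP Γ Λ ((sname s true, S) ::ₘ (sname s false, S.dual) ::ₘ Δ) P →
      HasP Γ Λ Δ (.resS s S P)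
  | resC {Γ Λ Δ a U P} : HasP (Γ.bindName (aname a) (.chan U)) Λ Δ P →
      HasP Γ Λ Δ (.resC a U P)
  | send {Γ Λ₁ Λ₂ Δ₁ Δ₂ Δ u U S V P} : Δ₁ + Δ₂ = (u, S) ::ₘ Δ →
      HasP Γ Λ₁ Δ₁ P → HasV Γ Λ₂ Δ₂ V U →
      (keys (Λ₁ + Λ₂)).Nodup → (keys (Δ₁ + Δ₂)).Nodup →
      HasP Γ (Λ₁ + Λ₂) ((u, .out U S) ::ₘ Δ) (.out u (.sess (.out U S)) V P)
  | rcv {Γ Λ Δ u U S y P} :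
      HasP (Γ.bindVar y U) (linPart y U + Λ) ((u, S) ::ₘ Δ) P →
      HasP Γ Λ ((u, .inp U S) ::ₘ Δ) (.inp u (.sess (.inp U S)) y P)
  | req {Γ Λ Δ₁ Δ₂ u U V P} : Γ.name u = some U →
      HasP Γ Λ Δ₁ P → HasV Γ 0 Δ₂ V U → (keys (Δ₁ + Δ₂)).Nodup →
      HasP Γ Λ (Δ₁ + Δ₂) (.out u (.chan U) V P)
  | acc {Γ Λ Δ u U y P} : Γ.name u = some U →
      HasP (Γ.bindVar y U) (linPart y U + Λ) Δ P →
      HasP Γ Λ Δ (.inp u (.chan U) y P)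
  | sel {Γ Λ Δ u I S l P} : HasP Γ Λ ((u, S l) ::ₘ Δ) P →
      HasP Γ Λ ((u, .sel I S) ::ₘ Δ) (.sel u I S l P)
  | bra {Γ Λ Δ u} {I : Finset Label} {S P} : I.Nonempty → (∀ l : I, HasP Γ Λ ((u, S l) ::ₘ Δ) (P l)) →
      HasP Γ Λ ((u, .bra I S) ::ₘ Δ) (.bra u I S P)
end

/-! ## Minimal session types -/

mutual
/-- Value types `C₁, …, C_n ⊸ ⋄` and `C₁, …, C_n → ⋄` over minimal session types. -/
inductive MU : Type where
  | ho (m : Mode) (Cs : List MC)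
/-- Name types over minimal session types. -/
inductive MC : Type where
  | sess (M : MS)
  | chan (U : MU)
/-- Minimal session types: `out Us` is `!⟨Us⟩; end` and `inp Us` is `?(Us); end`. -/
inductive MS : Type where
  | fin
  | out (Us : List MU)
  | inp (Us : List MU)
  | sel (I : Finset Label) (M : I → MS)
  | bra (I : Finset Label) (M : I → MS)
end

def MS.dual : MS → MS
  | .fin => .fin
  | .out Us => .inp Us
  | .inp Us => .out Us
  | .sel I M => .bra I fun l => (M l).dual
  | .bra I M => .sel I fun l => (M l).dual

mutual
/-- Decomposition of value types. -/
def HOTy.G : HOTy → MU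
  | .ho m C => .ho m C.G
/-- Decomposition of name types. -/
def CTy.G : CTy → List MC
  | .sess S => S.G.map .sess
  | .chan U => [.chan U.G]
/-- Decomposition of session types into lists of minimal session types. The clause for selection
is stated with the dual of `G(S_l)`, which is `G` of the dual of `S_l` (see `STy.G_sel`). -/
def STy.G : STy → List MS
  | .fin => [.fin]
  | .out U S => .out [U.G] :: if S.isEnd then [] else S.G
  | .inp U S => .inp [U.G] :: if S.isEnd then [] else S.G
  | .sel I S => [.sel I fun l => .inp [.ho .lin (((S l).G.map MS.dual).map .sess)]]
  | .bra I S => [.bra I fun l => .out [.ho .lin ((S l).G.map .sess)]]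
end

theorem MS.dual_dual : ∀ M : MS, M.dual.dual = M
  | .fin => rfl
  | .out _ => rfl
  | .inp _ => rfl
  | .sel I M => by
      simp only [MS.dual]
      congr 1
      funext l
      exact MS.dual_dual (M l)
  | .bra I M => by
      simp only [MS.dual]
      congr 1
      funext l
      exact MS.dual_dual (M l)

theorem STy.isEnd_dual (S : STy) : S.dual.isEnd = S.isEnd := by
  cases S <;> simp [STy.dual, STy.isEnd]

theorem STy.G_dual : ∀ S : STy, S.dual.G = S.G.map MS.dual
  | .fin => by simp [STy.dual, STy.G, MS.dual]
  | .out U S => by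
      have ih := STy.G_dual S
      simp only [STy.dual, STy.G, STy.isEnd_dual, ih]
      split <;> simp [MS.dual]
  | .inp U S => by
      have ih := STy.G_dual S
      simp only [STy.dual, STy.G, STy.isEnd_dual, ih]
      split <;> simp [MS.dual]
  | .sel I S => by
      have ih := fun l => STy.G_dual (S l)
      simp [STy.dual, STy.G, MS.dual, ih]
  | .bra I S => by
      have ih := fun l => STy.G_dual (S l)
      simp [STy.dual, STy.G, MS.dual, ih, Function.comp_def, MS.dual_dual]

theorem STy.G_sel (I : Finset Label) (S : I → STy) :
    (STy.sel I S).G = [.sel I fun l => .inp [.ho .lin ((S l).dual.G.map .sess)]] := by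
  simp [STy.G, STy.G_dual]

/-! ## Polyadic processes -/

/-- Names of polyadic processes: indexed names, and the propagators `c_k` (`prop k true`) with
their duals (`prop k false`). -/
inductive TName where
  | src (u : Name)
  | prop (k : ℕ) (p : Bool)
  deriving DecidableEq

namespace TName

def dual : TName → TName
  | src (.sess s p i) => src (.sess s (!p) i)
  | src u => src u
  | prop k p => prop k (!p)

def IsShared : TName → Prop
  | src u => u.IsShared
  | prop _ _ => False

def IsSession : TName → Prop
  | src u => u.IsSession
  | prop _ _ => True

def IsVar : TName → Prop
  | src (.var _ _) => True
  | _ => False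

end TName

/-- Value variables of polyadic processes: those of the given process and an additional one. -/
inductive TVar where
  | src (x : ℕ)
  | aux
  deriving DecidableEq

mutual
/-- Values: variables and abstractions of a tuple of names. -/
inductive TVal : Type where
  | var (x : TVar)
  | abs (m : Mode) (ys : List (TName × MC)) (P : TProc)
/-- Polyadic processes. `resS s T P` binds a session name `s` together with its dual; the
annotation `T` may be absent. -/
inductive TProc : Type where
  | out (u : TName) (Vs : List TVal) (P : TProc)
  | inp (u : TName) (xs : List TVar) (P : TProc)
  | sel (u : TName) (l : Label) (P : TProc)
  | bra (u : TName) (I : Finset Label) (P : I → TProc)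
  | app (V : TVal) (us : List TName)
  | par (P Q : TProc)
  | resS (s : TName) (T : Option MS) (P : TProc)
  | resC (a : TName) (U : MU) (P : TProc)
  | nil
end

/-- Shared environments: `var x = some Cs` is `x : Cs → ⋄`, and `name u = some U` is `u : ⟨U⟩`. -/
@[ext] structure TCtx where
  var : TVar → Option (List MC)
  name : TName → Option MU

namespace TCtx

/-- `Γ ∖ x`. -/
def eraseVar (Γ : TCtx) (x : TVar) : TCtx :=
  { Γ with var := Function.update Γ.var x none }

/-- The shared environment in the scope of a binder for a tuple of value variables. -/
def bindVars (Γ : TCtx) (xs : List (TVar × MU)) : TCtx :=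
  { Γ with var := fun x => match xs.lookup x with
      | some (.ho .shr Cs) => some Cs
      | some (.ho .lin _) => none
      | none => Γ.var x }

/-- The shared environment in the scope of a binder for a tuple of names. -/
def bindNames (Γ : TCtx) (ys : List (TName × MC)) : TCtx :=
  { Γ with name := fun u => match ys.lookup u with
      | some (.chan U) => some U
      | some (.sess _) => none
      | none => Γ.name u }

end TCtx

/-- Linear environments: `(x, Cs)` is the assignment `x : Cs ⊸ ⋄`. -/
abbrev TLEnv : Type := Multiset (TVar × List MC)
/-- Session environments with minimal session types. -/
abbrev TSEnv : Type := Multiset (TName × MS)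

/-- The linear assignments made by a binder for a tuple of value variables. -/
def linParts (xs : List (TVar × MU)) : TLEnv :=
  ↑(xs.filterMap fun p => match p.2 with
    | .ho .lin Cs => some (p.1, Cs)
    | .ho .shr _ => none)

/-- The session assignments made by a binder for a tuple of names. -/
def sessParts (ys : List (TName × MC)) : TSEnv :=
  ↑(ys.filterMap fun p => match p.2 with
    | .sess M => some (p.1, M)
    | .chan _ => none)

/-- `Γ; ∅; Δ ⊢ u ▷ C` for names. -/
inductive THasN : TCtx → TSEnv → TName → MC → Prop where
  | sess {Γ u M} : ¬ u.IsShared → Γ.name u = none → THasN Γ {(u, M)} u (.sess M)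
  | sh {Γ u U} : Γ.name u = some U → THasN Γ 0 u (.chan U)

/-- `Γ; ∅; Δ ⊢ us ▷ Cs` for tuples of names. -/
inductive THasNs : TCtx → TSEnv → List TName → List MC → Prop where
  | nil {Γ} : THasNs Γ 0 [] []
  | cons {Γ Δ₁ Δ₂ u us C Cs} : THasN Γ Δ₁ u C → THasNs Γ Δ₂ us Cs →
      (keys (Δ₁ + Δ₂)).Nodup → THasNs Γ (Δ₁ + Δ₂) (u :: us) (C :: Cs)

mutual
/-- `Γ; Λ; Δ ⊢ V ▷ U` with minimal session types. -/
inductive THasV : TCtx → TLEnv → TSEnv → TVal → MU → Prop where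
  | lvar {Γ x Cs} : Γ.var x = none → THasV Γ {(x, Cs)} 0 (.var x) (.ho .lin Cs)
  | sh {Γ x Cs} : Γ.var x = some Cs → THasV Γ 0 0 (.var x) (.ho .shr Cs)
  | prom {Γ ys P Cs} : THasV Γ 0 0 (.abs .lin ys P) (.ho .lin Cs) →
      THasV Γ 0 0 (.abs .shr ys P) (.ho .shr Cs)
  | abs {Γ Λ Δ ys P} : ys ≠ [] → (ys.map Prod.fst).Nodup → (∀ p ∈ ys, p.1.IsVar) →
      THasP (Γ.bindNames ys) Λ (sessParts ys + Δ) P →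
      THasV Γ Λ Δ (.abs .lin ys P) (.ho .lin (ys.map Prod.snd))
/-- `Γ; Λ; Δ ⊢ Vs ▷ Us` for tuples of values. -/
inductive THasVs : TCtx → TLEnv → TSEnv → List TVal → List MU → Prop where
  | nil {Γ} : THasVs Γ 0 0 [] []
  | cons {Γ Λ₁ Λ₂ Δ₁ Δ₂ V Vs U Us} : THasV Γ Λ₁ Δ₁ V U → THasVs Γ Λ₂ Δ₂ Vs Us →
      (keys (Λ₁ + Λ₂)).Nodup → (keys (Δ₁ + Δ₂)).Nodup →
      THasVs Γ (Λ₁ + Λ₂) (Δ₁ + Δ₂) (V :: Vs) (U :: Us)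
/-- `Γ; Λ; Δ ⊢ P ▷ ⋄` with minimal session types. Communication on session names and application
are polyadic (with non-empty tuples), communication on shared names is monadic. -/
inductive THasP : TCtx → TLEnv → TSEnv → TProc → Prop where
  | eprom {Γ Λ Δ x Cs P} : Γ.var x = some Cs → THasP (Γ.eraseVar x) ((x, Cs) ::ₘ Λ) Δ P →
      THasP Γ Λ Δ P
  | fin {Γ Λ Δ u P} : ¬ u.IsShared → Γ.name u = none → u ∉ keys Δ → THasP Γ Λ Δ P →
      THasP Γ Λ ((u, .fin) ::ₘ Δ) P
  | nil {Γ} : THasP Γ 0 0 .nil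
  | app {Γ Λ Δ₁ Δ₂ m V us Cs} : Cs ≠ [] → THasV Γ Λ Δ₁ V (.ho m Cs) → THasNs Γ Δ₂ us Cs →
      (keys (Δ₁ + Δ₂)).Nodup → THasP Γ Λ (Δ₁ + Δ₂) (.app V us)
  | par {Γ Λ₁ Λ₂ Δ₁ Δ₂ P Q} : THasP Γ Λ₁ Δ₁ P → THasP Γ Λ₂ Δ₂ Q →
      (keys (Λ₁ + Λ₂)).Nodup → (keys (Δ₁ + Δ₂)).Nodup →
      THasP Γ (Λ₁ + Λ₂) (Δ₁ + Δ₂) (.par P Q)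
  | resS {Γ Λ Δ s T M P} : s.IsSession → (T = none ∨ T = some M) →
      THasP Γ Λ ((s, M) ::ₘ (s.dual, M.dual) ::ₘ Δ) P →
      THasP Γ Λ Δ (.resS s T P)
  | resC {Γ Λ Δ a U P} : a.IsShared → THasP (Γ.bindNames [(a, .chan U)]) Λ Δ P →
      THasP Γ Λ Δ (.resC a U P)
  | send {Γ Λ₁ Λ₂ Δ₁ Δ₂ Δ u Us Vs P} : Us ≠ [] → Δ₁ + Δ₂ = (u, .fin) ::ₘ Δ →
      THasP Γ Λ₁ Δ₁ P → THasVs Γ Λ₂ Δ₂ Vs Us →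
      (keys (Λ₁ + Λ₂)).Nodup → (keys (Δ₁ + Δ₂)).Nodup →
      THasP Γ (Λ₁ + Λ₂) ((u, .out Us) ::ₘ Δ) (.out u Vs P)
  | rcv {Γ Λ Δ u Us xs P} : Us ≠ [] → xs.Nodup → xs.length = Us.length →
      THasP (Γ.bindVars (xs.zip Us)) (linParts (xs.zip Us) + Λ) ((u, .fin) ::ₘ Δ) P →
      THasP Γ Λ ((u, .inp Us) ::ₘ Δ) (.inp u xs P)
  | req {Γ Λ Δ₁ Δ₂ u U V P} : Γ.name u = some U →
      THasP Γ Λ Δ₁ P → THasV Γ 0 Δ₂ V U → (keys (Δ₁ + Δ₂)).Nodup →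
      THasP Γ Λ (Δ₁ + Δ₂) (.out u [V] P)
  | acc {Γ Λ Δ u U x P} : Γ.name u = some U →
      THasP (Γ.bindVars [(x, U)]) (linParts [(x, U)] + Λ) Δ P →
      THasP Γ Λ Δ (.inp u [x] P)
  | sel {Γ Λ Δ u I M l P} : THasP Γ Λ ((u, M l) ::ₘ Δ) P →
      THasP Γ Λ ((u, .sel I M) ::ₘ Δ) (.sel u l.1 P)
  | bra {Γ Λ Δ u} {I : Finset Label} {M P} : I.Nonempty → (∀ l : I, THasP Γ Λ ((u, M l) ::ₘ Δ) (P l)) →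
      THasP Γ Λ ((u, .bra I M) ::ₘ Δ) (.bra u I P)
end

/-- A session environment is balanced if dual names have dual types. -/
def BalancedEnv (Δ : TSEnv) : Prop :=
  ∀ u T T', u.IsSession → (u, T) ∈ Δ → (u.dual, T') ∈ Δ → T' = T.dual

/-! ## The breakdown -/

/-- The tuple `(u_i, …, u_{i+n-1})`. -/
def Name.block (u : Name) (n : ℕ) : List TName := (List.range n).map fun j => .src (u.shift j)

/-- The tuple `(u_1, …, u_n)` of a name `u` without index. -/
def Name.block1 (u : Name) (n : ℕ) : List TName := (u.shift 1).block n

/-- The free variables as a tuple. -/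
def Proc.fvs (P : Proc) : List ℕ := P.fv.sort
/-- The free variables as a tuple. -/
def Val.fvs (V : Val) : List ℕ := V.fv.sort

/-- `c_k?(xs).P`; when the tuple `xs` is empty, a variable that is not relevant is received. -/
def ctxIn (k : ℕ) (xs : List ℕ) (P : TProc) : TProc :=
  .inp (.prop k true) (if xs = [] then [.aux] else xs.map .src) P

/-- The abstraction `λ y. 0` of type `end → ⋄`. -/
def dummyVal : TVal := .abs .shr [(.src (.var (.aux 0) 0), .sess .fin)] .nil

/-- `c̄_k!⟨xs⟩.P`; when the tuple `xs` is empty, `λ y. 0` is sent. -/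
def ctxOut (k : ℕ) (xs : List ℕ) (P : TProc) : TProc :=
  .out (.prop k false) (if xs = [] then [dummyVal] else xs.map fun x => .var (.src x)) P

/-- `(ν c_k, …, c_{k+n-1}) P`. -/
def resProps (k n : ℕ) (P : TProc) : TProc :=
  (List.range n).foldr (fun j Q => .resS (.prop (k + j) true) none Q) P

/-- `(ν ss : Ts) P` for a tuple of session names. -/
def resBlock (ss : List (TName × MS)) (P : TProc) : TProc :=
  ss.foldr (fun s Q => .resS s.1 (some s.2) Q) P

/-- `σ = {u_{i+1}/u_i}` if `u_i` has a session type, and the identity otherwise. -/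
def step (u : Name) (C : CTy) : Name → Name := if C.isSess then u.incr else id

mutual
/-- Nesting depth, on which the breakdown is defined by recursion. -/
def Val.height : Val → ℕ
  | .var _ => 0
  | .abs _ _ _ P => P.height + 1
def Proc.height : Proc → ℕ
  | .out _ _ V P => max V.height P.height + 1
  | .inp _ _ _ P => P.height + 1
  | .sel _ _ _ _ P => P.height + 1
  | .bra _ I _ P => (Finset.univ.sup fun l : I => (P l).height) + 1
  | .app V _ _ => V.height + 1
  | .par P Q => max P.height Q.height + 1
  | .resS _ _ P => P.height + 1
  | .resC _ _ P => P.height + 1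
  | .nil => 0
end

mutual
theorem Val.height_rename (f : Name → Name) : ∀ V : Val, (V.rename f).height = V.height
  | .var _ => rfl
  | .abs m y C P => by simp [Val.rename, Val.height, Proc.height_rename _ P]
theorem Proc.height_rename (f : Name → Name) : ∀ P : Proc, (P.rename f).height = P.height
  | .out u C V P => by
      simp [Proc.rename, Proc.height, Val.height_rename f V, Proc.height_rename f P]
  | .inp u C y P => by simp [Proc.rename, Proc.height, Proc.height_rename f P]
  | .sel u I S l P => by simp [Proc.rename, Proc.height, Proc.height_rename f P]
  | .bra u I S P => by
      have ih := fun l => Proc.height_rename f (P l)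
      simp [Proc.rename, Proc.height, ih]
  | .app V u C => by simp [Proc.rename, Proc.height, Val.height_rename f V]
  | .par P Q => by
      simp [Proc.rename, Proc.height, Proc.height_rename f P, Proc.height_rename f Q]
  | .resS s S P => by simp [Proc.rename, Proc.height, Proc.height_rename _ P]
  | .resC a U P => by simp [Proc.rename, Proc.height, Proc.height_rename _ P]
  | .nil => rfl
end

theorem Proc.height_lt_bra (u : Name) (I : Finset Label) (S : I → STy) (P : I → Proc) (l : I) :
    (P l).height < (Proc.bra u I S P).height := by
  have h : (P l).height ≤ Finset.univ.sup fun l : I => (P l).height :=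
    Finset.le_sup (f := fun l : I => (P l).height) (Finset.mem_univ l)
  simp only [Proc.height]
  omega

mutual
/-- The breakdown of a value with context `xs` and propagators from `c_k`. -/
def Val.breakdown (k : ℕ) (xs : List ℕ) : Val → TVal
  | .var y => .var (.src y)
  | .abs m y C P =>
      .abs m (((pname y).block1 C.G.length).zip C.G)
        (resProps k (if m = .shr then P.degree else 0)
          (.par (ctxOut k xs .nil)
            ((P.rename (Name.subst (pname y) ((pname y).shift 1))).breakdown k xs)))
  termination_by V => V.height
  decreasing_by
    simp only [Proc.height_rename, Val.height]
    omega
/-- The breakdown of a process with context `xs` and propagators from `c_k`. The names and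
variables that it binds in the clauses for selection and branching are taken from the reserved
supply. -/
def Proc.breakdown (k : ℕ) (xs : List ℕ) : Proc → TProc
  | .out u C V Q =>
      .par
        (ctxIn k xs
          (.out (.src u) [(V.rename (step u C)).breakdown (k + 1) V.fvs]
            (ctxOut (k + V.degree + 1) Q.fvs .nil)))
        ((Q.rename (step u C)).breakdown (k + V.degree + 1) Q.fvs)
  | .inp u C y Q =>
      .par
        (ctxIn k xs (.inp (.src u) [.src y] (ctxOut (k + 1) Q.fvs .nil)))
        ((Q.rename (step u C)).breakdown (k + 1) Q.fvs)
  | .sel u _ S l P =>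
      .par
        (ctxIn k xs
          (.out (.prop (k + 1) false)
            [.abs .lin (((Name.var (.aux k) 0).block1 (S l).G.length).zip
                ((S l).dual.G.map .sess))
              (.sel (.src u) l.1
                (.inp (.src u) [.aux]
                  (ctxOut (k + 2) xs
                    (.app (.var .aux) ((Name.var (.aux k) 0).block1 (S l).G.length)))))]
            .nil))
        (resBlock (((Name.sess (.aux k) true 0).block1 (S l).G.length).zip (S l).G)
          (.par
            (.inp (.prop (k + 1) true) [.aux]
              (.app (.var .aux) ((Name.sess (.aux k) false 0).block1 (S l).G.length)))
            ((P.rename (Name.subst u (.sess (.aux k) true 1))).breakdown (k + 2) xs)))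
  | .bra u I S P =>
      ctxIn k xs
        (.bra (.src u) I fun l =>
          .out (.src u)
            [.abs .lin (((Name.var (.aux k) 0).block1 (S l).G.length).zip ((S l).G.map .sess))
              (resProps (k + 1) (P l).degree
                (.par (ctxOut (k + 1) (P l).fvs .nil)
                  (((P l).rename (Name.subst u (.var (.aux k) 1))).breakdown
                    (k + 1) (P l).fvs)))]
            .nil)
  | .app V u C =>
      ctxIn k xs (.app (V.breakdown (k + 1) xs) (u.block C.G.length))
  | .par Q R =>
      .par
        (ctxIn k xs
          (ctxOut (k + 1) Q.fvs (ctxOut (k + Q.degree + 1) R.fvs .nil)))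
        (.par (Q.breakdown (k + 1) Q.fvs) (R.breakdown (k + Q.degree + 1) R.fvs))
  | .resS s S P =>
      resBlock (((sname s true).block1 S.G.length).zip S.G)
        ((P.rename (Name.openSession s)).breakdown k xs)
  | .resC a U P =>
      .resC (.src (.shared a 1)) U.G
        ((P.rename (Name.subst (aname a) (.shared a 1))).breakdown k xs)
  | .nil => ctxIn k [] .nil
  termination_by P => P.height
  decreasing_by
    all_goals try simp only [Proc.height_rename, Val.height_rename]
    all_goals first
      | exact Proc.height_lt_bra _ _ _ _ _
      | (simp only [Proc.height]; omega)
end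

/-! ## Decomposition of environments -/

/-- Decomposition of shared environments. -/
def SCtx.G (Γ : SCtx) : TCtx where
  var
    | .src x => (Γ.var x).map CTy.G
    | .aux => none
  name
    | .src u => (Γ.name u).map HOTy.G
    | .prop _ _ => none

/-- Decomposition of linear environments. -/
def LEnv.G (Λ : LEnv) : TLEnv := Λ.map fun p => (.src p.1, p.2.G)

/-- Decomposition of session environments: `u_i : S` becomes
`(u_i, …, u_{i+n-1}) : G(S)`, where `n` is the length of `G(S)`. -/
def SEnv.G (Δ : SEnv) : TSEnv := Δ.bind fun p => ↑((p.1.block p.2.G.length).zip p.2.G)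

/-- Conventions on environments: the shared environment contains no session name; all names are
indexed; and the decomposed environments have distinct domains, i.e. they are environments. -/
structure EnvOK (Γ : SCtx) (Δ : SEnv) : Prop where
  proper : ∀ u, (Γ.name u).isSome → ¬ u.IsSession
  indexed_shared : ∀ u, (Γ.name u).isSome → u.Indexed
  indexed_session : ∀ u ∈ keys Δ, u.Indexed
  nodup : (keys (SEnv.G Δ)).Nodup
  disjoint : ∀ u ∈ keys (SEnv.G Δ), Γ.G.name u = none

/-- The roots of the names in the domains of `Γ` and `Δ`. -/
def envRoots (Γ : SCtx) (Δ : SEnv) : Set Root :=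
  {r | ∃ u : Name, ((Γ.name u).isSome ∨ u ∈ keys Δ) ∧ u.root = r}

/-- `xs` lists the elements of `X` without repetition. -/
def Enumerates (xs : List ℕ) (X : Finset ℕ) : Prop := xs.Nodup ∧ xs.toFinset = X

/-- `(Γ, Λ)(x) = U`. -/
def VarType (Γ : TCtx) (Λ : TLEnv) (x : TVar) (U : MU) : Prop :=
  (∃ Cs, Γ.var x = some Cs ∧ U = .ho .shr Cs) ∨ (∃ Cs, (x, Cs) ∈ Λ ∧ U = .ho .lin Cs)

/-- `(Γ, Λ)(xs) = Us` for a tuple of variables. -/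
def CtxTypes (Γ : TCtx) (Λ : TLEnv) (xs : List ℕ) (Us : List MU) : Prop :=
  List.Forall₂ (VarType Γ Λ) (xs.map .src) Us

/-- The payload of a propagator for a context with types `Us`; for the empty context it is
`end → ⋄`. -/
def payload (Us : List MU) : List MU := if Us = [] then [.ho .shr [.sess .fin]] else Us

/-- `{c_j : j ∈ J}` (for `p = true`) or the duals of these names (for `p = false`). -/
def props (p : Bool) (J : Finset ℕ) : Multiset TName := J.val.map fun j => .prop j p

/-!
The theorem is proved by induction on the typing derivation of the source process. Every clause of
the breakdown creates a trio whose first action is to receive, on `c_k`, the values that the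
subprocess needs, and whose last actions forward values on the propagators of the immediate
subprocesses. So in each case the induction hypotheses type the breakdowns of the subprocesses,
`THasP.ctxIn` and `THasP.ctxOut` type the exchange on the propagators, and what remains is the
single action of the source that the trio keeps, on a name whose session ends right after it.

Four choices make the induction go through.

* The breakdown applies a substitution at every prefix and binder, so the induction statements
  (`Proc.BreakdownTypable`, `Val.BreakdownTypable`) are about `P.rename f` for a renaming `f`, and
  the session environment of the target is `SEnv.decomp f d Δ`. Successive substitutions compose
  into one renaming because they only introduce indexed names, which no binder of the source can
  capture (`Proc.rename_rename`). `Admissible` records that the names of the target are indexed,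
  pairwise distinct, and built from roots in use; it is preserved at binders by the convention on
  bound names and by the reserved supply of identifiers `aux k`.
* A completed session `u : end` is omitted by the decomposition after a prefix, but the source
  derivation still has the assignment. The set `d` holds such names. As they are not used any
  more, they meet only the weakening rule, where there is nothing left to weaken.
* The propagators are typed by one function `T : ℕ → MS`: `c_j` at `T j`, its dual name at the dual
  of `T j`. So the environment `Θ` is balanced by construction (`balancedEnv_props`), and the
  functions for subprocesses, which use disjoint ranges of indices, are combined by `glue`.
* A source derivation may use a shared variable linearly at any place, also where the breakdown has
  no action. The context of a process may therefore be received at shared types where the process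
  needs linear ones (`ReceivableType`), and the trio promotes these variables after reception
  (`THasP.ctxIn`). With this the rule is trivial in the induction (`BreakdownTypable.eprom`).
-/

/-! ### Renaming -/

/-- A renaming that captures nothing: a name that it moves gets an index, and bound names have
none. -/
def Name.CaptureFree (f : Name → Name) : Prop := ∀ v, f v = v ∨ 1 ≤ (f v).idx

theorem Name.shift_zero (u : Name) : u.shift 0 = u := by cases u <;> rfl

theorem Name.shift_shift (u : Name) (i j : ℕ) : (u.shift i).shift j = u.shift (i + j) := by
  cases u <;> simp [Name.shift, Nat.add_assoc]

theorem Name.idx_shift (u : Name) (j : ℕ) : (u.shift j).idx = u.idx + j := by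
  cases u <;> rfl

theorem Name.root_shift (u : Name) (j : ℕ) : (u.shift j).root = u.root := by
  cases u <;> rfl

theorem Name.isShared_shift (u : Name) (j : ℕ) : (u.shift j).IsShared ↔ u.IsShared := by
  cases u <;> rfl

theorem Name.shift_injective (u : Name) : Function.Injective u.shift := by
  intro i j h
  have := congrArg Name.idx h
  simpa [Name.idx_shift] using this

/-- Renaming under binders is functorial, as the first renaming produces no bound name. -/
theorem Name.avoid_comp {bs : Finset Name} {f : Name → Name} (g : Name → Name)
    (hbs : ∀ b ∈ bs, b.idx = 0) (hf : Name.CaptureFree f) :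
    Name.avoid bs g ∘ Name.avoid bs f = Name.avoid bs (g ∘ f) := by
  funext u
  by_cases hu : u ∈ bs
  · simp [Name.avoid, hu]
  · have : f u ∉ bs := by
      intro h
      rcases hf u with e | e
      · exact hu (e ▸ h)
      · have := hbs _ h
        omega
    simp [Name.avoid, hu, this]

theorem Name.CaptureFree.avoid {f : Name → Name} (hf : Name.CaptureFree f) (bs : Finset Name) :
    Name.CaptureFree (Name.avoid bs f) := by
  intro v
  by_cases hv : v ∈ bs
  · simp [Name.avoid, hv]
  · simpa [Name.avoid, hv] using hf v

theorem Name.CaptureFree.subst {f : Name → Name} (hf : Name.CaptureFree f) (u : Name) {w : Name}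
    (hw : 1 ≤ w.idx) : Name.CaptureFree (Name.subst u w ∘ f) := by
  intro v
  by_cases h : f v = u
  · right
    simpa [Name.subst, h] using hw
  · simpa [Name.subst, Function.update_of_ne h] using hf v

theorem Name.CaptureFree.openSession {f : Name → Name} (hf : Name.CaptureFree f) (s : ℕ) :
    Name.CaptureFree (Name.openSession s ∘ f) := by
  intro v
  have key : ∀ w, Name.openSession s w = w ∨ 1 ≤ (Name.openSession s w).idx := by
    intro w
    cases w with
    | sess t p i =>
      simp only [Name.openSession]
      split
      · right
        simp [Name.idx]
      · left
        rfl
    | _ => left; rfl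
  rcases hf v with h | h
  · simpa [h] using key v
  · rcases key (f v) with h' | h'
    · right
      simpa [h'] using h
    · exact Or.inr h'

theorem Name.openSession_of_idx (s : ℕ) {u : Name} (h : 1 ≤ u.idx) :
    Name.openSession s u = u := by
  cases u with
  | sess t p i =>
    simp only [Name.idx] at h
    have : i ≠ 0 := by omega
    simp [Name.openSession, this]
  | _ => rfl

mutual
theorem Val.rename_rename {f : Name → Name} (g : Name → Name) (hf : Name.CaptureFree f) :
    ∀ V : Val, (V.rename f).rename g = V.rename (g ∘ f)
  | .var _ => rfl
  | .abs m y C P => by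
      simp only [Val.rename]
      rw [Proc.rename_rename _ (hf.avoid _) P, Name.avoid_comp g (by simp [Name.idx]) hf]
theorem Proc.rename_rename {f : Name → Name} (g : Name → Name) (hf : Name.CaptureFree f) :
    ∀ P : Proc, (P.rename f).rename g = P.rename (g ∘ f)
  | .out u C V P => by
      simp [Proc.rename, Val.rename_rename g hf V, Proc.rename_rename g hf P]
  | .inp u C y P => by simp [Proc.rename, Proc.rename_rename g hf P]
  | .sel u I S l P => by simp [Proc.rename, Proc.rename_rename g hf P]
  | .bra u I S P => by
      have ih := fun l => Proc.rename_rename g hf (P l)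
      simp [Proc.rename, ih]
  | .app V u C => by simp [Proc.rename, Val.rename_rename g hf V]
  | .par P Q => by simp [Proc.rename, Proc.rename_rename g hf P, Proc.rename_rename g hf Q]
  | .resS s S P => by
      simp only [Proc.rename]
      rw [Proc.rename_rename _ (hf.avoid _) P, Name.avoid_comp g (by simp [Name.idx]) hf]
  | .resC a U P => by
      simp only [Proc.rename]
      rw [Proc.rename_rename _ (hf.avoid _) P, Name.avoid_comp g (by simp [Name.idx]) hf]
  | .nil => rfl
end

theorem Name.avoid_id (bs : Finset Name) : Name.avoid bs id = id := by
  funext u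
  simp [Name.avoid]

mutual
theorem Val.rename_id : ∀ V : Val, V.rename id = V
  | .var _ => rfl
  | .abs m y C P => by simp [Val.rename, Name.avoid_id, Proc.rename_id P]
theorem Proc.rename_id : ∀ P : Proc, P.rename id = P
  | .out u C V P => by simp [Proc.rename, Val.rename_id V, Proc.rename_id P]
  | .inp u C y P => by simp [Proc.rename, Proc.rename_id P]
  | .sel u I S l P => by simp [Proc.rename, Proc.rename_id P]
  | .bra u I S P => by
      have ih := fun l => Proc.rename_id (P l)
      simp [Proc.rename, ih]
  | .app V u C => by simp [Proc.rename, Val.rename_id V]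
  | .par P Q => by simp [Proc.rename, Proc.rename_id P, Proc.rename_id Q]
  | .resS s S P => by simp [Proc.rename, Name.avoid_id, Proc.rename_id P]
  | .resC a U P => by simp [Proc.rename, Name.avoid_id, Proc.rename_id P]
  | .nil => rfl
end

mutual
theorem Val.fv_rename (f : Name → Name) : ∀ V : Val, (V.rename f).fv = V.fv
  | .var _ => rfl
  | .abs m y C P => by simp [Val.rename, Val.fv, Proc.fv_rename _ P]
theorem Proc.fv_rename (f : Name → Name) : ∀ P : Proc, (P.rename f).fv = P.fv
  | .out u C V P => by simp [Proc.rename, Proc.fv, Val.fv_rename f V, Proc.fv_rename f P]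
  | .inp u C y P => by simp [Proc.rename, Proc.fv, Proc.fv_rename f P]
  | .sel u I S l P => by simp [Proc.rename, Proc.fv, Proc.fv_rename f P]
  | .bra u I S P => by
      have ih := fun l => Proc.fv_rename f (P l)
      simp [Proc.rename, Proc.fv, ih]
  | .app V u C => by simp [Proc.rename, Proc.fv, Val.fv_rename f V]
  | .par P Q => by simp [Proc.rename, Proc.fv, Proc.fv_rename f P, Proc.fv_rename f Q]
  | .resS s S P => by simp [Proc.rename, Proc.fv, Proc.fv_rename _ P]
  | .resC a U P => by simp [Proc.rename, Proc.fv, Proc.fv_rename _ P]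
  | .nil => rfl
end

theorem Val.fvs_rename (f : Name → Name) (V : Val) : (V.rename f).fvs = V.fvs := by
  simp [Val.fvs, Val.fv_rename]

theorem Proc.fvs_rename (f : Name → Name) (P : Proc) : (P.rename f).fvs = P.fvs := by
  simp [Proc.fvs, Proc.fv_rename]

mutual
theorem Val.degree_rename (f : Name → Name) : ∀ V : Val, (V.rename f).degree = V.degree
  | .var _ => rfl
  | .abs .lin y C P => by simp [Val.rename, Val.degree, Proc.degree_rename _ P]
  | .abs .shr y C P => by simp [Val.rename, Val.degree]
theorem Proc.degree_rename (f : Name → Name) : ∀ P : Proc, (P.rename f).degree = P.degree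
  | .out u C V P => by
      simp [Proc.rename, Proc.degree, Val.degree_rename f V, Proc.degree_rename f P]
  | .inp u C y P => by simp [Proc.rename, Proc.degree, Proc.degree_rename f P]
  | .sel u I S l P => by simp [Proc.rename, Proc.degree, Proc.degree_rename f P]
  | .bra u I S P => by simp [Proc.rename, Proc.degree]
  | .app V u C => by simp [Proc.rename, Proc.degree, Val.degree_rename f V]
  | .par P Q => by
      simp [Proc.rename, Proc.degree, Proc.degree_rename f P, Proc.degree_rename f Q]
  | .resS s S P => by simp [Proc.rename, Proc.degree, Proc.degree_rename _ P]
  | .resC a U P => by simp [Proc.rename, Proc.degree, Proc.degree_rename _ P]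
  | .nil => rfl
end

theorem Proc.degree_pos : ∀ P : Proc, 0 < P.degree
  | .out _ _ _ _ => by simp [Proc.degree]
  | .inp _ _ _ _ => by simp [Proc.degree]
  | .sel _ _ _ _ _ => by simp [Proc.degree]
  | .bra _ _ _ _ => by simp [Proc.degree]
  | .app _ _ _ => by simp [Proc.degree]
  | .par _ _ => by simp [Proc.degree]
  | .resS _ _ P => by simpa [Proc.degree] using Proc.degree_pos P
  | .resC _ _ P => by simpa [Proc.degree] using Proc.degree_pos P
  | .nil => by simp [Proc.degree]

/-! ### Invariants of the source type system -/

theorem keys_add {α β : Type} (E F : Multiset (α × β)) : keys (E + F) = keys E + keys F :=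
  Multiset.map_add _ _ _

theorem keys_cons {α β : Type} (p : α × β) (E : Multiset (α × β)) :
    keys (p ::ₘ E) = p.1 ::ₘ keys E :=
  Multiset.map_cons _ _ _

theorem keys_singleton {α β : Type} (p : α × β) : keys ({p} : Multiset (α × β)) = {p.1} :=
  Multiset.map_singleton _ _

theorem keys_zero {α β : Type} : keys (0 : Multiset (α × β)) = 0 := rfl

theorem mem_keys {α β : Type} {E : Multiset (α × β)} {a : α} : a ∈ keys E ↔ ∃ b, (a, b) ∈ E := by
  simp [keys]

/-- What a derivation ensures about its environments when `X` is the set of free variables of the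
process or value. -/
structure WellFormed (Γ : SCtx) (Λ : LEnv) (Δ : SEnv) (X : Finset ℕ) : Prop where
  nodup_lin : (keys Λ).Nodup
  lin_none : ∀ x ∈ keys Λ, Γ.var x = none
  lin_mem : ∀ x ∈ keys Λ, x ∈ X
  nodup : (keys Δ).Nodup
  not_shared : ∀ u ∈ keys Δ, ¬ u.IsShared
  name_none : ∀ u ∈ keys Δ, Γ.name u = none
  typed : ∀ x ∈ X, (∃ C, Γ.var x = some C) ∨ x ∈ keys Λ

theorem HasN.not_shared_and_name_none {Γ Δ u C} (h : HasN Γ Δ u C) :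
    ∀ v ∈ keys Δ, ¬ v.IsShared ∧ Γ.name v = none := by
  cases h with
  | sess h₁ h₂ =>
    intro v hv
    obtain rfl : v = u := by simpa [keys] using hv
    exact ⟨h₁, h₂⟩
  | sh h₁ => simp [keys]

theorem WellFormed.bindVar {Γ Λ Δ y U X} (h : WellFormed (Γ.bindVar y U) (linPart y U + Λ) Δ X) :
    WellFormed Γ Λ Δ (X.erase y) := by
  obtain ⟨m, C⟩ := U
  cases m with
  | lin =>
    have hn : y ∉ keys Λ ∧ (keys Λ).Nodup := by
      simpa [linPart, keys_cons] using h.nodup_lin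
    refine ⟨hn.2, ?_, ?_, h.nodup, h.not_shared, h.name_none, ?_⟩
    · intro x hx
      have hxy : x ≠ y := fun e => hn.1 (e ▸ hx)
      have := h.lin_none x (by simp [keys_add, hx])
      simpa [SCtx.bindVar, hxy] using this
    · intro x hx
      have hxy : x ≠ y := fun e => hn.1 (e ▸ hx)
      exact Finset.mem_erase.2 ⟨hxy, h.lin_mem x (by simp [keys_add, hx])⟩
    · intro x hx
      obtain ⟨hxy, hx⟩ := Finset.mem_erase.1 hx
      simpa [SCtx.bindVar, hxy, linPart, keys_cons] using h.typed x hx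
  | shr =>
    have hΛ : linPart y (.ho .shr C) + Λ = Λ := by simp [linPart]
    rw [hΛ] at h
    have hne : ∀ x ∈ keys Λ, x ≠ y := by
      rintro x hx rfl
      simpa [SCtx.bindVar] using h.lin_none x hx
    refine ⟨h.nodup_lin, ?_, ?_, h.nodup, h.not_shared, h.name_none, ?_⟩
    · intro x hx
      simpa [SCtx.bindVar, hne x hx] using h.lin_none x hx
    · intro x hx
      exact Finset.mem_erase.2 ⟨hne x hx, h.lin_mem x hx⟩
    · intro x hx
      obtain ⟨hxy, hx⟩ := Finset.mem_erase.1 hx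
      simpa [SCtx.bindVar, hxy] using h.typed x hx

/-- The second part says that an abstracted or restricted name shadows no name of the session
environment. -/
theorem WellFormed.bindName {Γ Λ Δ u C X} (h : WellFormed (Γ.bindName u C) Λ (sessPart u C + Δ) X) :
    WellFormed Γ Λ Δ X ∧ u ∉ keys Δ := by
  have hu : u ∉ keys Δ := by
    intro hu
    cases C with
    | sess S =>
      have := h.nodup
      simp [sessPart, keys_cons, hu] at this
    | chan U =>
      have := h.name_none u (by simp [sessPart, hu])
      simp [SCtx.bindName] at this
  refine ⟨⟨h.nodup_lin, ?_, h.lin_mem, ?_, ?_, ?_, ?_⟩, hu⟩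
  · intro x hx
    have := h.lin_none x hx
    cases C <;> exact this
  · exact Multiset.nodup_of_le (by rw [keys_add]; exact Multiset.le_add_left _ _) h.nodup
  · intro v hv
    exact h.not_shared v (by simp [keys_add, hv])
  · intro v hv
    have hvu : v ≠ u := fun e => hu (e ▸ hv)
    have := h.name_none v (by simp [keys_add, hv])
    cases C <;> simpa [SCtx.bindName, hvu] using this
  · intro x hx
    have := h.typed x hx
    cases C <;> exact this

theorem WellFormed.congr_keys {Γ Λ Δ Δ' X} (h : WellFormed Γ Λ Δ X) (e : keys Δ' = keys Δ) :
    WellFormed Γ Λ Δ' X :=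
  ⟨h.nodup_lin, h.lin_none, h.lin_mem, e ▸ h.nodup, e ▸ h.not_shared, e ▸ h.name_none, h.typed⟩

theorem WellFormed.add {Γ Λ₁ Λ₂ Δ₁ Δ₂ X₁ X₂} (h₁ : WellFormed Γ Λ₁ Δ₁ X₁)
    (h₂ : WellFormed Γ Λ₂ Δ₂ X₂) (hΛ : (keys (Λ₁ + Λ₂)).Nodup) (hΔ : (keys (Δ₁ + Δ₂)).Nodup) :
    WellFormed Γ (Λ₁ + Λ₂) (Δ₁ + Δ₂) (X₁ ∪ X₂) := by
  refine ⟨hΛ, ?_, ?_, hΔ, ?_, ?_, ?_⟩ <;> intro x hx <;>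
    simp only [keys_add, Multiset.mem_add, Finset.mem_union] at hx ⊢
  · exact hx.elim (h₁.lin_none x) (h₂.lin_none x)
  · exact hx.imp (h₁.lin_mem x) (h₂.lin_mem x)
  · exact hx.elim (h₁.not_shared x) (h₂.not_shared x)
  · exact hx.elim (h₁.name_none x) (h₂.name_none x)
  · rcases hx with hx | hx
    · exact (h₁.typed x hx).imp id Or.inl
    · exact (h₂.typed x hx).imp id Or.inr

theorem HasP.wellFormed {Γ Λ Δ P} (h : HasP Γ Λ Δ P) : WellFormed Γ Λ Δ P.fv := by
  refine HasP.rec (motive_1 := fun Γ Λ Δ V _ _ => WellFormed Γ Λ Δ V.fv)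
    (motive_2 := fun Γ Λ Δ P _ => WellFormed Γ Λ Δ P.fv)
    ?lvar ?sh ?prom ?abs ?eprom ?fin ?nil ?app ?par ?resS ?resC ?send ?rcv ?req ?acc ?sel ?bra h
  case lvar =>
    intro Γ x C hx
    constructor <;> simp [keys, hx, Val.fv]
  case sh =>
    intro Γ x C hx
    constructor <;> simp [keys, hx, Val.fv]
  case prom => exact fun _ ih => ih
  case abs => exact fun _ ih => ih.bindName.1
  case eprom =>
    intro Γ Λ Δ x C P hx _ ih
    have hn : x ∉ keys Λ ∧ (keys Λ).Nodup := by
      simpa [keys_cons] using ih.nodup_lin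
    refine ⟨hn.2, ?_, fun y hy => ih.lin_mem y (by simp [keys_cons, hy]), ih.nodup, ih.not_shared,
      ih.name_none, ?_⟩
    · intro y hy
      have hxy : y ≠ x := fun e => hn.1 (e ▸ hy)
      simpa [SCtx.eraseVars, hxy] using ih.lin_none y (by simp [keys_cons, hy])
    · intro y hy
      by_cases hxy : y = x
      · exact Or.inl ⟨C, hxy ▸ hx⟩
      · simpa [SCtx.eraseVars, keys_cons, hxy] using ih.typed y hy
  case fin =>
    intro Γ Λ Δ u P h₁ h₂ h₃ _ ih
    refine ⟨ih.nodup_lin, ih.lin_none, ih.lin_mem, ?_, ?_, ?_, ih.typed⟩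
    · simpa [keys_cons] using ⟨h₃, ih.nodup⟩
    · simpa [keys_cons] using ⟨h₁, ih.not_shared⟩
    · simpa [keys_cons] using ⟨h₂, ih.name_none⟩
  case nil =>
    intro Γ
    constructor <;> simp [keys, Proc.fv]
  case app =>
    intro Γ Λ Δ₁ Δ₂ m V u C _ hN hn ih
    refine ⟨ih.nodup_lin, ih.lin_none, ih.lin_mem, hn, ?_, ?_, ih.typed⟩ <;> intro v hv <;>
      rcases Multiset.mem_add.1 (keys_add Δ₁ Δ₂ ▸ hv) with hv | hv
    · exact ih.not_shared v hv
    · exact (hN.not_shared_and_name_none v hv).1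
    · exact ih.name_none v hv
    · exact (hN.not_shared_and_name_none v hv).2
  case par =>
    intro Γ Λ₁ Λ₂ Δ₁ Δ₂ P Q _ _ hΛ hΔ ih₁ ih₂
    exact ih₁.add ih₂ hΛ hΔ
  case resS =>
    intro Γ Λ Δ s S P _ ih
    refine ⟨ih.nodup_lin, ih.lin_none, ih.lin_mem, ?_, ?_, ?_, ih.typed⟩
    · have := ih.nodup
      simp only [keys_cons, Multiset.nodup_cons] at this
      exact this.2.2
    · exact fun v hv => ih.not_shared v (by simp [keys_cons, hv])
    · exact fun v hv => ih.name_none v (by simp [keys_cons, hv])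
  case resC =>
    intro Γ Λ Δ a U P _ ih
    have : WellFormed (Γ.bindName (aname a) (.chan U)) Λ
        (sessPart (aname a) (.chan U) + Δ) P.fv := by simpa [sessPart] using ih
    exact this.bindName.1
  case send =>
    intro Γ Λ₁ Λ₂ Δ₁ Δ₂ Δ u U S V P e _ _ hΛ hΔ ih₁ ih₂
    have := ih₁.add ih₂ hΛ hΔ
    rw [e] at this
    rw [Proc.fv, Finset.union_comm]
    exact this.congr_keys (by simp [keys_cons])
  case rcv =>
    intro Γ Λ Δ u U S y P _ ih
    exact ih.bindVar.congr_keys (by simp [keys_cons])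
  case req =>
    intro Γ Λ Δ₁ Δ₂ u U V P _ _ _ hΔ ih₁ ih₂
    have := ih₁.add ih₂ (by simpa using ih₁.nodup_lin) hΔ
    rw [add_zero] at this
    rw [Proc.fv, Finset.union_comm]
    exact this
  case acc => exact fun _ _ ih => ih.bindVar
  case sel =>
    intro Γ Λ Δ u I S l P _ ih
    exact ih.congr_keys (by simp [keys_cons])
  case bra =>
    intro Γ Λ Δ u I S P hI _ ih
    obtain ⟨l, hl⟩ := hI
    have h₀ := (ih ⟨l, hl⟩).congr_keys (Δ' := (u, .bra I S) ::ₘ Δ) (by simp [keys_cons])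
    refine ⟨h₀.nodup_lin, h₀.lin_none, fun x hx => ?_, h₀.nodup, h₀.not_shared, h₀.name_none, ?_⟩
    · simp only [Proc.fv, Finset.mem_biUnion]
      exact ⟨_, Finset.mem_univ _, h₀.lin_mem x hx⟩
    · intro x hx
      simp only [Proc.fv, Finset.mem_biUnion] at hx
      obtain ⟨l', _, hx⟩ := hx
      exact (ih l').typed x hx

theorem HasV.wellFormed {Γ Λ Δ V U} (h : HasV Γ Λ Δ V U) : WellFormed Γ Λ Δ V.fv := by
  -- The premise of a promotion is about a linear abstraction.
  have hab : ∀ {Λ Δ V U}, HasV Γ Λ Δ V U → ∀ {y C P}, V = .abs .lin y C P →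
      WellFormed Γ Λ Δ V.fv := by
    intro Λ Δ V U h y C P e
    cases h with
    | abs h => exact h.wellFormed.bindName.1
    | _ => cases e
  cases h with
  | lvar hx => constructor <;> simp [keys, hx, Val.fv]
  | sh hx => constructor <;> simp [keys, hx, Val.fv]
  | prom h => simpa only [Val.fv] using hab h rfl
  | abs h => exact h.wellFormed.bindName.1

/-! ### Environments of the target system -/

/-- The environment `u_i : M_1, …, u_{i+n-1} : M_n` for the name `u_i`. -/
def Name.assign (u : Name) (Ms : List MS) : TSEnv := ↑((u.block Ms.length).zip Ms)

theorem Name.block_succ (u : Name) (n : ℕ) :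
    u.block (n + 1) = .src u :: (u.shift 1).block n := by
  simp only [Name.block, List.range_succ_eq_map, List.map_cons, List.map_map, Name.shift_zero]
  congr 1
  apply List.map_congr_left
  intro j _
  simp [Name.shift_shift, Nat.add_comm]

theorem Name.length_block (u : Name) (n : ℕ) : (u.block n).length = n := by
  simp [Name.block]

theorem Name.mem_block {u : Name} {n : ℕ} {v : TName} (h : v ∈ u.block n) :
    ∃ j, v = .src (u.shift j) := by
  simp only [Name.block, List.mem_map] at h
  obtain ⟨j, _, rfl⟩ := h
  exact ⟨j, rfl⟩

theorem Name.nodup_block (u : Name) (n : ℕ) : (u.block n).Nodup := by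
  refine List.Nodup.map ?_ List.nodup_range
  intro i j h
  exact u.shift_injective (TName.src.inj h)

theorem Name.assign_nil (u : Name) : u.assign [] = 0 := rfl

theorem Name.assign_cons (u : Name) (M : MS) (Ms : List MS) :
    u.assign (M :: Ms) = (.src u, M) ::ₘ (u.shift 1).assign Ms := by
  simp [Name.assign, Name.block_succ]

theorem Name.keys_assign (u : Name) (Ms : List MS) :
    keys (u.assign Ms) = ↑(u.block Ms.length) := by
  simp only [keys, Name.assign, Multiset.map_coe]
  rw [List.map_fst_zip]
  simp [Name.length_block]

theorem Name.nodup_assign (u : Name) (Ms : List MS) : (keys (u.assign Ms)).Nodup := by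
  rw [Name.keys_assign]
  exact u.nodup_block _

theorem Name.mem_keys_assign {u : Name} {Ms : List MS} {v : TName} (h : v ∈ keys (u.assign Ms)) :
    ∃ j, v = .src (u.shift j) := by
  rw [Name.keys_assign] at h
  exact Name.mem_block h

/-- Decomposition of a session environment, after its names have been renamed by `f` and those in
`d` have been discarded. Names are discarded when their session is complete. -/
def SEnv.decomp (f : Name → Name) (d : Finset Name) (Δ : SEnv) : TSEnv :=
  Δ.bind fun p => if p.1 ∈ d then 0 else (f p.1).assign p.2.G

namespace SEnv

variable {f g : Name → Name} {d : Finset Name}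

theorem decomp_zero : decomp f d 0 = 0 := rfl

theorem decomp_add (Δ₁ Δ₂ : SEnv) : decomp f d (Δ₁ + Δ₂) = decomp f d Δ₁ + decomp f d Δ₂ :=
  Multiset.add_bind _ _ _

theorem decomp_cons_mem {u : Name} (hu : u ∈ d) (S : STy) (Δ : SEnv) :
    decomp f d ((u, S) ::ₘ Δ) = decomp f d Δ := by
  simp [decomp, Multiset.cons_bind, hu]

theorem decomp_cons {u : Name} (hu : u ∉ d) (S : STy) (Δ : SEnv) :
    decomp f d ((u, S) ::ₘ Δ) = (f u).assign S.G + decomp f d Δ := by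
  simp [decomp, Multiset.cons_bind, hu]

theorem decomp_congr {d' : Finset Name} {Δ : SEnv} (hd : ∀ v ∈ keys Δ, v ∈ d ↔ v ∈ d')
    (h : ∀ v ∈ keys Δ, v ∉ d → f v = g v) : decomp f d Δ = decomp g d' Δ := by
  refine Multiset.bind_congr fun p hp => ?_
  have hk : p.1 ∈ keys Δ := Multiset.mem_map_of_mem _ hp
  by_cases hpd : p.1 ∈ d
  · simp [hpd, (hd _ hk).1 hpd]
  · simp [hpd, mt (hd _ hk).2 hpd, h _ hk hpd]

theorem decomp_id (Δ : SEnv) : decomp id ∅ Δ = SEnv.G Δ := by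
  simp [decomp, SEnv.G, Name.assign]

end SEnv

theorem STy.G_ne_nil (S : STy) : S.G ≠ [] := by
  cases S <;> simp [STy.G]

theorem CTy.G_ne_nil (C : CTy) : C.G ≠ [] := by
  cases C <;> simp [CTy.G, STy.G_ne_nil]

theorem SEnv.mem_keys_decomp {f : Name → Name} {d : Finset Name} {Δ : SEnv} {u : Name}
    (hu : u ∈ keys Δ) (hd : u ∉ d) : TName.src (f u) ∈ keys (SEnv.decomp f d Δ) := by
  obtain ⟨S, hS⟩ := mem_keys.1 hu
  obtain ⟨Δ', rfl⟩ := Multiset.exists_cons_of_mem hS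
  rw [SEnv.decomp_cons hd, keys_add]
  obtain ⟨M, Ms, e⟩ := List.exists_cons_of_ne_nil S.G_ne_nil
  simp [e, Name.assign_cons, keys_cons]

/-- Input ends of the propagators `c_a, …, c_{b-1}`, typed by `T`. -/
def propsIn (T : ℕ → MS) (a b : ℕ) : TSEnv := (Finset.Ico a b).val.map fun j => (.prop j true, T j)

/-- Output ends of the propagators `c_a, …, c_{b-1}`, typed by the duals of `T`. -/
def propsOut (T : ℕ → MS) (a b : ℕ) : TSEnv :=
  (Finset.Ico a b).val.map fun j => (.prop j false, (T j).dual)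

theorem keys_propsIn (T : ℕ → MS) (a b : ℕ) :
    keys (propsIn T a b) = props true (Finset.Ico a b) := by
  simp [keys, propsIn, props]

theorem keys_propsOut (T : ℕ → MS) (a b : ℕ) :
    keys (propsOut T a b) = props false (Finset.Ico a b) := by
  simp [keys, propsOut, props]

theorem balancedEnv_props (T : ℕ → MS) (a b a' b' : ℕ) :
    BalancedEnv (propsIn T a b + propsOut T a' b') := by
  intro u M M' _ h h'
  simp only [propsIn, propsOut, Multiset.mem_add, Multiset.mem_map, Prod.mk.injEq] at h h'
  rcases h with ⟨j, _, rfl, rfl⟩ | ⟨j, _, rfl, rfl⟩ <;>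
    rcases h' with ⟨j', _, e, rfl⟩ | ⟨j', _, e, rfl⟩ <;>
    simp_all [TName.dual, MS.dual_dual]

theorem Ico_val_cons {a b : ℕ} (h : a < b) :
    (Finset.Ico a b).val = a ::ₘ (Finset.Ico (a + 1) b).val := by
  rw [← Finset.insert_Ico_succ_left_eq_Ico h, Finset.insert_val_of_notMem (by simp)]
  rfl

theorem propsIn_cons (T : ℕ → MS) {a b : ℕ} (h : a < b) :
    propsIn T a b = (.prop a true, T a) ::ₘ propsIn T (a + 1) b := by
  rw [propsIn, Ico_val_cons h, Multiset.map_cons]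
  rfl

theorem propsOut_cons (T : ℕ → MS) {a b : ℕ} (h : a < b) :
    propsOut T a b = (.prop a false, (T a).dual) ::ₘ propsOut T (a + 1) b := by
  rw [propsOut, Ico_val_cons h, Multiset.map_cons]
  rfl

theorem propsIn_self (T : ℕ → MS) (a : ℕ) : propsIn T a a = 0 := by simp [propsIn]

theorem propsOut_self (T : ℕ → MS) (a : ℕ) : propsOut T a a = 0 := by simp [propsOut]

theorem Ico_val_add {a m b : ℕ} (h₁ : a ≤ m) (h₂ : m ≤ b) :
    (Finset.Ico a b).val = (Finset.Ico a m).val + (Finset.Ico m b).val := by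
  rw [← Finset.Ico_union_Ico_eq_Ico h₁ h₂, ← Finset.disjUnion_eq_union _ _
    (Finset.Ico_disjoint_Ico_consecutive a m b)]
  rfl

/-- The types of propagators `c_k, c_{k+1}, …` that are `M` for `c_k`, are given by `T₁` below `m`
and by `T₂` from `m` on. -/
def glue (k m : ℕ) (M : MS) (T₁ T₂ : ℕ → MS) (j : ℕ) : MS :=
  if j = k then M else if j < m then T₁ j else T₂ j

theorem glue_self (k m : ℕ) (M : MS) (T₁ T₂ : ℕ → MS) : glue k m M T₁ T₂ k = M := if_pos rfl

theorem propsIn_glue {k m b : ℕ} (M : MS) (T₁ T₂ : ℕ → MS) (h₁ : k + 1 ≤ m) (h₂ : m ≤ b) :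
    propsIn (glue k m M T₁ T₂) k b =
      (.prop k true, M) ::ₘ (propsIn T₁ (k + 1) m + propsIn T₂ m b) := by
  rw [propsIn_cons _ (by omega), glue_self, propsIn, Ico_val_add h₁ h₂, Multiset.map_add]
  congr 2 <;> refine Multiset.map_congr rfl fun j hj => ?_ <;>
    simp only [Finset.mem_val, Finset.mem_Ico] at hj
  · rw [glue, if_neg (by omega), if_pos (by omega)]
  · rw [glue, if_neg (by omega), if_neg (by omega)]

theorem propsOut_glue {k m b : ℕ} (M : MS) (T₁ T₂ : ℕ → MS) (h₁ : k + 1 ≤ m) (h₂ : m ≤ b) :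
    propsOut (glue k m M T₁ T₂) (k + 1) b = propsOut T₁ (k + 1) m + propsOut T₂ m b := by
  rw [propsOut, Ico_val_add h₁ h₂, Multiset.map_add]
  congr 1 <;> refine Multiset.map_congr rfl fun j hj => ?_ <;>
    simp only [Finset.mem_val, Finset.mem_Ico] at hj
  · rw [glue, if_neg (by omega), if_pos (by omega)]
  · rw [glue, if_neg (by omega), if_neg (by omega)]

/-! ### Derived rules of the target system -/

theorem TCtx.bindNames_of_notMem {Γ : TCtx} {ys : List (TName × MC)} {v : TName}
    (h : ∀ p ∈ ys, p.1 ≠ v) : (Γ.bindNames ys).name v = Γ.name v := by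
  have : ys.lookup v = none := by
    rw [List.lookup_eq_none_iff]
    intro p hp
    simpa using (h p hp).symm
  simp [TCtx.bindNames, this]

theorem List.mem_of_lookup {α β : Type} [BEq α] [LawfulBEq α] {l : List (α × β)} {a : α} {b : β}
    (h : l.lookup a = some b) : (a, b) ∈ l := by
  obtain ⟨l₁, l₂, rfl, _⟩ := List.lookup_eq_some_iff.1 h
  simp

theorem sessParts_sess (u : Name) (Ms : List MS) :
    sessParts ((u.block Ms.length).zip (Ms.map .sess)) = u.assign Ms := by
  rw [sessParts, Name.assign, List.zip_map_right, List.filterMap_map]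
  congr 1
  convert List.filterMap_some using 2
  rfl

theorem THasNs.block {Γ : TCtx} (u : Name) (Ms : List MS)
    (h : ∀ v ∈ keys (u.assign Ms), ¬ v.IsShared ∧ Γ.name v = none) :
    THasNs Γ (u.assign Ms) (u.block Ms.length) (Ms.map .sess) := by
  induction Ms generalizing u with
  | nil => exact THasNs.nil
  | cons M Ms ih =>
    have hn := u.nodup_assign (M :: Ms)
    rw [Name.assign_cons] at h hn ⊢
    rw [keys_cons] at h
    rw [List.length_cons, Name.block_succ, List.map_cons, ← Multiset.singleton_add]
    refine .cons (.sess (h _ (by simp)).1 (h _ (by simp)).2)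
      (ih _ fun v hv => h v (by simp [hv])) ?_
    simpa using hn

/-- All propagators of a range can be restricted at once, as they are typed dually. -/
theorem THasP.resProps {Γ : TCtx} {Λ : TLEnv} {Δ : TSEnv} {T : ℕ → MS} {P : TProc} (k n : ℕ)
    (h : THasP Γ Λ (Δ + (propsIn T k (k + n) + propsOut T k (k + n))) P) :
    THasP Γ Λ Δ (resProps k n P) := by
  induction n generalizing k Δ with
  | zero => simpa [_root_.resProps, propsIn_self, propsOut_self] using h
  | succ n ih =>
    have e : _root_.resProps k (n + 1) P =
        .resS (.prop k true) none (_root_.resProps (k + 1) n P) := by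
      simp [_root_.resProps, List.range_succ_eq_map, List.foldr_map, Nat.add_comm,
        Nat.add_left_comm]
    rw [e]
    refine .resS (M := T k) trivial (Or.inl rfl) (ih _ ?_)
    rw [propsIn_cons _ (by omega), propsOut_cons _ (by omega)] at h
    rw [show k + 1 + n = k + (n + 1) by omega]
    convert h using 1
    simp only [← Multiset.singleton_add, TName.dual, Bool.not_true]
    abel

/-- The tuple `s_i, …, s_{i+n-1}` can be restricted when the dual names are typed dually. -/
theorem THasP.resBlock {Γ : TCtx} {Λ : TLEnv} {Δ : TSEnv} {P : TProc} (s : Ident) (i : ℕ)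
    (Ms : List MS)
    (h : THasP Γ Λ ((Name.sess s true i).assign Ms +
      ((Name.sess s false i).assign (Ms.map MS.dual) + Δ)) P) :
    THasP Γ Λ Δ (resBlock (((Name.sess s true i).block Ms.length).zip Ms) P) := by
  induction Ms generalizing i Δ with
  | nil => simpa [_root_.resBlock, Name.assign_nil] using h
  | cons M Ms ih =>
    rw [List.length_cons, Name.block_succ, List.zip_cons_cons]
    refine .resS (M := M) trivial (Or.inr rfl) (ih (i + 1) ?_)
    rw [List.map_cons, Name.assign_cons, Name.assign_cons] at h
    convert h using 1
    simp only [← Multiset.singleton_add, TName.dual, Bool.not_true, Name.shift]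
    abel

/-- Output on a session name, whose session is discarded at once. -/
theorem THasP.send_fin {Γ : TCtx} {Λ₁ Λ₂ : TLEnv} {Δ₁ Δ₂ : TSEnv} {u : TName} {Us : List MU}
    {Vs : List TVal} {P : TProc} (hu : ¬ u.IsShared) (hΓ : Γ.name u = none) (hUs : Us ≠ [])
    (hP : THasP Γ Λ₁ Δ₁ P) (hV : THasVs Γ Λ₂ Δ₂ Vs Us) (hΛ : (keys (Λ₁ + Λ₂)).Nodup)
    (hΔ : (u ::ₘ keys (Δ₁ + Δ₂)).Nodup) :
    THasP Γ (Λ₁ + Λ₂) ((u, .out Us) ::ₘ (Δ₁ + Δ₂)) (.out u Vs P) := by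
  have hu' := (Multiset.nodup_cons.1 hΔ).1
  rw [keys_add, Multiset.mem_add, not_or] at hu'
  refine .send (Δ₁ := (u, .fin) ::ₘ Δ₁) hUs (by simp) (.fin hu hΓ hu'.1 hP) hV hΛ ?_
  simpa [keys_cons, keys_add] using hΔ

/-- Input on a session name, whose session is discarded at once. -/
theorem THasP.rcv_fin {Γ : TCtx} {Λ : TLEnv} {Δ : TSEnv} {u : TName} {Us : List MU}
    {xs : List TVar} {P : TProc} (hu : ¬ u.IsShared) (hΓ : Γ.name u = none) (hUs : Us ≠ [])
    (hxs : xs.Nodup) (hl : xs.length = Us.length) (hΔ : u ∉ keys Δ)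
    (hP : THasP (Γ.bindVars (xs.zip Us)) (linParts (xs.zip Us) + Λ) Δ P) :
    THasP Γ Λ ((u, .inp Us) ::ₘ Δ) (.inp u xs P) :=
  .rcv hUs hxs hl (.fin hu hΓ hΔ hP)

theorem THasVs.single {Γ : TCtx} {Λ : TLEnv} {Δ : TSEnv} {V : TVal} {U : MU}
    (h : THasV Γ Λ Δ V U) (hΛ : (keys Λ).Nodup) (hΔ : (keys Δ).Nodup) :
    THasVs Γ Λ Δ [V] [U] := by
  have := THasVs.cons h .nil (by simpa using hΛ) (by simpa using hΔ)
  simpa using this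

/-- Shared variables can be used linearly, several at a time. -/
theorem THasP.eproms {Γ : TCtx} {Λ : TLEnv} {Δ : TSEnv} {P : TProc} (L : TLEnv)
    (hL : (keys L).Nodup) (hΓ : ∀ p ∈ L, Γ.var p.1 = some p.2)
    (h : THasP { Γ with var := fun x => if x ∈ keys L then none else Γ.var x } (L + Λ) Δ P) :
    THasP Γ Λ Δ P := by
  induction L using Multiset.induction_on generalizing Γ Λ with
  | empty => simpa [keys] using h
  | cons p L ih =>
    rw [keys_cons, Multiset.nodup_cons] at hL
    refine .eprom (x := p.1) (Cs := p.2) (hΓ p (by simp)) (ih hL.2 ?_ ?_)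
    · intro q hq
      have hne : q.1 ≠ p.1 := fun e => hL.1 (e ▸ Multiset.mem_map_of_mem _ hq)
      simpa [TCtx.eraseVar, hne] using hΓ q (by simp [hq])
    · convert h using 1
      · simp only [TCtx.eraseVar, keys_cons, Multiset.mem_cons]
        congr 1
        funext x
        by_cases hx : x = p.1 <;> by_cases hx' : x ∈ keys L <;> simp [hx, hx']
      · simp

theorem dummyVal_typed (Γ : TCtx) : THasV Γ 0 0 dummyVal (.ho .shr [.sess .fin]) := by
  refine .prom (.abs (by simp) (by simp) (by simp [TName.IsVar]) ?_)
  simp only [sessParts, List.filterMap_cons, List.filterMap_nil, Multiset.coe_singleton,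
    ← Multiset.cons_zero, Multiset.cons_add, zero_add]
  exact .fin (by simp [TName.IsShared, Name.IsShared]) (by simp [TCtx.bindNames]) (by simp [keys])
    .nil

/-! ### Exchanging contexts on propagators -/

/-- Whether a value type is linear. -/
def MU.isLin : MU → Bool
  | .ho .lin _ => true
  | .ho .shr _ => false

/-- `U` is the type that `Γ` and `Λ` assign to `x`, decomposed. -/
def AssignedType (Γ : SCtx) (Λ : LEnv) (x : ℕ) (U : MU) : Prop :=
  (∃ C, Γ.var x = some C ∧ U = .ho .shr C.G) ∨ ∃ C, (x, C) ∈ Λ ∧ U = .ho .lin C.G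

/-- `U` is a type at which `x` can be received when it is used as `Γ` and `Λ` say: a linear
variable may also be received as a shared one, since shared variables can be used linearly. -/
def ReceivableType (Γ : SCtx) (Λ : LEnv) (x : ℕ) (U : MU) : Prop :=
  (∃ C, Γ.var x = some C ∧ U = .ho .shr C.G) ∨ ∃ C m, (x, C) ∈ Λ ∧ U = .ho m C.G

theorem AssignedType.receivable {Γ Λ x U} (h : AssignedType Γ Λ x U) : ReceivableType Γ Λ x U :=
  h.imp id fun ⟨C, hC⟩ => ⟨C, .lin, hC⟩

theorem WellFormed.exists_assignedType {Γ Λ Δ X} (h : WellFormed Γ Λ Δ X) :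
    ∃ τ : ℕ → MU, ∀ x ∈ X, AssignedType Γ Λ x (τ x) := by
  have : ∀ x, ∃ U, x ∈ X → AssignedType Γ Λ x U := by
    intro x
    by_cases hx : x ∈ X
    · rcases h.typed x hx with ⟨C, hC⟩ | hC
      · exact ⟨_, fun _ => Or.inl ⟨C, hC, rfl⟩⟩
      · obtain ⟨C, hC⟩ := mem_keys.1 hC
        exact ⟨_, fun _ => Or.inr ⟨C, hC, rfl⟩⟩
    · exact ⟨.ho .lin [], fun h => absurd h hx⟩
  choose τ hτ using this
  exact ⟨τ, hτ⟩

/-- The target environment `Γt` assigns to the variables in `X` what `Γ` does. -/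
def VarsAgree (Γ : SCtx) (Γt : TCtx) (X : Finset ℕ) : Prop :=
  ∀ x ∈ X, Γt.var (.src x) = (Γ.var x).map CTy.G

theorem VarsAgree.mono {Γ Γt X Y} (h : VarsAgree Γ Γt Y) (hXY : X ⊆ Y) : VarsAgree Γ Γt X :=
  fun x hx => h x (hXY hx)

theorem eq_of_nodup_keys {α β : Type} {E : Multiset (α × β)} (h : (keys E).Nodup) {a : α}
    {b c : β} (hb : (a, b) ∈ E) (hc : (a, c) ∈ E) : b = c := by
  have := Multiset.inj_on_of_nodup_map h _ hb _ hc rfl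
  exact congrArg Prod.snd this

theorem LEnv.keys_G (Λ : LEnv) : keys (LEnv.G Λ) = (keys Λ).map .src := by
  simp [keys, LEnv.G, Multiset.map_map]

theorem LEnv.nodup_keys_G {Λ : LEnv} (h : (keys Λ).Nodup) : (keys (LEnv.G Λ)).Nodup := by
  rw [LEnv.keys_G]
  exact h.map fun _ _ e => TVar.src.inj e

theorem LEnv.G_add (Λ₁ Λ₂ : LEnv) : LEnv.G (Λ₁ + Λ₂) = LEnv.G Λ₁ + LEnv.G Λ₂ :=
  Multiset.map_add _ _ _

theorem nodup_keys_filter {α β : Type} {E : Multiset (α × β)} (p : α × β → Prop) [DecidablePred p]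
    (h : (keys E).Nodup) : (keys (E.filter p)).Nodup :=
  Multiset.nodup_of_le (Multiset.map_le_map (Multiset.filter_le _ _)) h

theorem mem_linParts {ys : List (TVar × MU)} {v : TVar} {Cs : List MC} :
    (v, Cs) ∈ linParts ys ↔ (v, .ho .lin Cs) ∈ ys := by
  simp only [linParts, Multiset.mem_coe, List.mem_filterMap]
  constructor
  · rintro ⟨⟨w, U⟩, hw, e⟩
    rcases U with ⟨_ | _, Ds⟩
    · simp only [Option.some.injEq, Prod.mk.injEq] at e
      obtain ⟨rfl, rfl⟩ := e
      exact hw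
    · simp at e
  · exact fun h => ⟨_, h, rfl⟩

theorem keys_linParts_le (ys : List (TVar × MU)) : keys (linParts ys) ≤ ↑(ys.map Prod.fst) := by
  induction ys with
  | nil => simp [linParts, keys]
  | cons p ys ih =>
    obtain ⟨v, _ | _, Cs⟩ := p
    · have : linParts ((v, .ho .lin Cs) :: ys) = (v, Cs) ::ₘ linParts ys := rfl
      rw [this, keys_cons, List.map_cons, ← Multiset.cons_coe]
      exact Multiset.cons_le_cons _ ih
    · have : linParts ((v, .ho .shr Cs) :: ys) = linParts ys := rfl
      rw [this, List.map_cons, ← Multiset.cons_coe]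
      exact ih.trans (Multiset.le_cons_self _ _)

/-- The tuple `xs` of variables together with their types. -/
def typedVars (xs : List ℕ) (τ : ℕ → MU) : List (TVar × MU) := xs.map fun x => (.src x, τ x)

theorem zip_typedVars (xs : List ℕ) (τ : ℕ → MU) :
    (xs.map TVar.src).zip (xs.map τ) = typedVars xs τ := List.zip_map'

theorem map_fst_typedVars (xs : List ℕ) (τ : ℕ → MU) :
    (typedVars xs τ).map Prod.fst = xs.map .src := by
  simp [typedVars]

theorem nodup_keys_linParts {xs : List ℕ} (hxs : xs.Nodup) (τ : ℕ → MU) :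
    (keys (linParts (typedVars xs τ))).Nodup := by
  refine Multiset.nodup_of_le (keys_linParts_le _) ?_
  rw [map_fst_typedVars, Multiset.coe_nodup]
  exact hxs.map fun _ _ e => TVar.src.inj e

/-- Reception at receivable types adds to the linear environment those variables of `Λ` that are
received linearly. -/
theorem linParts_typedVars {Γ Λ Δ X} {xs : List ℕ} {τ : ℕ → MU} (h : WellFormed Γ Λ Δ X)
    (hxs : xs.Nodup) (hX : ∀ x, x ∈ xs ↔ x ∈ X) (hτ : ∀ x ∈ X, ReceivableType Γ Λ x (τ x)) :
    linParts (typedVars xs τ) = LEnv.G (Λ.filter fun p => (τ p.1).isLin) := by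
  refine (Multiset.Nodup.ext (Multiset.Nodup.of_map _ (nodup_keys_linParts hxs τ))
    (Multiset.Nodup.of_map _ (LEnv.nodup_keys_G (nodup_keys_filter _ h.nodup_lin)))).2 ?_
  rintro ⟨v, Cs⟩
  rw [mem_linParts]
  simp only [typedVars, List.mem_map, Prod.mk.injEq, LEnv.G, Multiset.mem_map,
    Multiset.mem_filter, Prod.exists]
  constructor
  · rintro ⟨x, hx, rfl, e⟩
    rcases hτ x ((hX x).1 hx) with ⟨C, _, e'⟩ | ⟨C, m, hC, e'⟩
    · simp [e] at e'
    · rw [e] at e'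
      injection e' with e₁ e₂
      exact ⟨x, C, ⟨hC, by simp [e, MU.isLin]⟩, rfl, e₂.symm⟩
  · rintro ⟨x, C, ⟨hC, hl⟩, rfl, rfl⟩
    have hk : x ∈ keys Λ := mem_keys.2 ⟨C, hC⟩
    have hx := h.lin_mem x hk
    refine ⟨x, (hX x).2 hx, rfl, ?_⟩
    rcases hτ x hx with ⟨C', e', _⟩ | ⟨C', m, hC', e'⟩
    · simp [h.lin_none x hk] at e'
    · obtain rfl := eq_of_nodup_keys h.nodup_lin hC hC'
      cases m
      · exact e'
      · simp [e', MU.isLin] at hl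

theorem lookup_typedVars {xs : List ℕ} {x : ℕ} (τ : ℕ → MU) (hx : x ∈ xs) :
    (typedVars xs τ).lookup (.src x) = some (τ x) := by
  induction xs with
  | nil => simp at hx
  | cons y xs ih =>
    rw [typedVars, List.map_cons, List.lookup_cons]
    by_cases hxy : x = y
    · simp [hxy]
    · have : x ∈ xs := by simpa [hxy] using hx
      have hne : (TVar.src x == TVar.src y) = false := by simp [hxy]
      rw [hne]
      exact ih this

/-- Receiving the context of a process on a propagator. The types at which it is received may be
shared where the process needs linear ones. -/
theorem THasP.ctxIn {Γ Λ Δ X} {Γt : TCtx} {Δt : TSEnv} {k : ℕ} {xs : List ℕ} {τ : ℕ → MU}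
    {R : TProc} (h : WellFormed Γ Λ Δ X) (hxs : xs.Nodup) (hX : ∀ x, x ∈ xs ↔ x ∈ X)
    (hτ : ∀ x ∈ X, ReceivableType Γ Λ x (τ x)) (hΓt : Γt.name (.prop k true) = none)
    (hk : TName.prop k true ∉ keys Δt)
    (hR : ∀ Γt' : TCtx, Γt'.name = Γt.name → VarsAgree Γ Γt' X →
      THasP Γt' (LEnv.G Λ) Δt R) :
    THasP Γt 0 ((.prop k true, .inp (payload (xs.map τ))) ::ₘ Δt) (ctxIn k xs R) := by
  by_cases hnil : xs = []
  · subst hnil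
    have hΛ : Λ = 0 := by
      refine Multiset.eq_zero_of_forall_notMem fun p hp => ?_
      simpa using (hX p.1).2 (h.lin_mem p.1 (Multiset.mem_map_of_mem _ hp))
    subst hΛ
    have hR' := hR (Γt.bindVars [(.aux, .ho .shr [.sess .fin])]) rfl
      fun x hx => absurd ((hX x).2 hx) (by simp)
    simp only [_root_.ctxIn, payload, List.map_nil, if_true]
    exact .rcv_fin (by simp [TName.IsShared]) hΓt (by simp) (by simp) (by simp) hk
      (by simpa [linParts, LEnv.G] using hR')
  · have hp : payload (xs.map τ) = xs.map τ := by simp [payload, hnil]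
    simp only [_root_.ctxIn, hp, if_neg hnil]
    refine .rcv_fin (by simp [TName.IsShared]) hΓt (by simpa using hnil)
      (hxs.map fun _ _ e => TVar.src.inj e) (by simp) hk ?_
    rw [zip_typedVars, linParts_typedVars h hxs hX hτ, add_zero]
    -- Linear variables that have been received as shared ones are used linearly from here on.
    refine .eproms (LEnv.G (Λ.filter fun p => ¬ (τ p.1).isLin))
      (LEnv.nodup_keys_G (nodup_keys_filter _ h.nodup_lin)) ?_ ?_
    · intro p hp
      simp only [LEnv.G, Multiset.mem_map, Multiset.mem_filter, Prod.exists] at hp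
      obtain ⟨x, C, ⟨hC, hl⟩, rfl⟩ := hp
      have hk : x ∈ keys Λ := mem_keys.2 ⟨C, hC⟩
      have hx := h.lin_mem x hk
      have hτx : τ x = .ho .shr C.G := by
        rcases hτ x hx with ⟨C', e', _⟩ | ⟨C', m, hC', e'⟩
        · simp [h.lin_none x hk] at e'
        · obtain rfl := eq_of_nodup_keys h.nodup_lin hC hC'
          cases m
          · simp [e', MU.isLin] at hl
          · exact e'
      simp [TCtx.bindVars, lookup_typedVars τ ((hX x).2 hx), hτx]
    · rw [← LEnv.G_add, add_comm, Multiset.filter_add_not]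
      refine hR _ rfl fun x hx => ?_
      simp only [TCtx.bindVars, lookup_typedVars τ ((hX x).2 hx)]
      rcases hτ x hx with ⟨C, e, e'⟩ | ⟨C, m, hC, e'⟩
      · rw [if_neg, e', e]
        · rfl
        · rw [LEnv.keys_G]
          intro hm
          obtain ⟨y, hy, e''⟩ := Multiset.mem_map.1 hm
          obtain rfl := TVar.src.inj e''
          have : y ∈ keys Λ := Multiset.mem_of_le (Multiset.map_le_map (Multiset.filter_le _ _)) hy
          simp [h.lin_none y this] at e
      · rw [h.lin_none x (mem_keys.2 ⟨C, hC⟩), Option.map_none]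
        cases m with
        | lin => simp [e']
        | shr =>
          rw [if_pos]
          rw [LEnv.keys_G, Multiset.mem_map]
          refine ⟨x, mem_keys.2 ⟨C, Multiset.mem_filter.2 ⟨hC, ?_⟩⟩, rfl⟩
          simp [e', MU.isLin]

/-- A tuple of variables has the types `τ` and uses its linear variables. -/
theorem THasVs.vars {Γt : TCtx} {τ : ℕ → MU} {xs : List ℕ} (hxs : xs.Nodup)
    (h : ∀ x ∈ xs, (∀ Cs, τ x = .ho .shr Cs → Γt.var (.src x) = some Cs) ∧
      (∀ Cs, τ x = .ho .lin Cs → Γt.var (.src x) = none)) :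
    THasVs Γt (linParts (typedVars xs τ)) 0 (xs.map fun x => .var (.src x)) (xs.map τ) := by
  induction xs with
  | nil => exact .nil
  | cons x xs ih =>
    have ih := ih (List.nodup_cons.1 hxs).2 fun y hy => h y (by simp [hy])
    have hn := nodup_keys_linParts hxs τ
    obtain ⟨h₁, h₂⟩ := h x (by simp)
    rw [List.map_cons, List.map_cons, typedVars, List.map_cons]
    rw [typedVars, List.map_cons] at hn
    change (keys (linParts (_ :: typedVars xs τ))).Nodup at hn
    change THasVs Γt (linParts (_ :: typedVars xs τ)) _ _ _
    rcases e : τ x with ⟨_ | _, Cs⟩ <;> rw [e] at hn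
    · have e' : linParts ((TVar.src x, MU.ho .lin Cs) :: typedVars xs τ) =
          {(TVar.src x, Cs)} + linParts (typedVars xs τ) := rfl
      rw [e'] at hn ⊢
      exact .cons (Δ₁ := 0) (.lvar (h₂ _ e)) ih hn (by simp [keys])
    · have e' : linParts ((TVar.src x, MU.ho .shr Cs) :: typedVars xs τ) =
          0 + linParts (typedVars xs τ) := by rw [zero_add]; rfl
      rw [e'] at hn ⊢
      exact .cons (Δ₁ := 0) (.sh (h₁ _ e)) ih hn (by simp [keys])

/-- Sending the context of a process on a propagator. -/
theorem THasP.ctxOut {Γ Λ Δ X} {Γt : TCtx} {Λ₁ : TLEnv} {Δt : TSEnv} {j : ℕ} {xs : List ℕ}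
    {τ : ℕ → MU} {P : TProc} (h : WellFormed Γ Λ Δ X) (hxs : xs.Nodup) (hX : ∀ x, x ∈ xs ↔ x ∈ X)
    (hτ : ∀ x ∈ X, AssignedType Γ Λ x (τ x)) (hΓt : Γt.name (.prop j false) = none)
    (hA : VarsAgree Γ Γt X) (hP : THasP Γt Λ₁ Δt P) (hΛ : (keys (Λ₁ + LEnv.G Λ)).Nodup)
    (hΔ : (TName.prop j false ::ₘ keys Δt).Nodup) :
    THasP Γt (Λ₁ + LEnv.G Λ) ((.prop j false, .out (payload (xs.map τ))) ::ₘ Δt)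
      (ctxOut j xs P) := by
  by_cases hnil : xs = []
  · subst hnil
    have hΛ0 : Λ = 0 := by
      refine Multiset.eq_zero_of_forall_notMem fun p hp => ?_
      simpa using (hX p.1).2 (h.lin_mem p.1 (Multiset.mem_map_of_mem _ hp))
    subst hΛ0
    have := THasP.send_fin (Δ₂ := 0) (by simp [TName.IsShared]) hΓt (by simp) hP
      (.single (dummyVal_typed Γt) (by simp [keys]) (by simp [keys])) hΛ (by simpa using hΔ)
    simpa [_root_.ctxOut, payload, LEnv.G] using this
  · have hp : payload (xs.map τ) = xs.map τ := by simp [payload, hnil]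
    have hlin : linParts (typedVars xs τ) = LEnv.G Λ := by
      rw [linParts_typedVars h hxs hX fun x hx => (hτ x hx).receivable, Multiset.filter_eq_self.2]
      rintro ⟨x, C⟩ hC
      have hk : x ∈ keys Λ := mem_keys.2 ⟨C, hC⟩
      rcases hτ x (h.lin_mem x hk) with ⟨C', e', _⟩ | ⟨C', _, e'⟩
      · simp [h.lin_none x hk] at e'
      · simp [e', MU.isLin]
    have hvs : THasVs Γt (linParts (typedVars xs τ)) 0 (xs.map fun x => .var (.src x))
        (xs.map τ) := by
      refine .vars hxs fun x hx => ?_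
      have hxX := (hX x).1 hx
      rw [hA x hxX]
      rcases hτ x hxX with ⟨C, e, e'⟩ | ⟨C, hC, e'⟩
      · simp [e, e']
      · simp [e', h.lin_none x (mem_keys.2 ⟨C, hC⟩)]
    rw [hlin] at hvs
    have := THasP.send_fin (Δ₂ := 0) (by simp [TName.IsShared]) hΓt (by simpa using hnil) hP hvs hΛ
      (by simpa using hΔ)
    simpa [_root_.ctxOut, hp, hnil] using this

/-! ### Admissible renamings -/

/-- The roots of names that may be in use when the breakdown has arrived at the propagator `c_k`:
those in `X`, and the reserved ones that have been taken for a smaller index. -/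
def allowedRoots (k : ℕ) (X : Set Root) : Set Root :=
  X ∪ {r | ∃ j < k, r = .sess (.aux j) ∨ r = .var (.aux j)}

theorem allowedRoots_mono {k k' : ℕ} {X X' : Set Root} (hk : k ≤ k') (hX : X ⊆ X') :
    allowedRoots k X ⊆ allowedRoots k' X' := by
  rintro r (hr | ⟨j, hj, hr⟩)
  · exact Or.inl (hX hr)
  · exact Or.inr ⟨j, by omega, hr⟩

/-- The renaming `f` of the names of a process with shared names `N` leads to the target
environments with shared names `Nt` and session environment `D`, in which every name is
indexed and its root is in use. The set `X` holds the roots of free names and of enclosing binders;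
the reserved roots are kept apart from it. -/
structure Admissible (k : ℕ) (X : Set Root) (f : Name → Name) (N : Name → Option HOTy)
    (Nt : TName → Option MU) (D : TSEnv) : Prop where
  aux_notMem : ∀ j, Root.sess (.aux j) ∉ X ∧ Root.var (.aux j) ∉ X
  captureFree : Name.CaptureFree f
  nodup : (keys D).Nodup
  sess_name : ∀ v ∈ keys D, ∃ w : Name, v = .src w ∧ 1 ≤ w.idx ∧ w.root ∈ allowedRoots k X ∧
    ¬ w.IsShared
  sess_none : ∀ v ∈ keys D, Nt v = none
  shared_name : ∀ u U, N u = some U → Nt (.src (f u)) = some U.G ∧ 1 ≤ (f u).idx ∧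
    (f u).root ∈ allowedRoots k X
  none_of_isSession : ∀ v : TName, v.IsSession → Nt v = none

namespace Admissible

variable {k : ℕ} {X : Set Root} {f : Name → Name} {N : Name → Option HOTy}
  {Nt : TName → Option MU} {D : TSEnv}

theorem mono (h : Admissible k X f N Nt D) {k' : ℕ} {f' : Name → Name} {D' : TSEnv} (hk : k ≤ k')
    (hf : Name.CaptureFree f') (hN : ∀ u U, N u = some U → f' u = f u) (hD : D' ≤ D) :
    Admissible k' X f' N Nt D' := by
  have hDk : keys D' ≤ keys D := Multiset.map_le_map hD
  refine ⟨h.aux_notMem, hf, Multiset.nodup_of_le hDk h.nodup, fun v hv => ?_,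
    fun v hv => h.sess_none v (Multiset.mem_of_le hDk hv), fun u U hu => ?_, h.none_of_isSession⟩
  · obtain ⟨w, hw, h₁, h₂, h₃⟩ := h.sess_name v (Multiset.mem_of_le hDk hv)
    exact ⟨w, hw, h₁, allowedRoots_mono hk subset_rfl h₂, h₃⟩
  · rw [hN u U hu]
    obtain ⟨h₁, h₂, h₃⟩ := h.shared_name u U hu
    exact ⟨h₁, h₂, allowedRoots_mono hk subset_rfl h₃⟩

theorem le (h : Admissible k X f N Nt D) {k' : ℕ} {D' : TSEnv} (hk : k ≤ k') (hD : D' ≤ D) :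
    Admissible k' X f N Nt D' :=
  h.mono hk h.captureFree (fun _ _ _ => rfl) hD

theorem not_shared (h : Admissible k X f N Nt D) {v : TName} (hv : v ∈ keys D) :
    ¬ v.IsShared := by
  obtain ⟨w, rfl, _, _, hw⟩ := h.sess_name v hv
  exact hw

theorem subst_of_shared (h : Admissible k X f N Nt D) {w w' : Name} (hw : TName.src w ∈ keys D)
    (u : Name) (U : HOTy) (hu : N u = some U) : (Name.subst w w' ∘ f) u = f u := by
  have hne : f u ≠ w := by
    intro e
    have h₁ := (h.shared_name u U hu).1
    rw [e, h.sess_none _ hw] at h₁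
    simp at h₁
  simp [Name.subst, Function.update_of_ne hne]

theorem mem_idx (h : Admissible k X f N Nt D) {w : Name} (hw : TName.src w ∈ keys D) :
    1 ≤ w.idx ∧ w.root ∈ allowedRoots k X := by
  obtain ⟨w', e, h₁, h₂, _⟩ := h.sess_name _ hw
  obtain rfl := TName.src.inj e
  exact ⟨h₁, h₂⟩

theorem notMem_prop (h : Admissible k X f N Nt D) (j : ℕ) (p : Bool) : TName.prop j p ∉ keys D := by
  intro hj
  obtain ⟨w, e, _⟩ := h.sess_name _ hj
  cases e

theorem nodup_props (h : Admissible k X f N Nt D) (T T' : ℕ → MS) (a b a' b' : ℕ) :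
    (keys (D + (propsIn T a b + propsOut T' a' b'))).Nodup := by
  rw [keys_add, keys_add, keys_propsIn, keys_propsOut]
  refine Multiset.nodup_add.2 ⟨h.nodup, Multiset.nodup_add.2 ⟨?_, ?_, ?_⟩, ?_⟩
  · exact (Finset.Ico a b).nodup.map fun _ _ e => (TName.prop.inj e).1
  · exact (Finset.Ico a' b').nodup.map fun _ _ e => (TName.prop.inj e).1
  · refine Multiset.disjoint_left.2 fun hv hv' => ?_
    obtain ⟨j, _, rfl⟩ := Multiset.mem_map.1 hv
    obtain ⟨j', _, e⟩ := Multiset.mem_map.1 hv'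
    simp at e
  · refine Multiset.disjoint_left.2 fun hv hv' => ?_
    rcases Multiset.mem_add.1 hv' with hv' | hv' <;>
      obtain ⟨j, _, rfl⟩ := Multiset.mem_map.1 hv' <;>
      exact h.notMem_prop _ _ hv

/-- Names whose roots have not been in use can be added to the session environment. -/
theorem extend (h : Admissible k X f N Nt D) {k' : ℕ} {X' : Set Root} {f' : Name → Name}
    {N' : Name → Option HOTy} {Nt' : TName → Option MU} {D' B : TSEnv} (hk : k ≤ k') (hX : X ⊆ X')
    (haux : ∀ j, Root.sess (.aux j) ∉ X' ∧ Root.var (.aux j) ∉ X')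
    (hf : Name.CaptureFree f') (hD : D' ≤ D) (hB : (keys B).Nodup)
    (hBn : ∀ v ∈ keys B, ∃ w : Name, v = .src w ∧ 1 ≤ w.idx ∧ w.root ∈ allowedRoots k' X' ∧
      w.root ∉ allowedRoots k X ∧ ¬ w.IsShared ∧ Nt' v = none)
    (hNt : ∀ w : Name, w.root ∈ allowedRoots k X → Nt' (.src w) = Nt (.src w))
    (hN : ∀ u U, N' u = some U → f' u = f u ∧ N u = some U ∨
      Nt' (.src (f' u)) = some U.G ∧ 1 ≤ (f' u).idx ∧ (f' u).root ∈ allowedRoots k' X')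
    (hsess : ∀ v : TName, v.IsSession → Nt' v = none) :
    Admissible k' X' f' N' Nt' (B + D') := by
  have hDk : keys D' ≤ keys D := Multiset.map_le_map hD
  have hD' : ∀ v ∈ keys D', ∃ w : Name, v = .src w ∧ 1 ≤ w.idx ∧ w.root ∈ allowedRoots k X ∧
      ¬ w.IsShared := fun v hv => h.sess_name v (Multiset.mem_of_le hDk hv)
  refine ⟨haux, hf, ?_, ?_, ?_, ?_, hsess⟩
  · rw [keys_add]
    refine Multiset.nodup_add.2 ⟨hB, Multiset.nodup_of_le hDk h.nodup,
      Multiset.disjoint_left.2 fun hv hv' => ?_⟩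
    obtain ⟨w, rfl, _, _, hw, _⟩ := hBn _ hv
    obtain ⟨w', e, _, hw', _⟩ := hD' _ hv'
    obtain rfl := TName.src.inj e
    exact hw hw'
  · intro v hv
    rcases Multiset.mem_add.1 (keys_add _ _ ▸ hv) with hv | hv
    · obtain ⟨w, rfl, h₁, h₂, _, h₃, _⟩ := hBn v hv
      exact ⟨w, rfl, h₁, h₂, h₃⟩
    · obtain ⟨w, rfl, h₁, h₂, h₃⟩ := hD' v hv
      exact ⟨w, rfl, h₁, allowedRoots_mono hk hX h₂, h₃⟩
  · intro v hv
    rcases Multiset.mem_add.1 (keys_add _ _ ▸ hv) with hv | hv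
    · obtain ⟨w, rfl, _, _, _, _, h₁⟩ := hBn v hv
      exact h₁
    · obtain ⟨w, rfl, _, h₂, _⟩ := hD' v hv
      rw [hNt w h₂]
      exact h.sess_none _ (Multiset.mem_of_le hDk hv)
  · intro u U hu
    rcases hN u U hu with ⟨e, hu⟩ | h'
    · obtain ⟨h₁, h₂, h₃⟩ := h.shared_name u U hu
      rw [e, hNt _ h₃]
      exact ⟨h₁, h₂, allowedRoots_mono hk hX h₃⟩
    · exact h'

end Admissible

/-- If the decomposition assigns pairwise distinct names, then `f` separates `u` from the other
names of the session environment. -/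
theorem SEnv.ne_of_nodup_decomp {f : Name → Name} {d : Finset Name} {u : Name} {S : STy} {Δ : SEnv}
    (hu : u ∉ d) (h : (keys (decomp f d ((u, S) ::ₘ Δ))).Nodup) {v : Name} (hv : v ∈ keys Δ)
    (hvd : v ∉ d) : f v ≠ f u := by
  intro e
  rw [decomp_cons hu, keys_add] at h
  have h₁ := SEnv.mem_keys_decomp (f := f) hv hvd
  obtain ⟨M, Ms, e'⟩ := List.exists_cons_of_ne_nil S.G_ne_nil
  rw [e', Name.assign_cons, keys_cons, Multiset.cons_add, Multiset.nodup_cons] at h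
  exact h.1 (Multiset.mem_add.2 (Or.inr (e ▸ h₁)))

/-- After a prefix on `u_i`, the name is used as `u_{i+1}`, and it is discarded if the session is
complete. -/
theorem SEnv.exists_decomp_step {f : Name → Name} {d : Finset Name} {u : Name} {S : STy} {Δ : SEnv}
    (hu : u ∉ d) (huΔ : u ∉ keys Δ) (hne : ∀ v ∈ keys Δ, v ∉ d → f v ≠ f u) :
    ∃ d' : Finset Name, (∀ v ∈ d', v ∈ d ∨ v = u ∧ S = .fin) ∧
      decomp ((f u).incr ∘ f) d' ((u, S) ::ₘ Δ) =
        ((f u).shift 1).assign (if S.isEnd then [] else S.G) + decomp f d Δ := by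
  have hcongr : ∀ v ∈ keys Δ, v ∉ d → ((f u).incr ∘ f) v = f v := by
    intro v hv hvd
    simp [Name.incr, Name.subst, Function.update_of_ne (hne v hv hvd)]
  by_cases hS : S.isEnd
  · have hfin : S = .fin := by cases S <;> simp [STy.isEnd] at hS ⊢
    refine ⟨insert u d, ?_, ?_⟩
    · intro v hv
      rcases Finset.mem_insert.1 hv with rfl | hv
      · exact Or.inr ⟨rfl, hfin⟩
      · exact Or.inl hv
    · rw [decomp_cons_mem (Finset.mem_insert_self u d), if_pos hS, Name.assign_nil, zero_add]
      refine (decomp_congr (fun v hv => ?_) fun v hv hvd => (hcongr v hv hvd).symm).symm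
      have : v ≠ u := fun e => huΔ (e ▸ hv)
      simp [this]
  · refine ⟨d, fun v hv => Or.inl hv, ?_⟩
    rw [decomp_cons hu, if_neg hS]
    congr 1
    · simp [Name.incr, Name.subst]
    · exact decomp_congr (fun _ _ => Iff.rfl) hcongr

/-- The decomposed session environment after `u` has been replaced by the name `w`. -/
theorem SEnv.decomp_subst {f : Name → Name} {d : Finset Name} {u w : Name} {S : STy} {Δ : SEnv}
    (hu : u ∉ d) (hne : ∀ v ∈ keys Δ, v ∉ d → f v ≠ f u) :
    decomp (Name.subst (f u) w ∘ f) d ((u, S) ::ₘ Δ) = w.assign S.G + decomp f d Δ := by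
  rw [decomp_cons hu]
  congr 1
  · simp [Name.subst]
  · refine decomp_congr (fun _ _ => Iff.rfl) fun v hv hvd => ?_
    simp [Name.subst, Function.update_of_ne (hne v hv hvd)]

/-! ### Induction statements -/

/-- The session environment `Δ` has no use for the names in `d`: they have type `end` and are not
in `X`. -/
def Discardable (Δ : SEnv) (d X : Finset Name) : Prop :=
  ∀ u S, (u, S) ∈ Δ → u ∈ d → S = .fin ∧ u ∉ X

theorem Discardable.notMem {Δ : SEnv} {d X : Finset Name} (h : Discardable Δ d X) {u : Name}
    {S : STy} (hS : (u, S) ∈ Δ) (hu : u ∈ X) : u ∉ d :=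
  fun hd => (h u S hS hd).2 hu

/-- Induction statement for processes. The breakdown starts from a renaming of `P`, since each
prefix renames its subject; it has no free variables and is typed for an arbitrary assignment of
types to them; and the context is received at types `τ` that the derivation may still promote. The
types of the propagators are given by a function `T`, so that they are balanced. -/
def Proc.BreakdownTypable (Γ : SCtx) (Λ : LEnv) (Δ : SEnv) (P : Proc) : Prop :=
  ∀ (f : Name → Name) (d : Finset Name) (k : ℕ) (xs : List ℕ) (X : Set Root)
    (N : TName → Option MU) (τ : ℕ → MU), Admissible k X f Γ.name N (SEnv.decomp f d Δ) →
    Discardable Δ d P.fn → P.Barendregt X → P.NoUseAfterEnd → xs.Nodup →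
    (∀ x, x ∈ xs ↔ x ∈ P.fv) → (∀ x ∈ P.fv, ReceivableType Γ Λ x (τ x)) →
    ∃ T : ℕ → MS, T k = .inp (payload (xs.map τ)) ∧ ∀ Γt : TCtx, Γt.name = N →
      THasP Γt 0 (SEnv.decomp f d Δ +
        (propsIn T k (k + P.degree) + propsOut T (k + 1) (k + P.degree)))
        ((P.rename f).breakdown k xs)

/-- Induction statement for values. A value of degree `0` uses no propagators. -/
def Val.BreakdownTypable (Γ : SCtx) (Λ : LEnv) (Δ : SEnv) (V : Val) (U : HOTy) : Prop :=
  ∀ (f : Name → Name) (d : Finset Name) (k : ℕ) (xs : List ℕ) (X : Set Root)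
    (N : TName → Option MU) (τ : ℕ → MU), Admissible k X f Γ.name N (SEnv.decomp f d Δ) →
    Discardable Δ d V.fn → V.Barendregt X → V.NoUseAfterEnd → xs.Nodup →
    (∀ x, x ∈ xs ↔ x ∈ V.fv) → (∀ x ∈ V.fv, AssignedType Γ Λ x (τ x)) →
    ∃ T : ℕ → MS, (0 < V.degree → T k = .inp (payload (xs.map τ))) ∧
      ∀ Γt : TCtx, Γt.name = N → VarsAgree Γ Γt V.fv →
        THasV Γt (LEnv.G Λ) (SEnv.decomp f d Δ +
          (propsIn T k (k + V.degree) + propsOut T k (k + V.degree)))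
          ((V.rename f).breakdown k xs) U.G

theorem Proc.mem_fvs {P : Proc} (x : ℕ) : x ∈ P.fvs ↔ x ∈ P.fv := Finset.mem_sort _

theorem Val.mem_fvs {V : Val} (x : ℕ) : x ∈ V.fvs ↔ x ∈ V.fv := Finset.mem_sort _

theorem Proc.nodup_fvs (P : Proc) : P.fvs.Nodup := Finset.sort_nodup _ _

theorem Val.nodup_fvs (V : Val) : V.fvs.Nodup := Finset.sort_nodup _ _

theorem step_sess (u : Name) (S : STy) : step u (.sess S) = u.incr := rfl

theorem step_chan (u : Name) (U : HOTy) : step u (.chan U) = id := rfl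

/-! ### Variables, weakening and inaction -/

namespace BreakdownTypable

theorem lvar {Γ : SCtx} {x : ℕ} {C : CTy} (h : Γ.var x = none) :
    Val.BreakdownTypable Γ {(x, C)} 0 (.var x) (.ho .lin C) := by
  intro f d k xs X N τ _ _ _ _ _ _ _
  refine ⟨fun _ => .fin, by simp [Val.degree], fun Γt _ hV => ?_⟩
  have hx := hV x (by simp [Val.fv])
  rw [h] at hx
  simpa [Val.degree, propsIn_self, propsOut_self, SEnv.decomp_zero, Val.rename, Val.breakdown,
    LEnv.G, HOTy.G] using THasV.lvar (Cs := C.G) hx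

theorem sh {Γ : SCtx} {x : ℕ} {C : CTy} (h : Γ.var x = some C) :
    Val.BreakdownTypable Γ 0 0 (.var x) (.ho .shr C) := by
  intro f d k xs X N τ _ _ _ _ _ _ _
  refine ⟨fun _ => .fin, by simp [Val.degree], fun Γt _ hV => ?_⟩
  have hx := hV x (by simp [Val.fv])
  rw [h] at hx
  simpa [Val.degree, propsIn_self, propsOut_self, SEnv.decomp_zero, Val.rename, Val.breakdown,
    LEnv.G, HOTy.G] using THasV.sh hx

/-- A shared variable that the derivation uses linearly is received as a shared one all the
same. -/
theorem eprom {Γ : SCtx} {Λ : LEnv} {Δ : SEnv} {x : ℕ} {C : CTy} {P : Proc} (h : Γ.var x = some C)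
    (ih : Proc.BreakdownTypable (Γ.eraseVars {x}) ((x, C) ::ₘ Λ) Δ P) :
    Proc.BreakdownTypable Γ Λ Δ P := by
  intro f d k xs X N τ hA hd hB hU hxs hX hτ
  refine ih f d k xs X N τ hA hd hB hU hxs hX fun y hy => ?_
  rcases hτ y hy with ⟨D, hD, e⟩ | ⟨D, m, hD, e⟩
  · by_cases hxy : y = x
    · subst hxy
      obtain rfl := Option.some.inj (hD.symm.trans h)
      exact Or.inr ⟨D, .shr, by simp, e⟩
    · exact Or.inl ⟨D, by simpa [SCtx.eraseVars, hxy] using hD, e⟩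
  · exact Or.inr ⟨D, m, by simp [hD], e⟩

theorem fin {Γ : SCtx} {Λ : LEnv} {Δ : SEnv} {u : Name} {P : Proc}
    (ih : Proc.BreakdownTypable Γ Λ Δ P) :
    Proc.BreakdownTypable Γ Λ ((u, .fin) ::ₘ Δ) P := by
  intro f d k xs X N τ hA hd hB hU hxs hX hτ
  have hd' : Discardable Δ d P.fn := fun v S hv hvd => hd v S (by simp [hv]) hvd
  -- A discarded name has no counterpart in the target; any other one is weakened there, too.
  by_cases hu : u ∈ d
  · rw [SEnv.decomp_cons_mem hu] at hA ⊢
    exact ih f d k xs X N τ hA hd' hB hU hxs hX hτ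
  · rw [SEnv.decomp_cons hu] at hA ⊢
    simp only [STy.G, Name.assign_cons, Name.assign_nil, Multiset.cons_add, zero_add] at hA ⊢
    obtain ⟨T, hT, h⟩ := ih f d k xs X N τ (hA.le le_rfl (Multiset.le_cons_self _ _)) hd' hB hU
      hxs hX hτ
    have hu' : TName.src (f u) ∈ keys ((TName.src (f u), MS.fin) ::ₘ SEnv.decomp f d Δ) := by
      simp [keys_cons]
    have hN := hA.nodup_props T T k (k + P.degree) (k + 1) (k + P.degree)
    rw [Multiset.cons_add, keys_cons, Multiset.nodup_cons] at hN
    exact ⟨T, hT, fun Γt hΓt =>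
      .fin (hA.not_shared hu') (hΓt ▸ hA.sess_none _ hu') hN.1 (h Γt hΓt)⟩

theorem nil {Γ : SCtx} : Proc.BreakdownTypable Γ 0 0 .nil := by
  intro f d k xs X N τ hA _ _ _ hxs hX _
  obtain rfl : xs = [] := List.eq_nil_iff_forall_not_mem.2 fun x hx => by
    simpa [Proc.fv] using (hX x).1 hx
  refine ⟨fun _ => .inp (payload []), rfl, fun Γt hΓt => ?_⟩
  have := THasP.ctxIn (Γt := Γt) (Δt := 0) (k := k) (xs := []) (τ := τ)
    (HasP.nil (Γ := Γ)).wellFormed hxs hX (by simp [Proc.fv])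
    (hΓt ▸ hA.none_of_isSession _ trivial) (by simp [keys])
    (fun Γt' _ _ => .nil)
  simpa [Proc.degree, SEnv.decomp_zero, propsIn_cons, propsIn_self, propsOut_self, Proc.rename,
    Proc.breakdown] using this

end BreakdownTypable

/-! ### Output and input -/

theorem WellFormed.nodup_add {Γ Λ₁ Λ₂ Δ X} (h : WellFormed Γ (Λ₁ + Λ₂) Δ X) :
    (keys (LEnv.G Λ₁ + LEnv.G Λ₂)).Nodup := by
  rw [← LEnv.G_add]
  exact LEnv.nodup_keys_G h.nodup_lin

theorem WellFormed.notMem_keys {Γ Λ u S Δ X} (h : WellFormed Γ Λ ((u, S) ::ₘ Δ) X) :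
    u ∉ keys Δ := by
  have := h.nodup
  rw [keys_cons] at this
  exact (Multiset.nodup_cons.1 this).1

theorem SCtx.bindVar_name (Γ : SCtx) (y : ℕ) (U : HOTy) : (Γ.bindVar y U).name = Γ.name := by
  rcases U with ⟨_ | _, C⟩ <;> rfl

theorem VarsAgree.bindVar {Γ Γt X} (y : ℕ) (U : HOTy) (h : VarsAgree Γ Γt (X.erase y)) :
    VarsAgree (Γ.bindVar y U) (Γt.bindVars [(.src y, U.G)]) X := by
  intro x hx
  by_cases hxy : x = y
  · subst hxy
    rcases U with ⟨_ | _, C⟩ <;> simp [SCtx.bindVar, TCtx.bindVars, HOTy.G, List.lookup_cons]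
  · have := h x (Finset.mem_erase.2 ⟨hxy, hx⟩)
    have hne : (TVar.src x == TVar.src y) = false := by simp [hxy]
    rcases U with ⟨_ | _, C⟩ <;>
      simpa [SCtx.bindVar, TCtx.bindVars, HOTy.G, List.lookup_cons, hne, hxy] using this

theorem linParts_single (y : ℕ) (U : HOTy) (Λ : LEnv) :
    linParts [(.src y, U.G)] + LEnv.G Λ = LEnv.G (linPart y U + Λ) := by
  rcases U with ⟨_ | _, C⟩ <;> simp [linParts, linPart, LEnv.G, HOTy.G]

/-- Distinctness of names in a part of an environment, up to rearrangement: the hypothesis is linear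
arithmetic on multiplicities. -/
theorem nodup_of_count {α : Type} [DecidableEq α] {s t : Multiset α} (hs : s.Nodup)
    (h : ∀ a, t.count a ≤ s.count a) : t.Nodup :=
  Multiset.nodup_of_le (Multiset.le_iff_count.2 h) hs

theorem notMem_of_count {α : Type} [DecidableEq α] {s t : Multiset α} {b : α} (hs : s.Nodup)
    (h : ∀ a, (b ::ₘ t).count a ≤ s.count a) : b ∉ t :=
  (Multiset.nodup_cons.1 (nodup_of_count hs h)).1

theorem THasP.cast_env {Γ : TCtx} {Λ Λ' : TLEnv} {Δ Δ' : TSEnv} {P : TProc} (h : THasP Γ Λ Δ P)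
    (hΛ : Λ = Λ') (hΔ : Δ = Δ') : THasP Γ Λ' Δ' P := hΛ ▸ hΔ ▸ h

namespace BreakdownTypable

/-- The common part of outputs on session names and on shared names. The session environment `B`
is the one that the prefix itself needs, and `f'` and `d'` take its effect into account. The
hypothesis `hpre` is the typing rule of the prefix. -/
theorem output {Γ : SCtx} {Λ₁ Λ₂ : LEnv} {Δ₁ Δ₂ Δ : SEnv} {U : HOTy} {V : Val} {P : Proc}
    {f f' : Name → Name} {d' : Finset Name} {k : ℕ} {xs : List ℕ} {X : Set Root}
    {N : TName → Option MU} {τ : ℕ → MU} {B D₁ D₂ : TSEnv} {v : TName}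
    (w : WellFormed Γ (Λ₁ + Λ₂) Δ (V.fv ∪ P.fv)) (wP : WellFormed Γ Λ₁ Δ₁ P.fv)
    (wV : WellFormed Γ Λ₂ Δ₂ V.fv) (ihP : Proc.BreakdownTypable Γ Λ₁ Δ₁ P)
    (ihV : Val.BreakdownTypable Γ Λ₂ Δ₂ V U)
    (hD₁ : SEnv.decomp f' d' Δ₁ = D₁) (hD₂ : SEnv.decomp f' d' Δ₂ = D₂)
    (hA : Admissible k X f Γ.name N (B + (D₁ + D₂)))
    (hA' : Admissible k X f' Γ.name N (D₁ + D₂))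
    (hdP : Discardable Δ₁ d' P.fn) (hdV : Discardable Δ₂ d' V.fn) (hBP : P.Barendregt X)
    (hBV : V.Barendregt X) (hUP : P.NoUseAfterEnd) (hUV : V.NoUseAfterEnd) (hxs : xs.Nodup)
    (hX : ∀ x, x ∈ xs ↔ x ∈ V.fv ∪ P.fv)
    (hτ : ∀ x ∈ V.fv ∪ P.fv, ReceivableType Γ (Λ₁ + Λ₂) x (τ x))
    (hpre : ∀ (Γt : TCtx) (E₁ E₂ : TSEnv) (V' : TVal) (P' : TProc), Γt.name = N →
      THasP Γt (LEnv.G Λ₁) E₁ P' → THasV Γt (LEnv.G Λ₂) E₂ V' U.G →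
      (keys (B + (E₁ + E₂))).Nodup →
      THasP Γt (LEnv.G (Λ₁ + Λ₂)) (B + (E₁ + E₂)) (.out v [V'] P')) :
    ∃ T : ℕ → MS, T k = .inp (payload (xs.map τ)) ∧ ∀ Γt : TCtx, Γt.name = N →
      THasP Γt 0 (B + (D₁ + D₂) + (propsIn T k (k + (V.degree + P.degree + 1)) +
          propsOut T (k + 1) (k + (V.degree + P.degree + 1))))
        (.par (ctxIn k xs (.out v [(V.rename f').breakdown (k + 1) V.fvs]
          (ctxOut (k + V.degree + 1) P.fvs .nil)))
          ((P.rename f').breakdown (k + V.degree + 1) P.fvs)) := by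
  obtain ⟨τV, hτV⟩ := wV.exists_assignedType
  obtain ⟨τP, hτP⟩ := wP.exists_assignedType
  obtain ⟨TP, hTP, tP⟩ := ihP f' d' (k + V.degree + 1) P.fvs X N τP
    (hD₁ ▸ hA'.le (by omega) (Multiset.le_add_right _ _)) hdP hBP hUP P.nodup_fvs P.mem_fvs
    (fun x hx => (hτP x hx).receivable)
  obtain ⟨TV, -, tV⟩ := ihV f' d' (k + 1) V.fvs X N τV
    (hD₂ ▸ hA'.le (by omega) (Multiset.le_add_left _ _)) hdV hBV hUV V.nodup_fvs V.mem_fvs hτV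
  refine ⟨glue k (k + V.degree + 1) (.inp (payload (xs.map τ))) TV TP, glue_self _ _ _ _ _,
    fun Γt hΓt => ?_⟩
  have hN := hA.nodup_props
    (glue k (k + V.degree + 1) (.inp (payload (xs.map τ))) TV TP)
    (glue k (k + V.degree + 1) (.inp (payload (xs.map τ))) TV TP)
    k (k + (V.degree + P.degree + 1)) (k + 1) (k + (V.degree + P.degree + 1))
  have hpos := P.degree_pos
  rw [propsIn_glue _ _ _ (by omega) (by omega), propsOut_glue _ _ _ (by omega) (by omega),
    propsOut_cons TP (by omega), hTP,
    show k + (V.degree + P.degree + 1) = k + 1 + V.degree + P.degree by omega] at hN ⊢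
  rw [show k + V.degree + 1 = k + 1 + V.degree by omega] at tP hN ⊢
  rw [hD₁] at tP
  rw [hD₂] at tV
  have hbody : ∀ Γt' : TCtx, Γt'.name = Γt.name → VarsAgree Γ Γt' (V.fv ∪ P.fv) →
      THasP Γt' (LEnv.G (Λ₁ + Λ₂)) (B +
        ((.prop (k + 1 + V.degree) false, .out (payload (P.fvs.map τP))) ::ₘ 0 + (D₂ +
          (propsIn TV (k + 1) (k + 1 + V.degree) + propsOut TV (k + 1) (k + 1 + V.degree)))))
        (.out v [(V.rename f').breakdown (k + 1) V.fvs]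
          (ctxOut (k + 1 + V.degree) P.fvs .nil)) := by
    intro Γt' hΓt' hV'
    rw [hΓt] at hΓt'
    refine hpre _ _ _ _ _ hΓt' ?_ (tV Γt' hΓt' (hV'.mono Finset.subset_union_left)) ?_
    · have := THasP.ctxOut (j := k + 1 + V.degree) wP P.nodup_fvs P.mem_fvs hτP
        (hΓt' ▸ hA.none_of_isSession _ trivial) (hV'.mono Finset.subset_union_right) .nil
        (by simpa using LEnv.nodup_keys_G wP.nodup_lin) (by simp [keys])
      simpa using this
    · refine nodup_of_count hN fun a => ?_
      simp only [keys_add, keys_singleton, keys_zero, ← Multiset.singleton_add,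
        Multiset.count_add, Multiset.count_zero]
      omega
  refine (THasP.par (.ctxIn w hxs hX hτ (hΓt ▸ hA.none_of_isSession _ trivial) ?_ hbody)
    (tP Γt hΓt) (by simp [keys]) ?_).cast_env (add_zero 0) ?_
  · refine notMem_of_count hN fun a => ?_
    simp only [keys_add, keys_singleton, keys_zero, ← Multiset.singleton_add,
      Multiset.count_add, Multiset.count_zero]
    omega
  · refine nodup_of_count hN fun a => ?_
    simp only [keys_add, keys_singleton, keys_zero, ← Multiset.singleton_add,
      Multiset.count_add, Multiset.count_zero]
    omega
  · simp only [← Multiset.singleton_add, MS.dual]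
    abel

theorem send {Γ : SCtx} {Λ₁ Λ₂ : LEnv} {Δ₁ Δ₂ Δ : SEnv} {u : Name} {U : HOTy} {S : STy} {V : Val}
    {P : Proc} (e : Δ₁ + Δ₂ = (u, S) ::ₘ Δ) (hP : HasP Γ Λ₁ Δ₁ P) (hV : HasV Γ Λ₂ Δ₂ V U)
    (hW : HasP Γ (Λ₁ + Λ₂) ((u, .out U S) ::ₘ Δ) (.out u (.sess (.out U S)) V P))
    (ihP : Proc.BreakdownTypable Γ Λ₁ Δ₁ P) (ihV : Val.BreakdownTypable Γ Λ₂ Δ₂ V U) :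
    Proc.BreakdownTypable Γ (Λ₁ + Λ₂) ((u, .out U S) ::ₘ Δ) (.out u (.sess (.out U S)) V P) := by
  intro f d k xs X N τ hA hd hB hU hxs hX hτ
  have w := hW.wellFormed
  have hud : u ∉ d := hd.notMem (Multiset.mem_cons_self _ _) (by simp [Proc.fn])
  have huΔ : u ∉ keys Δ := w.notMem_keys
  obtain ⟨d', hd', eD⟩ := SEnv.exists_decomp_step (f := f) (S := S) hud huΔ
    fun v hv hvd => SEnv.ne_of_nodup_decomp hud hA.nodup hv hvd
  have hD : SEnv.decomp f d ((u, .out U S) ::ₘ Δ) = (.src (f u), .out [U.G]) ::ₘ 0 +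
      (SEnv.decomp ((f u).incr ∘ f) d' Δ₁ + SEnv.decomp ((f u).incr ∘ f) d' Δ₂) := by
    rw [← SEnv.decomp_add, e, eD, SEnv.decomp_cons hud, STy.G, Name.assign_cons, Multiset.cons_add,
      Multiset.cons_add, zero_add]
  rw [hD] at hA ⊢
  have hu : TName.src (f u) ∈ keys ((TName.src (f u), MS.out [U.G]) ::ₘ 0 +
      (SEnv.decomp ((f u).incr ∘ f) d' Δ₁ + SEnv.decomp ((f u).incr ∘ f) d' Δ₂)) := by
    simp [keys_cons]
  -- If the prefix completes the session of `u`, then `u` occurs neither in `V` nor in `P`.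
  have hdis : ∀ v S', (v, S') ∈ Δ₁ + Δ₂ → v ∈ d' → S' = .fin ∧ v ∉ V.fn ∧ v ∉ P.fn := by
    intro v S' hv hvd
    rw [e] at hv
    by_cases hvu : v = u
    · subst hvu
      have hS : S' = S := by
        rcases Multiset.mem_cons.1 hv with hv | hv
        · exact (Prod.mk.inj hv).2
        · exact absurd (mem_keys.2 ⟨_, hv⟩) huΔ
      rcases hd' v hvd with h | ⟨_, h⟩
      · exact absurd h hud
      · subst hS h
        exact ⟨rfl, hU.1 U rfl⟩
    · have hv' : (v, S') ∈ Δ := by simpa [hvu] using hv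
      rcases hd' v hvd with h | ⟨h, _⟩
      · have := hd v S' (by simp [hv']) h
        simp only [Proc.fn, Finset.mem_union, not_or] at this
        exact ⟨this.1, this.2.1.2, this.2.2⟩
      · exact absurd h hvu
  simp only [Proc.rename, Proc.breakdown, step_sess, Val.rename_rename _ hA.captureFree,
    Proc.rename_rename _ hA.captureFree, Val.fvs_rename, Proc.fvs_rename, Val.degree_rename]
  refine output w hP.wellFormed hV.wellFormed ihP ihV rfl rfl hA
    (hA.mono le_rfl (hA.captureFree.subst _ (by rw [Name.idx_shift]; omega))
      (hA.subst_of_shared hu) (Multiset.le_add_left _ _))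
    (fun v S' hv hvd => ⟨(hdis v S' (by simp [hv]) hvd).1, (hdis v S' (by simp [hv]) hvd).2.2⟩)
    (fun v S' hv hvd => ⟨(hdis v S' (by simp [hv]) hvd).1, (hdis v S' (by simp [hv]) hvd).2.1⟩)
    hB.2 hB.1 hU.2.2 hU.2.1 hxs hX hτ fun Γt E₁ E₂ V' P' hΓt hP' hV' hn => ?_
  simp only [Multiset.cons_add, zero_add, keys_cons] at hn ⊢
  rw [LEnv.G_add]
  exact .send_fin (hA.not_shared hu) (hΓt ▸ hA.sess_none _ hu) (by simp) hP'
    (.single hV' (LEnv.nodup_keys_G hV.wellFormed.nodup_lin)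
      (Multiset.nodup_add.1 (keys_add E₁ E₂ ▸ (Multiset.nodup_cons.1 hn).2)).2.1) w.nodup_add hn

theorem req {Γ : SCtx} {Λ : LEnv} {Δ₁ Δ₂ : SEnv} {u : Name} {U : HOTy} {V : Val}
    {P : Proc} (hu : Γ.name u = some U) (hP : HasP Γ Λ Δ₁ P) (hV : HasV Γ 0 Δ₂ V U)
    (hn : (keys (Δ₁ + Δ₂)).Nodup)
    (ihP : Proc.BreakdownTypable Γ Λ Δ₁ P) (ihV : Val.BreakdownTypable Γ 0 Δ₂ V U) :
    Proc.BreakdownTypable Γ Λ (Δ₁ + Δ₂) (.out u (.chan U) V P) := by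
  intro f d k xs X N τ hA hd hB hU hxs hX hτ
  have w := (HasP.req hu hP hV hn).wellFormed
  rw [← add_zero Λ] at w hτ
  simp only [Proc.rename, Proc.breakdown, step_chan, Val.rename_id, Proc.rename_id,
    Val.fvs_rename, Proc.fvs_rename, Val.degree_rename]
  rw [SEnv.decomp_add] at hA ⊢
  have hdis : ∀ v S', (v, S') ∈ Δ₁ + Δ₂ → v ∈ d → S' = .fin ∧ v ∉ V.fn ∧ v ∉ P.fn := by
    intro v S' hv hvd
    have := hd v S' hv hvd
    simp only [Proc.fn, Finset.mem_union, not_or] at this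
    exact ⟨this.1, this.2.1.2, this.2.2⟩
  have := output (B := 0) (v := .src (f u)) w hP.wellFormed hV.wellFormed ihP ihV rfl rfl
    (by rwa [zero_add]) hA
    (fun v S' hv hvd => ⟨(hdis v S' (by simp [hv]) hvd).1, (hdis v S' (by simp [hv]) hvd).2.2⟩)
    (fun v S' hv hvd => ⟨(hdis v S' (by simp [hv]) hvd).1, (hdis v S' (by simp [hv]) hvd).2.1⟩)
    hB.2 hB.1 hU.2.2 hU.2.1 hxs hX hτ fun Γt E₁ E₂ V' P' hΓt hP' hV' hn => by
      rw [zero_add] at hn ⊢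
      rw [add_zero]
      exact .req (hΓt ▸ (hA.shared_name u U hu).1) hP' hV' hn
  simp only [zero_add] at this
  exact this

/-- The common part of inputs on session names and on shared names; see `output`. -/
theorem input {Γ : SCtx} {Λ : LEnv} {Δ Δ' : SEnv} {U : HOTy} {y : ℕ} {P : Proc}
    {f f' : Name → Name} {d' : Finset Name} {k : ℕ} {xs : List ℕ} {X : Set Root}
    {N : TName → Option MU} {τ : ℕ → MU} {B D : TSEnv} {v : TName}
    (w : WellFormed Γ Λ Δ (P.fv.erase y))
    (wP : WellFormed (Γ.bindVar y U) (linPart y U + Λ) Δ' P.fv)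
    (ihP : Proc.BreakdownTypable (Γ.bindVar y U) (linPart y U + Λ) Δ' P)
    (hD : SEnv.decomp f' d' Δ' = D)
    (hA : Admissible k X f Γ.name N (B + D)) (hA' : Admissible k X f' Γ.name N D)
    (hdP : Discardable Δ' d' P.fn) (hBP : P.Barendregt X) (hUP : P.NoUseAfterEnd) (hxs : xs.Nodup)
    (hX : ∀ x, x ∈ xs ↔ x ∈ P.fv.erase y) (hτ : ∀ x ∈ P.fv.erase y, ReceivableType Γ Λ x (τ x))
    (hpre : ∀ (Γt : TCtx) (E : TSEnv) (P' : TProc), Γt.name = N →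
      THasP (Γt.bindVars [(.src y, U.G)]) (linParts [(.src y, U.G)] + LEnv.G Λ) E P' →
      (keys (B + E)).Nodup → THasP Γt (LEnv.G Λ) (B + E) (.inp v [.src y] P')) :
    ∃ T : ℕ → MS, T k = .inp (payload (xs.map τ)) ∧ ∀ Γt : TCtx, Γt.name = N →
      THasP Γt 0 (B + D + (propsIn T k (k + (P.degree + 1)) +
          propsOut T (k + 1) (k + (P.degree + 1))))
        (.par (ctxIn k xs (.inp v [.src y] (ctxOut (k + 1) P.fvs .nil)))
          ((P.rename f').breakdown (k + 1) P.fvs)) := by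
  obtain ⟨τP, hτP⟩ := wP.exists_assignedType
  obtain ⟨TP, hTP, tP⟩ := ihP f' d' (k + 1) P.fvs X N τP
    (by rw [SCtx.bindVar_name, hD]; exact hA'.le (by omega) le_rfl) hdP hBP hUP P.nodup_fvs
    P.mem_fvs (fun x hx => (hτP x hx).receivable)
  -- The middle part of the range is empty here.
  refine ⟨glue k (k + 1) (.inp (payload (xs.map τ))) TP TP, glue_self _ _ _ _ _,
    fun Γt hΓt => ?_⟩
  have hN := hA.nodup_props
    (glue k (k + 1) (.inp (payload (xs.map τ))) TP TP)
    (glue k (k + 1) (.inp (payload (xs.map τ))) TP TP)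
    k (k + (P.degree + 1)) (k + 1) (k + (P.degree + 1))
  have hpos := P.degree_pos
  rw [propsIn_glue _ _ _ (by omega) (by omega), propsOut_glue _ _ _ (by omega) (by omega),
    propsIn_self, propsOut_self, zero_add, zero_add, propsOut_cons TP (by omega), hTP,
    show k + (P.degree + 1) = k + 1 + P.degree by omega] at hN ⊢
  rw [hD] at tP
  have hbody : ∀ Γt' : TCtx, Γt'.name = Γt.name → VarsAgree Γ Γt' (P.fv.erase y) →
      THasP Γt' (LEnv.G Λ) (B + (.prop (k + 1) false, .out (payload (P.fvs.map τP))) ::ₘ 0)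
        (.inp v [.src y] (ctxOut (k + 1) P.fvs .nil)) := by
    intro Γt' hΓt' hV'
    rw [hΓt] at hΓt'
    refine hpre _ _ _ hΓt' ?_ ?_
    · have hnone : Γt'.name (.prop (k + 1) false) = none :=
        hΓt' ▸ hA.none_of_isSession _ trivial
      have := THasP.ctxOut (j := k + 1) wP P.nodup_fvs P.mem_fvs hτP
        (Γt := Γt'.bindVars [(.src y, U.G)]) hnone (hV'.bindVar y U) .nil
        (by simpa using LEnv.nodup_keys_G wP.nodup_lin) (by simp [keys])
      rw [linParts_single]
      simpa using this
    · refine nodup_of_count hN fun a => ?_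
      simp only [keys_add, keys_singleton, keys_zero, ← Multiset.singleton_add,
        Multiset.count_add, Multiset.count_zero]
      omega
  refine (THasP.par (.ctxIn w hxs hX hτ (hΓt ▸ hA.none_of_isSession _ trivial) ?_ hbody)
    (tP Γt hΓt) (by simp [keys]) ?_).cast_env (add_zero 0) ?_
  · refine notMem_of_count hN fun a => ?_
    simp only [keys_add, keys_singleton, keys_zero, ← Multiset.singleton_add,
      Multiset.count_add, Multiset.count_zero]
    omega
  · refine nodup_of_count hN fun a => ?_
    simp only [keys_add, keys_singleton, keys_zero, ← Multiset.singleton_add,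
      Multiset.count_add, Multiset.count_zero]
    omega
  · simp only [← Multiset.singleton_add, MS.dual]
    abel

theorem rcv {Γ : SCtx} {Λ : LEnv} {Δ : SEnv} {u : Name} {U : HOTy} {S : STy} {y : ℕ} {P : Proc}
    (hP : HasP (Γ.bindVar y U) (linPart y U + Λ) ((u, S) ::ₘ Δ) P)
    (ihP : Proc.BreakdownTypable (Γ.bindVar y U) (linPart y U + Λ) ((u, S) ::ₘ Δ) P) :
    Proc.BreakdownTypable Γ Λ ((u, .inp U S) ::ₘ Δ) (.inp u (.sess (.inp U S)) y P) := by
  intro f d k xs X N τ hA hd hB hU hxs hX hτ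
  have w := (HasP.rcv hP).wellFormed
  have hud : u ∉ d := hd.notMem (Multiset.mem_cons_self _ _) (by simp [Proc.fn])
  have huΔ : u ∉ keys Δ := w.notMem_keys
  obtain ⟨d', hd', eD⟩ := SEnv.exists_decomp_step (f := f) (S := S) hud huΔ
    fun v hv hvd => SEnv.ne_of_nodup_decomp hud hA.nodup hv hvd
  have hD : SEnv.decomp f d ((u, .inp U S) ::ₘ Δ) = (.src (f u), .inp [U.G]) ::ₘ 0 +
      SEnv.decomp ((f u).incr ∘ f) d' ((u, S) ::ₘ Δ) := by
    rw [eD, SEnv.decomp_cons hud, STy.G, Name.assign_cons, Multiset.cons_add,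
      Multiset.cons_add, zero_add]
  rw [hD] at hA ⊢
  have hu : TName.src (f u) ∈ keys ((TName.src (f u), MS.inp [U.G]) ::ₘ 0 +
      SEnv.decomp ((f u).incr ∘ f) d' ((u, S) ::ₘ Δ)) := by
    simp [keys_cons]
  have hdis : Discardable ((u, S) ::ₘ Δ) d' P.fn := by
    intro v S' hv hvd
    by_cases hvu : v = u
    · subst hvu
      have hS : S' = S := by
        rcases Multiset.mem_cons.1 hv with hv | hv
        · exact (Prod.mk.inj hv).2
        · exact absurd (mem_keys.2 ⟨_, hv⟩) huΔ
      rcases hd' v hvd with h | ⟨_, h⟩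
      · exact absurd h hud
      · subst hS h
        exact ⟨rfl, hU.1 U rfl⟩
    · have hv' : (v, S') ∈ Δ := by simpa [hvu] using hv
      rcases hd' v hvd with h | ⟨h, _⟩
      · have := hd v S' (by simp [hv']) h
        simp only [Proc.fn, Finset.mem_union, not_or] at this
        exact ⟨this.1, this.2.2⟩
      · exact absurd h hvu
  simp only [Proc.rename, Proc.breakdown, step_sess, Proc.rename_rename _ hA.captureFree,
    Proc.fvs_rename]
  refine input w hP.wellFormed ihP rfl hA
    (hA.mono le_rfl (hA.captureFree.subst _ (by rw [Name.idx_shift]; omega))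
      (hA.subst_of_shared hu) (Multiset.le_add_left _ _))
    hdis hB hU.2 hxs hX hτ fun Γt E P' hΓt hP' hn => ?_
  simp only [Multiset.cons_add, zero_add, keys_cons] at hn ⊢
  exact .rcv_fin (hA.not_shared hu) (hΓt ▸ hA.sess_none _ hu) (by simp) (by simp) (by simp)
    (Multiset.nodup_cons.1 hn).1 hP'

theorem acc {Γ : SCtx} {Λ : LEnv} {Δ : SEnv} {u : Name} {U : HOTy} {y : ℕ} {P : Proc}
    (hu : Γ.name u = some U) (hP : HasP (Γ.bindVar y U) (linPart y U + Λ) Δ P)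
    (ihP : Proc.BreakdownTypable (Γ.bindVar y U) (linPart y U + Λ) Δ P) :
    Proc.BreakdownTypable Γ Λ Δ (.inp u (.chan U) y P) := by
  intro f d k xs X N τ hA hd hB hU hxs hX hτ
  simp only [Proc.rename, Proc.breakdown, step_chan, Proc.rename_id, Proc.fvs_rename]
  have := input (B := 0) (v := .src (f u)) (HasP.acc hu hP).wellFormed hP.wellFormed ihP rfl
    (by rwa [zero_add]) hA
    (fun v S' hv hvd => by
      have := hd v S' hv hvd
      simp only [Proc.fn, Finset.mem_union, not_or] at this
      exact ⟨this.1, this.2.2⟩)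
    hB hU.2 hxs hX hτ fun Γt E P' hΓt hP' hn => by
      rw [zero_add]
      exact .acc (hΓt ▸ (hA.shared_name u U hu).1) hP'
  simp only [zero_add] at this
  exact this

end BreakdownTypable

/-! ### Application, parallel composition and promotion -/

theorem THasNs.of_hasN {Γ : SCtx} {Δ : SEnv} {u : Name} {C : CTy} {k : ℕ} {X : Set Root}
    {f : Name → Name} {d : Finset Name} {Γt : TCtx} (h : HasN Γ Δ u C)
    (hA : Admissible k X f Γ.name Γt.name (SEnv.decomp f d Δ)) (hd : u ∈ keys Δ → u ∉ d) :
    THasNs Γt (SEnv.decomp f d Δ) ((f u).block C.G.length) C.G := by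
  cases h with
  | @sess _ S _ _ =>
    have hD : SEnv.decomp f d {(u, S)} = (f u).assign S.G := by
      rw [← Multiset.cons_zero, SEnv.decomp_cons (hd (by simp [keys])), SEnv.decomp_zero, add_zero]
    rw [hD] at hA ⊢
    simp only [CTy.G, List.length_map]
    exact .block _ _ fun v hv => ⟨hA.not_shared hv, hA.sess_none v hv⟩
  | sh h =>
    simp only [CTy.G, List.length_singleton, Name.block_succ, SEnv.decomp_zero]
    exact .cons (Δ₁ := 0) (.sh (hA.shared_name u _ h).1) .nil (by simp [keys])

theorem THasV.abs_inv {Γ : TCtx} {Λ : TLEnv} {Δ : TSEnv} {ys : List (TName × MC)} {P : TProc}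
    {U : MU} (h : THasV Γ Λ Δ (.abs .lin ys P) U) :
    ys ≠ [] ∧ (ys.map Prod.fst).Nodup ∧ (∀ p ∈ ys, p.1.IsVar) ∧ U = .ho .lin (ys.map Prod.snd) ∧
      THasP (Γ.bindNames ys) Λ (sessParts ys + Δ) P := by
  cases h with
  | abs h₁ h₂ h₃ h₄ => exact ⟨h₁, h₂, h₃, rfl, h₄⟩

/-- The parameters of an abstraction, with their types. -/
def Name.params (w : Name) (Cs : List MC) : List (TName × MC) := (w.block Cs.length).zip Cs

namespace Name

variable {w : Name} {Cs : List MC}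

theorem map_fst_params : (w.params Cs).map Prod.fst = w.block Cs.length :=
  List.map_fst_zip (by simp [length_block])

theorem map_snd_params : (w.params Cs).map Prod.snd = Cs :=
  List.map_snd_zip (by simp [length_block])

theorem mem_params {p : TName × MC} (h : p ∈ w.params Cs) :
    (∃ j, p.1 = .src (w.shift j)) ∧ p.2 ∈ Cs :=
  ⟨mem_block (List.of_mem_zip h).1, (List.of_mem_zip h).2⟩

theorem params_ne_nil (h : Cs ≠ []) : w.params Cs ≠ [] := by
  intro e
  apply h
  rw [← map_snd_params (w := w) (Cs := Cs), e, List.map_nil]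

theorem bindNames_params_of_root {Γ : TCtx} {v : Name} (h : v.root ≠ w.root) :
    (Γ.bindNames (w.params Cs)).name (.src v) = Γ.name (.src v) := by
  refine TCtx.bindNames_of_notMem fun p hp e => h ?_
  obtain ⟨⟨j, hj⟩, _⟩ := mem_params hp
  rw [hj] at e
  rw [← TName.src.inj e, root_shift]

theorem bindNames_params_of_isSession {Γ : TCtx} {v : TName} {y : Ident} {i : ℕ}
    (hv : v.IsSession) :
    (Γ.bindNames ((Name.var y i).params Cs)).name v = Γ.name v := by
  refine TCtx.bindNames_of_notMem fun p hp e => ?_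
  obtain ⟨⟨j, hj⟩, _⟩ := mem_params hp
  rw [← e, hj] at hv
  exact hv

theorem bindNames_params_sess {Γ : TCtx} {Ms : List MS} {v : TName}
    (hv : v ∈ keys (w.assign Ms)) :
    (Γ.bindNames (w.params (Ms.map .sess))).name v = none := by
  have hv' : v ∈ (w.params (Ms.map .sess)).map Prod.fst := by
    rw [map_fst_params, List.length_map]
    rwa [keys_assign] at hv
  cases e : (w.params (Ms.map MC.sess)).lookup v with
  | none =>
    obtain ⟨p, hp, rfl⟩ := List.mem_map.1 hv'
    simpa using List.lookup_eq_none_iff.1 e p hp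
  | some C =>
    obtain ⟨M, _, rfl⟩ := List.mem_map.1 (mem_params (List.mem_of_lookup e)).2
    simp [TCtx.bindNames, e]

theorem sessParts_params_sess (w : Name) (Ms : List MS) :
    sessParts (w.params (Ms.map .sess)) = w.assign Ms := by
  rw [params, List.length_map, sessParts_sess]

end Name

theorem THasV.abs_params {Γ : TCtx} {Λ : TLEnv} {Δ : TSEnv} {y : Ident} {i : ℕ} {Cs : List MC}
    {P : TProc} (hCs : Cs ≠ []) (h : THasP (Γ.bindNames ((Name.var y i).params Cs)) Λ
      (sessParts ((Name.var y i).params Cs) + Δ) P) :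
    THasV Γ Λ Δ (.abs .lin ((Name.var y i).params Cs) P) (.ho .lin Cs) := by
  have := THasV.abs (Name.params_ne_nil hCs)
    (by rw [Name.map_fst_params]; exact Name.nodup_block _ _)
    (fun p hp => by obtain ⟨⟨j, hj⟩, _⟩ := Name.mem_params hp; rw [hj]; trivial) h
  rwa [Name.map_snd_params] at this

/-- A process that is broken down is started by the context that its first propagator waits for. -/
theorem THasP.start {Γ Λ Δ Y} {k k' b : ℕ} {X : Set Root} {f : Name → Name}
    {N : Name → Option HOTy} {Γt : TCtx}
    {D : TSEnv} {T : ℕ → MS} {xs : List ℕ} {τ : ℕ → MU} {P : TProc}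
    (hA : Admissible k' X f N Γt.name D) (h : WellFormed Γ Λ Δ Y) (hxs : xs.Nodup)
    (hX : ∀ x, x ∈ xs ↔ x ∈ Y) (hτ : ∀ x ∈ Y, AssignedType Γ Λ x (τ x)) (hV : VarsAgree Γ Γt Y)
    (hT : T k = .inp (payload (xs.map τ))) (hb : k < b)
    (hP : THasP Γt 0 (D + (propsIn T k b + propsOut T (k + 1) b)) P) :
    THasP Γt (LEnv.G Λ) (D + (propsIn T k b + propsOut T k b))
      (.par (_root_.ctxOut k xs .nil) P) := by
  have hN := hA.nodup_props T T k b k b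
  rw [propsOut_cons T hb, hT] at hN ⊢
  have hc := THasP.ctxOut (j := k) h hxs hX hτ (hA.none_of_isSession _ trivial) hV .nil
    (by simpa using LEnv.nodup_keys_G h.nodup_lin) (by simp [keys])
  refine (THasP.par hc hP ?_ ?_).cast_env (by rw [zero_add, add_zero]) ?_
  · simpa using LEnv.nodup_keys_G h.nodup_lin
  · refine nodup_of_count hN fun a => ?_
    simp only [keys_add, keys_singleton, keys_zero, ← Multiset.singleton_add, Multiset.count_add,
      Multiset.count_zero]
    omega
  · simp only [← Multiset.singleton_add, MS.dual]
    abel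

theorem SCtx.bindName_var (Γ : SCtx) (u : Name) (C : CTy) : (Γ.bindName u C).var = Γ.var := by
  cases C <;> rfl

namespace BreakdownTypable

theorem app {Γ : SCtx} {Λ : LEnv} {Δ₁ Δ₂ : SEnv} {m : Mode} {V : Val} {u : Name} {C : CTy}
    (hV : HasV Γ Λ Δ₁ V (.ho m C)) (hu : HasN Γ Δ₂ u C) (hn : (keys (Δ₁ + Δ₂)).Nodup)
    (ihV : Val.BreakdownTypable Γ Λ Δ₁ V (.ho m C)) :
    Proc.BreakdownTypable Γ Λ (Δ₁ + Δ₂) (.app V u C) := by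
  intro f d k xs X N τ hA hd hB hU hxs hX hτ
  have w := (HasP.app hV hu hn).wellFormed
  rw [SEnv.decomp_add] at hA ⊢
  obtain ⟨τV, hτV⟩ := hV.wellFormed.exists_assignedType
  obtain ⟨TV, -, tV⟩ := ihV f d (k + 1) xs X N τV
    (hA.le (by omega) (Multiset.le_add_right _ _))
    (fun v S hv hvd => by
      have := hd v S (by simp [hv]) hvd
      simp only [Proc.fn, Finset.mem_union, not_or] at this
      exact ⟨this.1, this.2.1⟩) hB hU hxs hX hτV
  refine ⟨glue k (k + (V.degree + 1)) (.inp (payload (xs.map τ))) TV TV, glue_self _ _ _ _ _,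
    fun Γt hΓt => ?_⟩
  have hN := hA.nodup_props
    (glue k (k + (V.degree + 1)) (.inp (payload (xs.map τ))) TV TV)
    (glue k (k + (V.degree + 1)) (.inp (payload (xs.map τ))) TV TV)
    k (k + (V.degree + 1)) (k + 1) (k + (V.degree + 1))
  simp only [Proc.rename, Proc.breakdown, Proc.degree]
  rw [propsIn_glue _ _ _ (by omega) (by omega), propsOut_glue _ _ _ (by omega) (by omega),
    propsIn_self, propsOut_self, add_zero, add_zero,
    show k + (V.degree + 1) = k + 1 + V.degree by omega] at hN ⊢
  have hbody : ∀ Γt' : TCtx, Γt'.name = Γt.name → VarsAgree Γ Γt' V.fv →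
      THasP Γt' (LEnv.G Λ) (SEnv.decomp f d Δ₁ +
        (propsIn TV (k + 1) (k + 1 + V.degree) + propsOut TV (k + 1) (k + 1 + V.degree)) +
          SEnv.decomp f d Δ₂)
        (.app ((V.rename f).breakdown (k + 1) xs) ((f u).block C.G.length)) := by
    intro Γt' hΓt' hV'
    rw [hΓt] at hΓt'
    refine .app C.G_ne_nil (tV Γt' hΓt' hV')
      (.of_hasN hu (hΓt' ▸ hA.le le_rfl (Multiset.le_add_left _ _)) fun huΔ => ?_) ?_
    · obtain ⟨S, hS⟩ := mem_keys.1 huΔ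
      exact hd.notMem (Multiset.mem_add.2 (Or.inr hS)) (by simp [Proc.fn])
    · refine nodup_of_count hN fun a => ?_
      simp only [keys_add, ← Multiset.singleton_add, Multiset.count_add]
      omega
  refine (THasP.ctxIn w hxs hX hτ (hΓt ▸ hA.none_of_isSession _ trivial) ?_ hbody).cast_env rfl ?_
  · refine notMem_of_count hN fun a => ?_
    simp only [keys_add, keys_singleton, ← Multiset.singleton_add, Multiset.count_add]
    omega
  · simp only [← Multiset.singleton_add]
    abel

theorem par {Γ : SCtx} {Λ₁ Λ₂ : LEnv} {Δ₁ Δ₂ : SEnv} {P Q : Proc} (hP : HasP Γ Λ₁ Δ₁ P)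
    (hQ : HasP Γ Λ₂ Δ₂ Q) (hΛ : (keys (Λ₁ + Λ₂)).Nodup) (hΔ : (keys (Δ₁ + Δ₂)).Nodup)
    (ihP : Proc.BreakdownTypable Γ Λ₁ Δ₁ P) (ihQ : Proc.BreakdownTypable Γ Λ₂ Δ₂ Q) :
    Proc.BreakdownTypable Γ (Λ₁ + Λ₂) (Δ₁ + Δ₂) (.par P Q) := by
  intro f d k xs X N τ hA hd hB hU hxs hX hτ
  have w := (HasP.par hP hQ hΛ hΔ).wellFormed
  have wP := hP.wellFormed
  have wQ := hQ.wellFormed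
  rw [SEnv.decomp_add] at hA ⊢
  obtain ⟨τP, hτP⟩ := wP.exists_assignedType
  obtain ⟨τQ, hτQ⟩ := wQ.exists_assignedType
  obtain ⟨TP, hTP, tP⟩ := ihP f d (k + 1) P.fvs X N τP
    (hA.le (by omega) (Multiset.le_add_right _ _))
    (fun v S hv hvd => by
      have := hd v S (by simp [hv]) hvd
      simp only [Proc.fn, Finset.mem_union, not_or] at this
      exact ⟨this.1, this.2.1⟩) hB.1 hU.1 P.nodup_fvs P.mem_fvs
    (fun x hx => (hτP x hx).receivable)
  obtain ⟨TQ, hTQ, tQ⟩ := ihQ f d (k + P.degree + 1) Q.fvs X N τQ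
    (hA.le (by omega) (Multiset.le_add_left _ _))
    (fun v S hv hvd => by
      have := hd v S (by simp [hv]) hvd
      simp only [Proc.fn, Finset.mem_union, not_or] at this
      exact ⟨this.1, this.2.2⟩) hB.2 hU.2 Q.nodup_fvs Q.mem_fvs
    (fun x hx => (hτQ x hx).receivable)
  refine ⟨glue k (k + P.degree + 1) (.inp (payload (xs.map τ))) TP TQ, glue_self _ _ _ _ _,
    fun Γt hΓt => ?_⟩
  have hN := hA.nodup_props
    (glue k (k + P.degree + 1) (.inp (payload (xs.map τ))) TP TQ)
    (glue k (k + P.degree + 1) (.inp (payload (xs.map τ))) TP TQ)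
    k (k + (P.degree + Q.degree + 1)) (k + 1) (k + (P.degree + Q.degree + 1))
  have hposP := P.degree_pos
  have hposQ := Q.degree_pos
  simp only [Proc.rename, Proc.breakdown, Proc.degree, Proc.fvs_rename, Proc.degree_rename]
  rw [propsIn_glue _ _ _ (by omega) (by omega), propsOut_glue _ _ _ (by omega) (by omega),
    propsOut_cons TP (by omega), propsOut_cons TQ (by omega), hTP, hTQ,
    show k + (P.degree + Q.degree + 1) = k + 1 + P.degree + Q.degree by omega] at hN ⊢
  rw [show k + P.degree + 1 = k + 1 + P.degree by omega] at tQ hN ⊢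
  have hbody : ∀ Γt' : TCtx, Γt'.name = Γt.name → VarsAgree Γ Γt' (P.fv ∪ Q.fv) →
      THasP Γt' (LEnv.G (Λ₁ + Λ₂)) ((.prop (k + 1) false, .out (payload (P.fvs.map τP))) ::ₘ
          (.prop (k + 1 + P.degree) false, .out (payload (Q.fvs.map τQ))) ::ₘ 0)
        (ctxOut (k + 1) P.fvs (ctxOut (k + 1 + P.degree) Q.fvs .nil)) := by
    intro Γt' hΓt' hV'
    rw [hΓt] at hΓt'
    rw [LEnv.G_add, add_comm]
    refine .ctxOut wP P.nodup_fvs P.mem_fvs hτP (hΓt' ▸ hA.none_of_isSession _ trivial)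
      (hV'.mono Finset.subset_union_left) ?_ (add_comm (LEnv.G Λ₁) _ ▸ w.nodup_add) ?_
    · have := THasP.ctxOut (j := k + 1 + P.degree) wQ Q.nodup_fvs Q.mem_fvs hτQ
        (hΓt' ▸ hA.none_of_isSession _ trivial) (hV'.mono Finset.subset_union_right) .nil
        (by simpa using LEnv.nodup_keys_G wQ.nodup_lin) (by simp [keys])
      simpa using this
    · simp only [keys_cons, keys_zero]
      simp
      omega
  refine (THasP.par (.ctxIn w hxs hX hτ (hΓt ▸ hA.none_of_isSession _ trivial) ?_ hbody)
    (.par (tP Γt hΓt) (tQ Γt hΓt) (by simp [keys]) ?_) (by simp [keys]) ?_).cast_env (by simp) ?_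
  · simp [keys]
  · refine nodup_of_count hN fun a => ?_
    simp only [keys_add, keys_singleton, ← Multiset.singleton_add, Multiset.count_add]
    omega
  · refine nodup_of_count hN fun a => ?_
    simp only [keys_add, keys_singleton, keys_zero, ← Multiset.singleton_add, Multiset.count_add,
      Multiset.count_zero]
    omega
  · simp only [← Multiset.singleton_add, MS.dual]
    abel

/-- The breakdown of a shared abstraction is that of the linear one, with the propagators of the
body restricted; as these are all that its session environment holds, it can be promoted. -/
theorem prom {Γ : SCtx} {y : ℕ} {C : CTy} {P : Proc}
    (ih : Val.BreakdownTypable Γ 0 0 (.abs .lin y C P) (.ho .lin C)) :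
    Val.BreakdownTypable Γ 0 0 (.abs .shr y C P) (.ho .shr C) := by
  intro f d k xs X N τ hA hd hB hU hxs hX hτ
  obtain ⟨T, -, t⟩ := ih f d k xs X N τ hA hd hB hU hxs hX hτ
  refine ⟨T, fun h => absurd h (by simp [Val.degree]), fun Γt hΓt hV => ?_⟩
  have t := t Γt hΓt hV
  simp only [Val.rename, Val.breakdown, if_true, Val.degree, add_zero, propsIn_self, propsOut_self,
    SEnv.decomp_zero, Proc.degree_rename, zero_add] at t ⊢
  obtain ⟨h₁, h₂, h₃, h₄, h₅⟩ := THasV.abs_inv t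
  simp only [HOTy.G, MU.ho.injEq, true_and] at h₄ ⊢
  have := THasV.prom (.abs h₁ h₂ h₃ (Δ := 0) (by rw [add_zero]; exact .resProps k P.degree h₅))
  rwa [← h₄] at this

end BreakdownTypable

/-! ### Abstraction and restriction -/

theorem notMem_allowedRoots_aux {k : ℕ} {X : Set Root}
    (h : ∀ j, Root.sess (.aux j) ∉ X ∧ Root.var (.aux j) ∉ X) :
    Root.sess (.aux k) ∉ allowedRoots k X ∧ Root.var (.aux k) ∉ allowedRoots k X := by
  constructor <;> rintro (hx | ⟨j, hj, e | e⟩)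
  · exact (h k).1 hx
  · simp at e
    omega
  · simp at e
  · exact (h k).2 hx
  · simp at e
  · simp at e
    omega

theorem aux_notMem_insert {X : Set Root} {r : Root}
    (h : ∀ j, Root.sess (.aux j) ∉ X ∧ Root.var (.aux j) ∉ X)
    (hr : ∀ j, Root.sess (.aux j) ≠ r ∧ Root.var (.aux j) ≠ r) (j : ℕ) :
    Root.sess (.aux j) ∉ insert r X ∧ Root.var (.aux j) ∉ insert r X := by
  simp [hr j, h j]

theorem notMem_allowedRoots {k : ℕ} {X : Set Root} {r : Root} (h : r ∉ X)
    (hr : ∀ j, Root.sess (.aux j) ≠ r ∧ Root.var (.aux j) ≠ r) : r ∉ allowedRoots k X := by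
  rintro (hx | ⟨j, _, e | e⟩)
  · exact h hx
  · exact (hr j).1 e.symm
  · exact (hr j).2 e.symm

theorem Name.subst_avoid_of_ne {f : Name → Name} {b w v : Name} (hv : v ≠ b) (hf : f v ≠ b) :
    (Name.subst b w ∘ Name.avoid {b} f) v = f v := by
  simp [Name.subst, Name.avoid, hv, Function.update_of_ne hf]

theorem Name.subst_avoid_self {f : Name → Name} {b w : Name} :
    (Name.subst b w ∘ Name.avoid {b} f) b = w := by
  simp [Name.subst, Name.avoid]

theorem Name.ne_of_idx {v w : Name} (hv : 1 ≤ v.idx) (hw : w.idx = 0) : v ≠ w := by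
  rintro rfl
  omega

/-- The shared names in the scope of a binder for parameters `ys`. -/
def bindTargetNames (N : TName → Option MU) (ys : List (TName × MC)) : TName → Option MU :=
  (TCtx.bindNames ⟨fun _ => none, N⟩ ys).name

theorem bindNames_name (Γt : TCtx) (ys : List (TName × MC)) :
    (Γt.bindNames ys).name = bindTargetNames Γt.name ys := rfl

theorem Name.nodup_assign_add_dual (s : Ident) (i : ℕ) (Ms : List MS) :
    (keys ((Name.sess s true i).assign Ms +
      (Name.sess s false i).assign (Ms.map MS.dual))).Nodup := by
  rw [keys_add]
  refine Multiset.nodup_add.2 ⟨Name.nodup_assign _ _, Name.nodup_assign _ _,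
    Multiset.disjoint_left.2 fun hv hv2 => ?_⟩
  obtain ⟨j, rfl⟩ := Name.mem_keys_assign hv
  obtain ⟨j2, e⟩ := Name.mem_keys_assign hv2
  simp [Name.shift] at e

namespace BreakdownTypable

theorem abs {Γ : SCtx} {Λ : LEnv} {Δ : SEnv} {y : ℕ} {C : CTy} {P : Proc}
    (hP : HasP (Γ.bindName (pname y) C) Λ (sessPart (pname y) C + Δ) P)
    (ih : Proc.BreakdownTypable (Γ.bindName (pname y) C) Λ (sessPart (pname y) C + Δ) P) :
    Val.BreakdownTypable Γ Λ Δ (.abs .lin y C P) (.ho .lin C) := by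
  intro f d k xs X N τ hA hd hB hU hxs hX hτ
  have wP := hP.wellFormed
  have hyΔ := wP.bindName.2
  -- The bound name `y` becomes `y_1`, whose root is new by the convention on bound names.
  set w : Name := .var (.src y) 1 with hw
  set f' : Name → Name := Name.subst (pname y) w ∘ Name.avoid {pname y} f with hf'
  have hr : ∀ j, Root.sess (.aux j) ≠ .var (.src y) ∧ Root.var (.aux j) ≠ .var (.src y) := by simp
  have hwr : w.root ∉ allowedRoots k X := notMem_allowedRoots hB.1 hr
  have hf'y : f' (pname y) = w := Name.subst_avoid_self
  have hcf : Name.CaptureFree f' := (hA.captureFree.avoid _).subst _ le_rfl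
  have hf'ne : ∀ v, v ≠ pname y → 1 ≤ (f v).idx → f' v = f v := fun v hv hi =>
    Name.subst_avoid_of_ne hv (Name.ne_of_idx hi rfl)
  have hD : SEnv.decomp f' (d.erase (pname y)) (sessPart (pname y) C + Δ) =
      sessParts (w.params C.G) + SEnv.decomp f d Δ := by
    rw [SEnv.decomp_add]
    congr 1
    · cases C with
      | sess S =>
        rw [CTy.G, Name.sessParts_params_sess, sessPart, ← Multiset.cons_zero,
          SEnv.decomp_cons (by simp), SEnv.decomp_zero, add_zero, hf'y]
      | chan U => rfl
    · refine (SEnv.decomp_congr (fun v hv => ?_) fun v hv hvd => ?_).symm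
      · have : v ≠ pname y := fun e => hyΔ (e ▸ hv)
        simp [this]
      · exact (hf'ne v (fun e => hyΔ (e ▸ hv)) (hA.mem_idx (SEnv.mem_keys_decomp hv hvd)).1).symm
  have hA' : Admissible k (insert (.var (.src y)) X) f' (Γ.bindName (pname y) C).name
      (bindTargetNames N (w.params C.G)) (sessParts (w.params C.G) + SEnv.decomp f d Δ) := by
    refine hA.extend le_rfl (Set.subset_insert _ _) (aux_notMem_insert hA.aux_notMem hr) hcf le_rfl
      ?_ ?_ (fun v hv => Name.bindNames_params_of_root fun e => hwr (e ▸ hv)) ?_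
      (fun v hv => (Name.bindNames_params_of_isSession hv).trans (hA.none_of_isSession v hv))
    · cases C with
      | sess S => exact Name.sessParts_params_sess w S.G ▸ Name.nodup_assign _ _
      | chan U => simp [CTy.G, Name.params, Name.block_succ, sessParts, keys]
    · cases C with
      | sess S =>
        rw [CTy.G, Name.sessParts_params_sess]
        intro v hv
        obtain ⟨j, rfl⟩ := Name.mem_keys_assign hv
        exact ⟨_, rfl, by simp [hw, Name.shift, Name.idx],
          Or.inl (by simp [hw, Name.shift, Name.root]),
          by rwa [Name.root_shift], id, Name.bindNames_params_sess hv⟩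
      | chan U => simp [CTy.G, Name.params, Name.block_succ, sessParts, keys]
    · intro u U hu
      by_cases huy : u = pname y
      · subst huy
        cases C with
        | sess S => simp [SCtx.bindName] at hu
        | chan U' =>
          obtain rfl : U' = U := by simpa [SCtx.bindName] using hu
          refine Or.inr ⟨?_, ?_, ?_⟩
          · simp [hf'y, bindTargetNames, TCtx.bindNames, CTy.G, Name.params, Name.block_succ]
          · simp [hf'y, hw, Name.idx]
          · rw [hf'y]
            exact Or.inl (Set.mem_insert _ _)
      · have hu' : Γ.name u = some U := by
          cases C <;> simpa [SCtx.bindName, huy] using hu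
        exact Or.inl ⟨hf'ne u huy (hA.shared_name u U hu').2.1, hu'⟩
  have hdis : Discardable (sessPart (pname y) C + Δ) (d.erase (pname y)) P.fn := by
    intro v S hv hvd
    obtain ⟨hvy, hvd⟩ := Finset.mem_erase.1 hvd
    have hv' : (v, S) ∈ Δ := by
      rcases Multiset.mem_add.1 hv with hv | hv
      · cases C with
        | sess S' =>
          rw [sessPart, Multiset.mem_singleton] at hv
          exact absurd (Prod.mk.inj hv).1 hvy
        | chan U => simp [sessPart] at hv
      · exact hv
    have := hd v S hv' hvd
    simpa [Val.fn, hvy] using this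
  have hτ' : ∀ x ∈ P.fv, AssignedType (Γ.bindName (pname y) C) Λ x (τ x) := by
    intro x hx
    have := hτ x hx
    rwa [AssignedType, ← SCtx.bindName_var Γ (pname y) C] at this
  rw [← hD] at hA'
  obtain ⟨T, hT, t⟩ := ih f' (d.erase (pname y)) k xs _ _ τ hA' hdis hB.2 hU hxs hX
    fun x hx => (hτ' x hx).receivable
  refine ⟨T, fun _ => hT, fun Γt hΓt hV => ?_⟩
  subst hΓt
  have t := t (Γt.bindNames (w.params C.G)) (bindNames_name _ _)
  rw [hD] at t hA'
  simp only [Val.rename, Val.breakdown, Val.degree, Proc.rename_rename _ (hA.captureFree.avoid _),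
    reduceCtorEq, if_false]
  refine .abs_params C.G_ne_nil ?_
  rw [← add_assoc]
  refine THasP.start (Γt := Γt.bindNames (w.params C.G)) hA' wP hxs hX hτ' ?_ hT
    (by have := P.degree_pos; omega) t
  intro x hx
  rw [SCtx.bindName_var]
  exact hV x hx

theorem resC {Γ : SCtx} {Λ : LEnv} {Δ : SEnv} {a : ℕ} {U : HOTy} {P : Proc}
    (hP : HasP (Γ.bindName (aname a) (.chan U)) Λ Δ P)
    (ih : Proc.BreakdownTypable (Γ.bindName (aname a) (.chan U)) Λ Δ P) :
    Proc.BreakdownTypable Γ Λ Δ (.resC a U P) := by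
  intro f d k xs X N τ hA hd hB hU hxs hX hτ
  have wP := hP.wellFormed
  have haΔ : aname a ∉ keys Δ := fun h => by
    have := wP.name_none _ h
    simp [SCtx.bindName] at this
  set w : Name := .shared a 1 with hw
  set f' : Name → Name := Name.subst (aname a) w ∘ Name.avoid {aname a} f with hf'
  have hr : ∀ j, Root.sess (.aux j) ≠ .shared a ∧ Root.var (.aux j) ≠ .shared a := by simp
  have hwr : w.root ∉ allowedRoots k X := notMem_allowedRoots hB.1 hr
  have hf'a : f' (aname a) = w := Name.subst_avoid_self
  have hcf : Name.CaptureFree f' := (hA.captureFree.avoid _).subst _ le_rfl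
  have hf'ne : ∀ v, v ≠ aname a → 1 ≤ (f v).idx → f' v = f v := fun v hv hi =>
    Name.subst_avoid_of_ne hv (Name.ne_of_idx hi rfl)
  have hD : SEnv.decomp f' d Δ = SEnv.decomp f d Δ :=
    (SEnv.decomp_congr (fun _ _ => Iff.rfl) fun v hv hvd =>
      (hf'ne v (fun e => haΔ (e ▸ hv)) (hA.mem_idx (SEnv.mem_keys_decomp hv hvd)).1).symm).symm
  have hA' : Admissible k (insert (.shared a) X) f' (Γ.bindName (aname a) (.chan U)).name
      (bindTargetNames N [(.src w, .chan U.G)]) (SEnv.decomp f d Δ) := by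
    have hne : ∀ v : TName, v ≠ .src w →
        bindTargetNames N [(.src w, .chan U.G)] v = N v := fun v hv =>
      TCtx.bindNames_of_notMem (by simpa using hv.symm)
    have := hA.extend (B := 0) (f' := f') (N' := (Γ.bindName (aname a) (.chan U)).name)
      (Nt' := bindTargetNames N [(.src w, .chan U.G)]) le_rfl (Set.subset_insert (.shared a) _)
      (aux_notMem_insert hA.aux_notMem hr) hcf le_rfl (by simp [keys]) (by simp [keys])
      (fun v hv => hne _ fun e => hwr (TName.src.inj e ▸ hv)) ?_ ?_
    · rwa [zero_add] at this
    · intro u U' hu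
      by_cases hua : u = aname a
      · subst hua
        obtain rfl : U = U' := by simpa [SCtx.bindName] using hu
        refine Or.inr ⟨?_, ?_, ?_⟩
        · simp [hf'a, bindTargetNames, TCtx.bindNames]
        · simp [hf'a, hw, Name.idx]
        · rw [hf'a]
          exact Or.inl (Set.mem_insert _ _)
      · have hu' : Γ.name u = some U' := by simpa [SCtx.bindName, hua] using hu
        exact Or.inl ⟨hf'ne u hua (hA.shared_name u U' hu').2.1, hu'⟩
    · intro v hv
      rw [hne v (by rintro rfl; exact hv)]
      exact hA.none_of_isSession v hv
  have hdis : Discardable Δ d P.fn := by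
    intro v S hv hvd
    have hva : v ≠ aname a := fun e => haΔ (e ▸ mem_keys.2 ⟨S, hv⟩)
    simpa [Proc.fn, hva] using hd v S hv hvd
  rw [← hD] at hA' ⊢
  obtain ⟨T, hT, t⟩ := ih f' d k xs _ _ τ hA' hdis hB.2 hU hxs hX hτ
  refine ⟨T, hT, fun Γt hΓt => ?_⟩
  subst hΓt
  simp only [Proc.rename, Proc.breakdown, Proc.degree,
    Proc.rename_rename _ (hA.captureFree.avoid _)]
  exact .resC trivial (t _ (bindNames_name _ _))

theorem resS {Γ : SCtx} {Λ : LEnv} {Δ : SEnv} {s : ℕ} {S : STy} {P : Proc}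
    (hP : HasP Γ Λ ((sname s true, S) ::ₘ (sname s false, S.dual) ::ₘ Δ) P)
    (ih : Proc.BreakdownTypable Γ Λ ((sname s true, S) ::ₘ (sname s false, S.dual) ::ₘ Δ) P) :
    Proc.BreakdownTypable Γ Λ Δ (.resS s S P) := by
  intro f d k xs X N τ hA hd hB hU hxs hX hτ
  have wP := hP.wellFormed
  have hsΔ : sname s true ∉ keys Δ ∧ sname s false ∉ keys Δ := by
    have := wP.nodup
    simp only [keys_cons, Multiset.nodup_cons, Multiset.mem_cons, not_or] at this
    exact ⟨this.1.2, this.2.1⟩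
  have hsΓ : ∀ p, Γ.name (sname s p) = none := fun p =>
    wP.name_none _ (by cases p <;> simp [keys_cons])
  set bs : Finset Name := {sname s true, sname s false} with hbs
  set f' : Name → Name := Name.openSession s ∘ Name.avoid bs f with hf'
  have hr : ∀ j, Root.sess (.aux j) ≠ .sess (.src s) ∧ Root.var (.aux j) ≠ .sess (.src s) := by simp
  have hwr : Root.sess (.src s) ∉ allowedRoots k X := notMem_allowedRoots hB.1 hr
  have hf's : ∀ p, f' (sname s p) = .sess (.src s) p 1 := by
    intro p
    cases p <;> simp [hf', hbs, Name.avoid, Name.openSession]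
  have hcf : Name.CaptureFree f' := (hA.captureFree.avoid _).openSession _
  have hf'ne : ∀ v, v ∉ bs → 1 ≤ (f v).idx → f' v = f v := fun v hv hi => by
    simp [hf', Name.avoid, hv, Name.openSession_of_idx s hi]
  have hΔbs : ∀ v ∈ keys Δ, v ∉ bs := by
    intro v hv hvb
    rw [hbs, Finset.mem_insert, Finset.mem_singleton] at hvb
    rcases hvb with rfl | rfl
    · exact hsΔ.1 hv
    · exact hsΔ.2 hv
  have hD : SEnv.decomp f' (d \ bs) ((sname s true, S) ::ₘ (sname s false, S.dual) ::ₘ Δ) =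
      ((Name.sess (.src s) true 1).assign S.G +
        (Name.sess (.src s) false 1).assign (S.G.map MS.dual)) + SEnv.decomp f d Δ := by
    rw [SEnv.decomp_cons (by simp [hbs]), SEnv.decomp_cons (by simp [hbs]), hf's, hf's, STy.G_dual,
      add_assoc]
    congr 2
    refine (SEnv.decomp_congr (fun v hv => ?_) fun v hv hvd => ?_).symm
    · simp [hΔbs v hv]
    · exact (hf'ne v (hΔbs v hv) (hA.mem_idx (SEnv.mem_keys_decomp hv hvd)).1).symm
  have hA' : Admissible k (insert (.sess (.src s)) X) f' Γ.name N
      (((Name.sess (.src s) true 1).assign S.G +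
        (Name.sess (.src s) false 1).assign (S.G.map MS.dual)) + SEnv.decomp f d Δ) := by
    refine hA.extend le_rfl (Set.subset_insert _ _) (aux_notMem_insert hA.aux_notMem hr) hcf le_rfl
      (Name.nodup_assign_add_dual _ _ _) ?_ (fun _ _ => rfl) ?_ hA.none_of_isSession
    · intro v hv
      have : ∃ p j, v = .src ((Name.sess (.src s) p 1).shift j) := by
        rcases Multiset.mem_add.1 (keys_add _ _ ▸ hv) with hv | hv
        · exact ⟨true, Name.mem_keys_assign hv⟩
        · exact ⟨false, Name.mem_keys_assign hv⟩
      obtain ⟨p, j, rfl⟩ := this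
      exact ⟨_, rfl, by simp [Name.shift, Name.idx], Or.inl (by simp [Name.shift, Name.root]),
        hwr, id, hA.none_of_isSession _ trivial⟩
    · intro u U hu
      have hub : u ∉ bs := by
        rw [hbs, Finset.mem_insert, Finset.mem_singleton]
        rintro (rfl | rfl)
        · simp [hsΓ true] at hu
        · simp [hsΓ false] at hu
      exact Or.inl ⟨hf'ne u hub (hA.shared_name u U hu).2.1, hu⟩
  have hdis : Discardable ((sname s true, S) ::ₘ (sname s false, S.dual) ::ₘ Δ) (d \ bs) P.fn := by
    intro v S' hv hvd
    obtain ⟨hvd, hvb⟩ := Finset.mem_sdiff.1 hvd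
    have hv' : (v, S') ∈ Δ := by
      rw [hbs, Finset.mem_insert, Finset.mem_singleton, not_or] at hvb
      simpa [hvb.1, hvb.2] using hv
    have := hd v S' hv' hvd
    simp only [Proc.fn, ← hbs, Finset.mem_sdiff, hvb, not_false_eq_true, and_true] at this
    exact this
  rw [← hD] at hA'
  obtain ⟨T, hT, t⟩ := ih f' (d \ bs) k xs _ _ τ hA' hdis hB.2 hU hxs hX hτ
  refine ⟨T, hT, fun Γt hΓt => ?_⟩
  have t := t Γt hΓt
  rw [hD] at t
  simp only [Proc.rename, Proc.breakdown, Proc.degree,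
    Proc.rename_rename _ (hA.captureFree.avoid _)]
  refine THasP.resBlock _ _ _ (t.cast_env rfl ?_)
  rw [add_assoc, add_assoc]

end BreakdownTypable

/-! ### Branching and selection -/

namespace BreakdownTypable

theorem bra {Γ : SCtx} {Λ : LEnv} {Δ : SEnv} {u : Name} {I : Finset Label} {S : I → STy}
    {P : I → Proc} (hI : I.Nonempty) (hP : ∀ l, HasP Γ Λ ((u, S l) ::ₘ Δ) (P l))
    (ih : ∀ l, Proc.BreakdownTypable Γ Λ ((u, S l) ::ₘ Δ) (P l)) :
    Proc.BreakdownTypable Γ Λ ((u, .bra I S) ::ₘ Δ) (.bra u I S P) := by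
  intro f d k xs X N τ hA hd hB hU hxs hX hτ
  have w := (HasP.bra hI hP).wellFormed
  have hud : u ∉ d := hd.notMem (Multiset.mem_cons_self _ _) (by simp [Proc.fn])
  have hne : ∀ v ∈ keys Δ, v ∉ d → f v ≠ f u :=
    fun v hv hvd => SEnv.ne_of_nodup_decomp hud hA.nodup hv hvd
  set M : I → MS := fun l => .out [.ho .lin ((S l).G.map .sess)] with hM
  have hD : SEnv.decomp f d ((u, .bra I S) ::ₘ Δ) =
      (.src (f u), .bra I M) ::ₘ SEnv.decomp f d Δ := by
    rw [SEnv.decomp_cons hud, STy.G, Name.assign_cons, Name.assign_nil, Multiset.cons_add, zero_add]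
  rw [hD] at hA ⊢
  have hu : TName.src (f u) ∈ keys ((TName.src (f u), MS.bra I M) ::ₘ SEnv.decomp f d Δ) := by
    simp [keys_cons]
  have hnd := hA.nodup
  rw [keys_cons] at hnd
  refine ⟨fun _ => .inp (payload (xs.map τ)), rfl, fun Γt hΓt => ?_⟩
  simp only [Proc.rename, Proc.breakdown, Proc.degree, Proc.degree_rename, Proc.fvs_rename,
    Proc.rename_rename _ hA.captureFree]
  rw [propsIn_cons _ (by omega), propsIn_self, propsOut_self, add_zero, add_comm _ (_ ::ₘ 0),
    Multiset.cons_add, zero_add]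
  refine .ctxIn w hxs hX hτ (hΓt ▸ hA.none_of_isSession _ trivial) (hA.notMem_prop _ _)
    fun Γt' hΓt' hV => .bra hI fun l => ?_
  rw [hΓt] at hΓt'
  subst hΓt'
  have wl := (hP l).wellFormed
  obtain ⟨τl, hτl⟩ := wl.exists_assignedType
  have hfv : (P l).fv ⊆ (Proc.bra u I S P).fv :=
    Finset.subset_biUnion_of_mem (fun l : I => (P l).fv) (Finset.mem_univ l)
  have hfn : (P l).fn ⊆ (Proc.bra u I S P).fn :=
    (Finset.subset_biUnion_of_mem (fun l : I => (P l).fn) (Finset.mem_univ l)).trans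
      Finset.subset_union_right
  -- The parameters of `N_l` are reserved for the index `k`, so that they differ from all names in
  -- use.
  set p : Name := .var (.aux k) 1 with hp
  have hpr : p.root ∉ allowedRoots k X := (notMem_allowedRoots_aux hA.aux_notMem).2
  have hDl : SEnv.decomp (Name.subst (f u) p ∘ f) d ((u, S l) ::ₘ Δ) =
      p.assign (S l).G + SEnv.decomp f d Δ := SEnv.decomp_subst hud hne
  have hA' : Admissible (k + 1) X (Name.subst (f u) p ∘ f) Γ.name
      (bindTargetNames Γt'.name (p.params ((S l).G.map .sess)))
      (p.assign (S l).G + SEnv.decomp f d Δ) := by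
    refine hA.extend (by omega) subset_rfl hA.aux_notMem (hA.captureFree.subst _ le_rfl)
      (Multiset.le_cons_self _ _) (Name.nodup_assign _ _) ?_
      (fun v hv => Name.bindNames_params_of_root fun e => hpr (e ▸ hv))
      (fun v U hv => Or.inl ⟨hA.subst_of_shared hu v U hv, hv⟩)
      (fun v hv => (Name.bindNames_params_of_isSession hv).trans (hA.none_of_isSession v hv))
    intro v hv
    obtain ⟨j, rfl⟩ := Name.mem_keys_assign hv
    exact ⟨_, rfl, by simp [hp, Name.shift, Name.idx],
      Or.inr ⟨k, by omega, Or.inr (by simp [hp, Name.shift, Name.root])⟩,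
      by rwa [Name.root_shift], id, Name.bindNames_params_sess hv⟩
  obtain ⟨T, hT, t⟩ := ih l (Name.subst (f u) p ∘ f) d (k + 1) (P l).fvs X _ τl (hDl ▸ hA')
    (fun v S' hv hvd => by
      rcases Multiset.mem_cons.1 hv with hv | hv
      · exact absurd ((Prod.mk.inj hv).1 ▸ hvd) hud
      · have := hd v S' (by simp [hv]) hvd
        exact ⟨this.1, fun h => this.2 (hfn h)⟩)
    (hB l) (hU l) (P l).nodup_fvs (P l).mem_fvs fun x hx => (hτl x hx).receivable
  have t := t (Γt'.bindNames (p.params ((S l).G.map .sess))) (bindNames_name _ _)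
  rw [hDl] at t
  have hbody := THasP.start (Γt := Γt'.bindNames (p.params ((S l).G.map .sess))) hA' wl
    (P l).nodup_fvs (P l).mem_fvs hτl (hV.mono hfv) hT
    (by have := (P l).degree_pos; omega) t
  have habs : THasV Γt' (LEnv.G Λ) (SEnv.decomp f d Δ) (.abs .lin (p.params ((S l).G.map .sess))
      (resProps (k + 1) (P l).degree (.par (ctxOut (k + 1) (P l).fvs .nil)
        (((P l).rename (Name.subst (f u) p ∘ f)).breakdown (k + 1) (P l).fvs))))
      (.ho .lin ((S l).G.map .sess)) := by
    refine .abs_params (by simpa using (S l).G_ne_nil) (.resProps (T := T) _ _ ?_)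
    rw [Name.sessParts_params_sess]
    exact hbody
  have := THasP.send_fin (hA.not_shared hu) (hA.sess_none _ hu) (by simp) .nil
    (.single habs (LEnv.nodup_keys_G w.nodup_lin) (Multiset.nodup_cons.1 hnd).2)
    (by simpa using LEnv.nodup_keys_G w.nodup_lin) (by simpa using hnd)
  simpa [Name.params, Name.block1, Name.shift, hM, hp] using this

theorem sel {Γ : SCtx} {Λ : LEnv} {Δ : SEnv} {u : Name} {I : Finset Label} {S : I → STy} {l : I}
    {P : Proc} (hP : HasP Γ Λ ((u, S l) ::ₘ Δ) P)
    (ih : Proc.BreakdownTypable Γ Λ ((u, S l) ::ₘ Δ) P) :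
    Proc.BreakdownTypable Γ Λ ((u, .sel I S) ::ₘ Δ) (.sel u I S l P) := by
  intro f d k xs X N τ hA hd hB hU hxs hX hτ
  have w := (HasP.sel hP).wellFormed
  have wP := hP.wellFormed
  have hud : u ∉ d := hd.notMem (Multiset.mem_cons_self _ _) (by simp [Proc.fn])
  have hne : ∀ v ∈ keys Δ, v ∉ d → f v ≠ f u :=
    fun v hv hvd => SEnv.ne_of_nodup_decomp hud hA.nodup hv hvd
  set M : I → MS := fun l => .inp [.ho .lin (((S l).G.map MS.dual).map .sess)] with hM
  set D₀ := SEnv.decomp f d Δ with hD₀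
  have hD : SEnv.decomp f d ((u, .sel I S) ::ₘ Δ) = (.src (f u), .sel I M) ::ₘ D₀ := by
    rw [SEnv.decomp_cons hud, STy.G, Name.assign_cons, Name.assign_nil, Multiset.cons_add, zero_add]
  rw [hD] at hA ⊢
  have hu : TName.src (f u) ∈ keys ((TName.src (f u), MS.sel I M) ::ₘ D₀) := by
    simp [keys_cons]
  obtain ⟨haux₁, haux₂⟩ := notMem_allowedRoots_aux (k := k) hA.aux_notMem
  -- The continuation `P` uses the new names `s_1, …`; the abstraction that performs the selection
  -- is applied to their duals.
  set A₁ := (Name.sess (.aux k) true 1).assign (S l).G with hA₁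
  set A₂ := (Name.sess (.aux k) false 1).assign ((S l).G.map MS.dual) with hA₂
  set f' := Name.subst (f u) (.sess (.aux k) true 1) ∘ f with hf'
  have hD' : SEnv.decomp f' d ((u, S l) ::ₘ Δ) = A₁ + D₀ := SEnv.decomp_subst hud hne
  have hA' : Admissible (k + 2) X f' Γ.name N ((A₁ + A₂) + D₀) := by
    refine hA.extend (by omega) subset_rfl hA.aux_notMem (hA.captureFree.subst _ le_rfl)
      (Multiset.le_cons_self _ _) (Name.nodup_assign_add_dual _ _ _) ?_ (fun _ _ => rfl)
      (fun v U hv => Or.inl ⟨hA.subst_of_shared hu v U hv, hv⟩) hA.none_of_isSession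
    intro v hv
    have : ∃ p j, v = .src ((Name.sess (.aux k) p 1).shift j) := by
      rcases Multiset.mem_add.1 (keys_add _ _ ▸ hv) with hv | hv
      · exact ⟨true, Name.mem_keys_assign hv⟩
      · exact ⟨false, Name.mem_keys_assign hv⟩
    obtain ⟨p, j, rfl⟩ := this
    exact ⟨_, rfl, by simp [Name.shift, Name.idx],
      Or.inr ⟨k, by omega, Or.inl (by simp [Name.shift, Name.root])⟩,
      haux₁, id, hA.none_of_isSession _ trivial⟩
  obtain ⟨τP, hτP⟩ := wP.exists_assignedType
  obtain ⟨TP, hTP, tP⟩ := ih f' d (k + 2) xs X N τP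
    (hD' ▸ hA'.le le_rfl (add_le_add_left (Multiset.le_add_right _ _) _))
    (fun v S' hv hvd => by
      rcases Multiset.mem_cons.1 hv with hv | hv
      · exact absurd ((Prod.mk.inj hv).1 ▸ hvd) hud
      · have := hd v S' (by simp [hv]) hvd
        simp only [Proc.fn, Finset.mem_union, not_or] at this
        exact ⟨this.1, this.2.2⟩)
    hB hU hxs hX fun x hx => (hτP x hx).receivable
  rw [hD'] at tP
  set M₁ : MS := .inp [.ho .lin (((S l).G.map MS.dual).map .sess)] with hM₁
  set Cs : List MC := ((S l).G.map MS.dual).map .sess with hCs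
  have hCs0 : Cs ≠ [] := by simpa [hCs] using (S l).G_ne_nil
  refine ⟨glue k (k + 1 + 1) (.inp (payload (xs.map τ))) (fun _ => M₁) TP, glue_self _ _ _ _ _,
    fun Γt hΓt => ?_⟩
  have hpos := P.degree_pos
  have hN := hA.nodup_props
    (glue k (k + 1 + 1) (.inp (payload (xs.map τ))) (fun _ => M₁) TP)
    (glue k (k + 1 + 1) (.inp (payload (xs.map τ))) (fun _ => M₁) TP)
    k (k + (P.degree + 2)) (k + 1) (k + (P.degree + 2))
  have hN' := hA'.nodup_props (glue k (k + 1 + 1) (.inp (payload (xs.map τ))) (fun _ => M₁) TP)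
    (glue k (k + 1 + 1) (.inp (payload (xs.map τ))) (fun _ => M₁) TP)
    k (k + (P.degree + 2)) (k + 1) (k + (P.degree + 2))
  simp only [Proc.rename, Proc.breakdown, Proc.degree, Proc.rename_rename _ hA.captureFree]
  rw [propsIn_glue _ _ _ (by omega) (by omega), propsOut_glue _ _ _ (by omega) (by omega),
    propsIn_cons (fun _ => M₁) (by omega), propsIn_self, propsOut_cons (fun _ => M₁) (by omega),
    propsOut_self, propsOut_cons TP (by omega), hTP,
    show k + (P.degree + 2) = k + 2 + P.degree by omega, show k + 1 + 1 = k + 2 from rfl]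
    at hN hN' ⊢
  -- The abstraction that performs the selection. Its parameters stand for the duals of the names
  -- that the continuation uses.
  have hsel : ∀ Γt' : TCtx, Γt'.name = Γt.name → VarsAgree Γ Γt' P.fv →
      THasV Γt' (LEnv.G Λ) ((.src (f u), .sel I M) ::ₘ
          (.prop (k + 2) false, .out (payload (xs.map τP))) ::ₘ 0)
        (.abs .lin ((Name.var (.aux k) 1).params Cs) (.sel (.src (f u)) l.1
          (.inp (.src (f u)) [.aux] (ctxOut (k + 2) xs
            (.app (.var .aux) ((Name.var (.aux k) 1).block (S l).G.length))))))
        (.ho .lin Cs) := by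
    intro Γt' hΓt' hV'
    rw [hΓt] at hΓt'
    subst hΓt'
    refine .abs_params hCs0 ?_
    rw [hCs, Name.sessParts_params_sess]
    set A₃ := (Name.var (.aux k) 1).assign ((S l).G.map MS.dual) with hA₃
    set Γy := Γt'.bindNames ((Name.var (.aux k) 1).params (((S l).G.map MS.dual).map .sess))
      with hΓy
    have hfresh : TName.src (f u) ∉ keys A₃ := by
      intro h
      obtain ⟨j, e⟩ := Name.mem_keys_assign h
      have := (hA.mem_idx hu).2
      rw [TName.src.inj e, Name.root_shift] at this
      exact haux₂ this
    have hprop : TName.prop (k + 2) false ∉ keys A₃ := by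
      intro h
      obtain ⟨j, e⟩ := Name.mem_keys_assign h
      cases e
    have hΓyu : Γy.name (.src (f u)) = none := by
      rw [hΓy, Name.bindNames_params_of_root, hA.sess_none _ hu]
      intro e
      have := (hA.mem_idx hu).2
      rw [e] at this
      exact haux₂ this
    have hΓyp : Γy.name (.prop (k + 2) false) = none := by
      rw [hΓy, Name.bindNames_params_of_isSession (v := .prop (k + 2) false) trivial]
      exact hA.none_of_isSession (.prop (k + 2) false) trivial
    have happ : THasP (Γy.bindVars [(.aux, .ho .lin Cs)]) {(.aux, Cs)} (0 + A₃)
        (.app (.var .aux) ((Name.var (.aux k) 1).block (S l).G.length)) := by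
      refine .app hCs0 (.lvar (by simp [TCtx.bindVars])) ?_ ?_
      · have := THasNs.block (Γ := Γy.bindVars [(.aux, .ho .lin Cs)]) (Name.var (.aux k) 1)
          ((S l).G.map MS.dual) fun v hv => ⟨by
            obtain ⟨j, rfl⟩ := Name.mem_keys_assign hv
            exact id, Name.bindNames_params_sess hv⟩
        rwa [List.length_map] at this
      · rw [zero_add]
        exact Name.nodup_assign _ _
    rw [zero_add] at happ
    have hVy : VarsAgree Γ (Γy.bindVars [(.aux, .ho .lin Cs)]) P.fv := by
      intro x hx
      have : (TVar.src x == TVar.aux) = false := rfl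
      have hx' : Γy.var (.src x) = (Γ.var x).map CTy.G := hV' x hx
      simpa [TCtx.bindVars, List.lookup_cons, this] using hx'
    have hout := THasP.ctxOut (Γt := Γy.bindVars [(.aux, .ho .lin Cs)]) (j := k + 2) wP hxs hX hτP
      hΓyp hVy happ ?_ ?_
    · have hin := THasP.rcv_fin (u := .src (f u)) (hA.not_shared hu) hΓyu
        (Us := [.ho .lin Cs]) (by simp) (xs := [.aux]) (by simp) (by simp) ?_ hout
      · refine (THasP.sel (M := M) (l := l) hin).cast_env rfl ?_
        simp only [← Multiset.singleton_add]
        abel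
      · simpa [keys_cons] using hfresh
    · rw [keys_add, keys_singleton, Multiset.singleton_add, Multiset.nodup_cons, LEnv.keys_G]
      exact ⟨by simp, LEnv.keys_G Λ ▸ LEnv.nodup_keys_G wP.nodup_lin⟩
    · exact Multiset.nodup_cons.2 ⟨hprop, Name.nodup_assign _ _⟩
  have hleft : ∀ Γt' : TCtx, Γt'.name = Γt.name → VarsAgree Γ Γt' P.fv →
      THasP Γt' (LEnv.G Λ) ((.prop (k + 1) false, .out [.ho .lin Cs]) ::ₘ
          (.src (f u), .sel I M) ::ₘ (.prop (k + 2) false, .out (payload (xs.map τP))) ::ₘ 0)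
        (.out (.prop (k + 1) false) [.abs .lin ((Name.var (.aux k) 1).params Cs)
          (.sel (.src (f u)) l.1 (.inp (.src (f u)) [.aux] (ctxOut (k + 2) xs
            (.app (.var .aux) ((Name.var (.aux k) 1).block (S l).G.length)))))] .nil) := by
    intro Γt' hΓt' hV'
    have hnd : ((.prop (k + 1) false : TName) ::ₘ keys ((TName.src (f u), MS.sel I M) ::ₘ
        ((TName.prop (k + 2) false, MS.out (payload (xs.map τP))) ::ₘ 0))).Nodup := by
      simp [keys_cons, keys_singleton]
    have := THasP.send_fin (u := .prop (k + 1) false) id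
      (by rw [hΓt', hΓt]; exact hA.none_of_isSession _ trivial) (by simp) .nil
      (.single (hsel Γt' hΓt' hV') (LEnv.nodup_keys_G w.nodup_lin) (Multiset.nodup_cons.1 hnd).2)
      (by simpa using LEnv.nodup_keys_G w.nodup_lin) (by simpa using hnd)
    simpa using this
  have hnames : ∀ v ∈ keys A₂, ¬ v.IsShared ∧ Γt.name v = none := by
    intro v hv
    obtain ⟨j, rfl⟩ := Name.mem_keys_assign hv
    exact ⟨id, hΓt ▸ hA.none_of_isSession _ trivial⟩
  -- In parallel with the continuation, that abstraction is received on `c_{k+1}` and applied.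
  have hhand : THasP Γt 0 ((.prop (k + 1) true, M₁) ::ₘ A₂)
      (.inp (.prop (k + 1) true) [.aux]
        (.app (.var .aux) ((Name.sess (.aux k) false 1).block (S l).G.length))) := by
    refine .rcv_fin id (hΓt ▸ hA.none_of_isSession _ trivial) (by simp) (by simp) (by simp) ?_ ?_
    · intro h
      obtain ⟨j, e⟩ := Name.mem_keys_assign h
      cases e
    · have := THasP.app (Γ := Γt.bindVars [(.aux, .ho .lin Cs)]) (Λ := {(.aux, Cs)}) (Δ₁ := 0) hCs0
        (.lvar (by simp [TCtx.bindVars]))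
        (.block (Name.sess (.aux k) false 1) ((S l).G.map MS.dual) fun v hv => hnames v hv)
        (by rw [zero_add]; exact Name.nodup_assign _ _)
      rw [List.length_map] at this
      refine this.cast_env ?_ (by rw [zero_add])
      rw [add_zero]
      rfl
  have hright : THasP Γt 0 ((.prop (k + 1) true, M₁) ::ₘ (D₀ +
      (propsIn TP (k + 2) (k + 2 + P.degree) + propsOut TP (k + 2 + 1) (k + 2 + P.degree))))
      (resBlock (((Name.sess (.aux k) true 1).block (S l).G.length).zip (S l).G)
        (.par (.inp (.prop (k + 1) true) [.aux]
          (.app (.var .aux) ((Name.sess (.aux k) false 1).block (S l).G.length)))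
          ((P.rename f').breakdown (k + 2) xs))) := by
    refine .resBlock _ _ _ ((THasP.par hhand (tP Γt hΓt) (by simp [keys]) ?_).cast_env
      (add_zero 0) ?_)
    · refine nodup_of_count hN' fun a => ?_
      simp only [keys_add, keys_singleton, keys_zero, ← Multiset.singleton_add,
        Multiset.count_add, Multiset.count_zero]
      omega
    · simp only [← Multiset.singleton_add]
      abel
  -- The breakdown annotates the parameters with the decomposition of the dual type.
  have hps : ((Name.var (.aux k) 0).block1 (S l).G.length).zip ((S l).dual.G.map MC.sess) =
      (Name.var (.aux k) 1).params Cs := by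
    simp [Name.params, Name.block1, Name.shift, hCs, STy.G_dual]
  rw [hps]
  refine (THasP.par (.ctxIn w hxs hX hτ
    (by rw [hΓt]; exact hA.none_of_isSession (.prop k true) trivial) ?_ hleft) hright
    (by simp [keys]) ?_).cast_env (add_zero 0) ?_
  · simp [keys_cons, keys_singleton]
  · refine nodup_of_count hN fun a => ?_
    simp only [keys_add, keys_singleton, keys_zero, ← Multiset.singleton_add, Multiset.count_add,
      Multiset.count_zero]
    omega
  · simp only [← Multiset.singleton_add, hM₁, MS.dual]
    abel

end BreakdownTypable

/-! ### The theorem -/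

theorem HasP.breakdownTypable {Γ : SCtx} {Λ : LEnv} {Δ : SEnv} {P : Proc} (h : HasP Γ Λ Δ P) :
    Proc.BreakdownTypable Γ Λ Δ P := by
  refine HasP.rec (motive_1 := fun Γ Λ Δ V U _ => Val.BreakdownTypable Γ Λ Δ V U)
    (motive_2 := fun Γ Λ Δ P _ => Proc.BreakdownTypable Γ Λ Δ P)
    ?lvar ?sh ?prom ?abs ?eprom ?fin ?nil ?app ?par ?resS ?resC ?send ?rcv ?req ?acc ?sel ?bra h
  case lvar => exact BreakdownTypable.lvar
  case sh => exact BreakdownTypable.sh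
  case prom => exact fun _ ih => BreakdownTypable.prom ih
  case abs => exact fun h ih => BreakdownTypable.abs h ih
  case eprom => exact fun hx _ ih => BreakdownTypable.eprom hx ih
  case fin => exact fun _ _ _ _ ih => BreakdownTypable.fin ih
  case nil => exact BreakdownTypable.nil
  case app => exact fun hV hu hn ih => BreakdownTypable.app hV hu hn ih
  case par => exact fun hP hQ hΛ hΔ ih₁ ih₂ => BreakdownTypable.par hP hQ hΛ hΔ ih₁ ih₂
  case resS => exact fun h ih => BreakdownTypable.resS h ih
  case resC => exact fun h ih => BreakdownTypable.resC h ih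
  case send =>
    exact fun e hP hV hΛ hΔ ih₁ ih₂ =>
      BreakdownTypable.send e hP hV (.send e hP hV hΛ hΔ) ih₁ ih₂
  case rcv => exact fun h ih => BreakdownTypable.rcv h ih
  case req => exact fun hu hP hV hn ih₁ ih₂ => BreakdownTypable.req hu hP hV hn ih₁ ih₂
  case acc => exact fun hu h ih => BreakdownTypable.acc hu h ih
  case sel => exact fun h ih => BreakdownTypable.sel h ih
  case bra => exact fun hI h ih => BreakdownTypable.bra hI h ih

theorem HasV.breakdownTypable {Γ : SCtx} {Λ : LEnv} {Δ : SEnv} {V : Val} {U : HOTy}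
    (h : HasV Γ Λ Δ V U) : Val.BreakdownTypable Γ Λ Δ V U := by
  -- The premise of a promotion is about a linear abstraction.
  have hlin : ∀ {Λ Δ V U}, HasV Γ Λ Δ V U → ∀ {y C P}, V = .abs .lin y C P →
      Val.BreakdownTypable Γ Λ Δ V U := by
    intro Λ Δ V U h y C P e
    cases h with
    | abs h => exact BreakdownTypable.abs h h.breakdownTypable
    | _ => cases e
  cases h with
  | lvar hx => exact BreakdownTypable.lvar hx
  | sh hx => exact BreakdownTypable.sh hx
  | prom h => exact BreakdownTypable.prom (hlin h rfl)
  | abs h => exact BreakdownTypable.abs h h.breakdownTypable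

/-- By the conventions, the identity is admissible at the outset. -/
theorem Admissible.of_envOK {Γ : SCtx} {Δ : SEnv} (h : EnvOK Γ Δ)
    (hs : ∀ u ∈ keys Δ, ¬ u.IsShared) (k : ℕ) :
    Admissible k (envRoots Γ Δ) id Γ.name Γ.G.name (SEnv.decomp id ∅ Δ) := by
  have hidx : ∀ u : Name, u.Indexed → 1 ≤ u.idx := by
    intro u hu
    cases u with
    | shared a i => exact hu
    | sess s p i =>
      cases s with
      | src n => exact hu
      | aux n => exact hu.elim
    | var y i =>
      cases y with
      | src n => exact hu
      | aux n => exact hu.elim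
  have haux : ∀ u : Name, u.Indexed → ∀ j, u.root ≠ .sess (.aux j) ∧ u.root ≠ .var (.aux j) := by
    rintro u hu j
    constructor <;> intro e <;> cases u <;> simp only [Name.root, Root.sess.injEq, Root.var.injEq,
      reduceCtorEq] at e
    · subst e
      exact hu
    · subst e
      exact hu
  have hroot : ∀ u : Name, (Γ.name u).isSome ∨ u ∈ keys Δ → u.Indexed := fun u hu =>
    hu.elim (h.indexed_shared u) (h.indexed_session u)
  rw [SEnv.decomp_id]
  refine ⟨fun j => ⟨?_, ?_⟩, fun v => Or.inl rfl, h.nodup, ?_, h.disjoint, ?_, ?_⟩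
  · rintro ⟨u, hu, e⟩
    exact (haux u (hroot u hu) j).1 e
  · rintro ⟨u, hu, e⟩
    exact (haux u (hroot u hu) j).2 e
  · intro v hv
    rw [← SEnv.decomp_id] at hv
    obtain ⟨M, hM⟩ := mem_keys.1 hv
    obtain ⟨p, hp, hM⟩ := Multiset.mem_bind.1 hM
    have hu : p.1 ∈ keys Δ := Multiset.mem_map_of_mem _ hp
    obtain ⟨j, rfl⟩ := Name.mem_keys_assign (mem_keys.2 ⟨M, by simpa using hM⟩)
    refine ⟨_, rfl, ?_, Or.inl ⟨p.1, Or.inr hu, ?_⟩, ?_⟩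
    · have := hidx _ (h.indexed_session _ hu)
      rw [Name.idx_shift]
      exact this.trans (Nat.le_add_right _ _)
    · rw [Name.root_shift]
    · rw [Name.isShared_shift]
      exact hs _ hu
  · intro u U hu
    exact ⟨by simp [SCtx.G, hu], hidx u (h.indexed_shared u (by simp [hu])),
      Or.inl ⟨u, Or.inl (by simp [hu]), rfl⟩⟩
  · intro v hv
    cases v with
    | src u =>
      simp only [SCtx.G, Option.map_eq_none_iff]
      by_contra hne
      exact h.proper u (Option.isSome_iff_ne_none.2 hne) hv
    | prop j p => rfl

theorem HasV.degree_of_shr {Γ : SCtx} {Λ : LEnv} {Δ : SEnv} {V : Val} {C : CTy}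
    (h : HasV Γ Λ Δ V (.ho .shr C)) : V.degree = 0 := by
  cases h <;> rfl

theorem ctxTypes_of_assignedType {Γ : SCtx} {Λ : LEnv} {τ : ℕ → MU} {xs : List ℕ}
    (h : ∀ x ∈ xs, AssignedType Γ Λ x (τ x)) : CtxTypes Γ.G (LEnv.G Λ) xs (xs.map τ) := by
  rw [CtxTypes, List.forall₂_map_left_iff, List.forall₂_map_right_iff, List.forall₂_same]
  intro x hx
  rcases h x hx with ⟨C, hC, e⟩ | ⟨C, hC, e⟩
  · exact Or.inl ⟨C.G, by simp [SCtx.G, hC], e⟩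
  · exact Or.inr ⟨C.G, Multiset.mem_map_of_mem _ hC, e⟩

theorem theoremt :
    (∀ (Γ : SCtx) (Λ : LEnv) (Δ : SEnv) (P : Proc) (k : ℕ) (xs : List ℕ),
      0 < k → Enumerates xs P.fv →
      (∀ u ∈ P.fn, u.Indexed) → EnvOK Γ Δ → P.Barendregt (envRoots Γ Δ) → P.NoUseAfterEnd →
      HasP Γ Λ Δ P →
      ∃ (Θ : TSEnv) (Us : List MU),
        CtxTypes Γ.G (LEnv.G Λ) xs Us ∧
        BalancedEnv Θ ∧
        keys Θ = props true (Finset.Ico k (k + P.degree)) +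
          props false (Finset.Ico (k + 1) (k + P.degree)) ∧
        (.prop k true, .inp (payload Us)) ∈ Θ ∧
        THasP (Γ.eraseVars P.fv).G 0 (SEnv.G Δ + Θ) (P.breakdown k xs)) ∧
    (∀ (Γ : SCtx) (Λ : LEnv) (Δ : SEnv) (V : Val) (C : CTy) (k : ℕ) (xs : List ℕ),
      0 < k → Enumerates xs V.fv →
      (∀ u ∈ V.fn, u.Indexed) → EnvOK Γ Δ → V.Barendregt (envRoots Γ Δ) → V.NoUseAfterEnd →
      HasV Γ Λ Δ V (.ho .lin C) →
      ∃ (Θ : TSEnv) (Us : List MU),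
        CtxTypes Γ.G (LEnv.G Λ) xs Us ∧
        BalancedEnv Θ ∧
        keys Θ = props true (Finset.Ico k (k + V.degree)) +
          props false (Finset.Ico k (k + V.degree)) ∧
        (0 < V.degree → (.prop k true, .inp (payload Us)) ∈ Θ ∧
          (.prop k false, .out (payload Us)) ∈ Θ) ∧
        THasV Γ.G (LEnv.G Λ) (SEnv.G Δ + Θ) (V.breakdown k xs) (.ho .lin C.G)) ∧
    (∀ (Γ : SCtx) (V : Val) (C : CTy) (k : ℕ) (xs : List ℕ),
      0 < k → Enumerates xs V.fv →
      (∀ u ∈ V.fn, u.Indexed) → EnvOK Γ 0 → V.Barendregt (envRoots Γ 0) → V.NoUseAfterEnd →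
      HasV Γ 0 0 V (.ho .shr C) →
      THasV Γ.G 0 0 (V.breakdown k xs) (.ho .shr C.G)) := by
  have hdis : ∀ (Δ : SEnv) (Y : Finset Name), Discardable Δ ∅ Y := fun _ _ v S _ hv =>
    absurd hv (Finset.notMem_empty v)
  refine ⟨?_, ?_, ?_⟩
  · intro Γ Λ Δ P k xs _ hxs _ hE hB hU h
    have w := h.wellFormed
    have hX : ∀ x, x ∈ xs ↔ x ∈ P.fv := fun x => by rw [← hxs.2, List.mem_toFinset]
    obtain ⟨τ, hτ⟩ := w.exists_assignedType
    obtain ⟨T, hT, t⟩ := h.breakdownTypable id ∅ k xs _ Γ.G.name τ (.of_envOK hE w.not_shared k)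
      (hdis _ _) hB hU hxs.1 hX fun x hx => (hτ x hx).receivable
    have hpos := P.degree_pos
    refine ⟨_, xs.map τ, ctxTypes_of_assignedType fun x hx => hτ x ((hX x).1 hx),
      balancedEnv_props T k (k + P.degree) (k + 1) (k + P.degree), ?_, ?_, ?_⟩
    · rw [keys_add, keys_propsIn, keys_propsOut]
    · rw [propsIn_cons T (by omega), hT]
      simp
    · have := t (Γ.eraseVars P.fv).G rfl
      rwa [SEnv.decomp_id, Proc.rename_id] at this
  · intro Γ Λ Δ V C k xs _ hxs _ hE hB hU h
    have w := h.wellFormed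
    have hX : ∀ x, x ∈ xs ↔ x ∈ V.fv := fun x => by rw [← hxs.2, List.mem_toFinset]
    obtain ⟨τ, hτ⟩ := w.exists_assignedType
    obtain ⟨T, hT, t⟩ := h.breakdownTypable id ∅ k xs _ Γ.G.name τ (.of_envOK hE w.not_shared k)
      (hdis _ _) hB hU hxs.1 hX hτ
    refine ⟨_, xs.map τ, ctxTypes_of_assignedType fun x hx => hτ x ((hX x).1 hx),
      balancedEnv_props T k (k + V.degree) k (k + V.degree), ?_, fun hpos => ?_, ?_⟩
    · rw [keys_add, keys_propsIn, keys_propsOut]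
    · rw [propsIn_cons T (by omega), propsOut_cons T (by omega), hT hpos]
      simp [MS.dual]
    · have := t Γ.G rfl fun _ _ => rfl
      rw [SEnv.decomp_id, Val.rename_id] at this
      simpa only [HOTy.G] using this
  · intro Γ V C k xs _ hxs _ hE hB hU h
    have w := h.wellFormed
    have hX : ∀ x, x ∈ xs ↔ x ∈ V.fv := fun x => by rw [← hxs.2, List.mem_toFinset]
    obtain ⟨τ, hτ⟩ := w.exists_assignedType
    obtain ⟨T, -, t⟩ := h.breakdownTypable id ∅ k xs _ Γ.G.name τ (.of_envOK hE w.not_shared k)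
      (hdis _ _) hB hU hxs.1 hX hτ
    have hdeg : V.degree = 0 := h.degree_of_shr
    have := t Γ.G rfl fun _ _ => rfl
    rw [hdeg, add_zero, propsIn_self, propsOut_self, Val.rename_id] at this
    simpa only [HOTy.G, SEnv.decomp_zero, add_zero, LEnv.G, Multiset.map_zero] using this
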